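/- Let $G=\{1,\chi\}$ be a group of order two. A semiring means a commutative semiring with $0$ and $1$. Let $\overline{\mathcal U}_G$ be the category whose objects are finite $G$-sets and whose morphisms from $X$ to $Y$ are isomorphism classes of bispans $(X\xleftarrow{p}A\xrightarrow{q}B\xrightarrow{r}Y)$ of finite $G$-sets and equivariant maps. The composite of $(X_0\xleftarrow{p_0}A_0\xrightarrow{q_0}B_0\xrightarrow{r_0}X_1)$ followed by $(X_1\xleftarrow{p_1}A_1\xrightarrow{q_1}B_1\xrightarrow{r_1}X_2)$ is $(X_0\xleftarrow{p}A\xrightarrow{q}B\xrightarrow{r}X_2)$, where $B=\{(b_1,s)\mid b_1\in B_1,\ s\colon q_1^{-1}\{b_1\}\to B_0,\ r_0s=p_1\}$, $A=\{(a_0,a_1,s)\mid s\colon q_1^{-1}\{q_1(a_1)\}\to B_0,\ r_0s=p_1,\ q_0(a_0)=s(a_1)\}$, $p(a_0,a_1,s)=p_0(a_0)$, $q(a_0,a_1,s)=(q_1(a_1),s)$, $r(b_1,s)=r_1(b_1)$, the maps $s$ are not required to be equivariant, and $G$ acts on them by conjugation. For a $G$-map $f\colon X\to Y$ put $R_f=[Y\xleftarrow{f}X\xrightarrow{1}X\xrightarrow{1}X]$,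 $N_f=[X\xleftarrow{1}X\xrightarrow{f}Y\xrightarrow{1}Y]$ and $T_f=[X\xleftarrow{1}X\xrightarrow{1}X\xrightarrow{f}Y]$. A Tambara functor is a functor $S\colon\overline{\mathcal U}_G\to\mathrm{Sets}$ that preserves finite products (the product of $X$ and $Y$ in $\overline{\mathcal U}_G$ is $X\amalg Y$); morphisms are natural transformations. Each set $S(X)$ has elements and operations $0=T_z()$, $1=N_z()$, $a+b=T_s(a,b)$, $ab=N_s(a,b)$, where $z\colon\emptyset\to X$ is the inclusion and $s\colon X\amalg X\to X$ is the fold map. A Tambara pair consists of semirings $A$ and $B$, an action of $G$ on $A$ by semiring maps (we write $\overline a$ for the image of $a$ under $\chi$), a semiring map $\mathrm{res}\colon B\to A^G$, and functions $\mathrm{trc},\mathrm{nrm}\colon A\to B$ such that $\mathrm{trc}(0)=0$, $\mathrm{trc}(a_0+a_1)=\mathrm{trc}(a_0)+\mathrm{trc}(a_1)$, $\mathrm{trc}(\overline a)=\mathrm{trc}(a)$, $\mathrm{res}(\mathrm{trc}(a))=a+\overline a$, $\mathrm{nrm}(1)=1$, $\mathrm{nrm}(a_0a_1)=\mathrm{nrm}(a_0)\mathrm{nrm}(a_1)$,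 $\mathrm{nrm}(\overline a)=\mathrm{nrm}(a)$, $\mathrm{res}(\mathrm{nrm}(a))=a\,\overline a$, $\mathrm{nrm}(0)=0$, $\mathrm{nrm}(a_0+a_1)=\mathrm{nrm}(a_0)+\mathrm{nrm}(a_1)+\mathrm{trc}(a_0\overline{a_1})$, $\mathrm{trc}(a\,\mathrm{res}(b))=\mathrm{trc}(a)\,b$. Morphisms of Tambara pairs are pairs of semiring maps that commute with the $G$-action, $\mathrm{res}$, $\mathrm{trc}$ and $\mathrm{nrm}$. For a Tambara functor $S$ put $F(S)=(S(G),S(1))$, with the operations $0,1,+,\cdot$ above, with $g\in G$ acting on $S(G)$ by $R_{\rho_g}$, where $\rho_g\colon G\to G$ is the $G$-map $x\mapsto xg$, and with $\mathrm{res}=R_\epsilon$, $\mathrm{trc}=T_\epsilon$, $\mathrm{nrm}=N_\epsilon$, where $\epsilon\colon G\to 1$ is the projection. For a morphism $\phi$ put $F(\phi)=(\phi_G,\phi_1)$. For a Tambara pair $P=(A,B)$ and a finite $G$-set $X$ put $$EP(X)=\{(u,v)\in\mathrm{Map}_G(X,A)\times\mathrm{Map}(X^G,B)\mid u(x)=\mathrm{res}(v(x))\text{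 for all }x\in X^G\}.$$ For a $G$-map $f\colon X\to Y$ choose $X_1\subseteq X$ with $f^{-1}(Y^G)=X^G\amalg X_1\amalg\chi X_1$. Define $R_f(m,n)=(m\circ f,\,n\circ f|_{X^G})$; define $T_f(u,v)=(m,n)$ by $m(y)=\sum_{f(x)=y}u(x)$ for $y\in Y$ and $n(y)=\sum_{x\in X^G,\,f(x)=y}v(x)+\sum_{x\in X_1,\,f(x)=y}\mathrm{trc}(u(x))$ for $y\in Y^G$; and define $N_f(u,v)=(m,n)$ by $m(y)=\prod_{f(x)=y}u(x)$ for $y\in Y$ and $n(y)=\prod_{x\in X^G,\,f(x)=y}v(x)\cdot\prod_{x\in X_1,\,f(x)=y}\mathrm{nrm}(u(x))$ for $y\in Y^G$. A morphism of Tambara pairs acts on $EP(X)$ by composition with $u$ and $v$. **Theorem.** $F$ is a well-defined functor from Tambara functors to Tambara pairs, and it is an equivalence of categories. An inverse is given by the functor $E$: for every Tambara pair $P$ the sets $EP(X)$ with the operators $R_f$, $T_f$, $N_f$ above (which do not depend on the choice of $X_1$) form a Tambara functor, naturally in $P$, and $E$ is inverse to $F$ up to natural isomorphism. -/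

import Mathlib

open CategoryTheory Limits

universe w

/-- A finite `G`-set. -/
structure FinGSet (G : Type) [Group G] where
  carrier : Type
  [finite : Finite carrier]
  [action : MulAction G carrier]

namespace FinGSet

instance (G : Type) [Group G] : CoeSort (FinGSet G) Type := ⟨FinGSet.carrier⟩

attribute [instance] FinGSet.finite FinGSet.action

variable {G : Type} [Group G]

/-- The empty `G`-set. -/
def empty (G : Type) [Group G] : FinGSet G where
  carrier := PEmpty
  action := { smul := fun _ x => x, one_smul := fun _ => rfl, mul_smul := fun _ _ _ => rfl }

/-- The one-point `G`-set `1 = G/G`. -/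
def point (G : Type) [Group G] : FinGSet G where
  carrier := PUnit

/-- The `G`-set `G = G/1`, with `G` acting by left multiplication. -/
def regular (G : Type) [Group G] [Finite G] : FinGSet G where
  carrier := G

/-- The disjoint union of two finite `G`-sets. -/
def sum (X Y : FinGSet G) : FinGSet G where
  carrier := X ⊕ Y

/-- The map from the empty `G`-set. -/
def fromEmpty (X : FinGSet G) : empty G →[G] X where
  toFun := PEmpty.elim
  map_smul' := fun _ x => x.elim

/-- The projection `X → 1`. -/
def toPoint (X : FinGSet G) : X →[G] point G where
  toFun := fun _ => PUnit.unit
  map_smul' := fun _ _ => rfl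

/-- The inclusion of the first summand. -/
def inl (X Y : FinGSet G) : X →[G] sum X Y where
  toFun := Sum.inl
  map_smul' := fun _ _ => rfl

/-- The inclusion of the second summand. -/
def inr (X Y : FinGSet G) : Y →[G] sum X Y where
  toFun := Sum.inr
  map_smul' := fun _ _ => rfl

/-- The fold map `X ⊔ X → X`, which is the identity on both copies of `X`. -/
def fold (X : FinGSet G) : sum X X →[G] X where
  toFun := Sum.elim id id
  map_smul' := by rintro g (x | x) <;> rfl

/-- For `g ∈ G`, the `G`-map `G → G` given by `x ↦ x g`. -/
def rightMul [Finite G] (g : G) : regular G →[G] regular G where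
  toFun := fun x : G => (x * g : G)
  map_smul' := fun h x => mul_assoc h x g

end FinGSet

/-- A bispan `X ←p- A -q→ B -r→ Y` of finite `G`-sets and equivariant maps. -/
structure Bispan {G : Type} [Group G] (X Y : FinGSet G) where
  A : FinGSet G
  B : FinGSet G
  p : A →[G] X
  q : A →[G] B
  r : B →[G] Y

namespace Bispan

variable {G : Type} [Group G]

/-- An isomorphism of bispans from `X` to `Y`: equivariant bijections `α : A → A'` and
`β : B → B'` that are compatible with the structure maps. -/
structure Iso {X Y : FinGSet G} (ω ω' : Bispan X Y) where
  α : ω.A ≃ ω'.A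
  β : ω.B ≃ ω'.B
  map_smul_α : ∀ (g : G) (a : ω.A), α (g • a) = g • α a
  map_smul_β : ∀ (g : G) (b : ω.B), β (g • b) = g • β b
  comm_p : ∀ a, ω'.p (α a) = ω.p a
  comm_q : ∀ a, ω'.q (α a) = β (ω.q a)
  comm_r : ∀ b, ω'.r (β b) = ω.r b

/-- The relation of being isomorphic, on bispans from `X` to `Y`. -/
instance setoid (X Y : FinGSet G) : Setoid (Bispan X Y) where
  r ω ω' := Nonempty (Iso ω ω')
  iseqv :=
    { refl := fun _ => ⟨⟨Equiv.refl _, Equiv.refl _, fun _ _ => rfl, fun _ _ => rfl,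
        fun _ => rfl, fun _ => rfl, fun _ => rfl⟩⟩
      symm := by
        rintro ω ω' ⟨e⟩
        refine ⟨⟨e.α.symm, e.β.symm, ?_, ?_, ?_, ?_, ?_⟩⟩
        · intro g a; rw [Equiv.symm_apply_eq, e.map_smul_α, Equiv.apply_symm_apply]
        · intro g a; rw [Equiv.symm_apply_eq, e.map_smul_β, Equiv.apply_symm_apply]
        · intro a; rw [← e.comm_p, Equiv.apply_symm_apply]
        · intro a; rw [Equiv.eq_symm_apply, ← e.comm_q, Equiv.apply_symm_apply]
        · intro a; rw [← e.comm_r, Equiv.apply_symm_apply]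
      trans := by
        rintro ω ω' ω'' ⟨e⟩ ⟨f⟩
        refine ⟨⟨e.α.trans f.α, e.β.trans f.β, ?_, ?_, ?_, ?_, ?_⟩⟩
        · intro g a; simp [e.map_smul_α, f.map_smul_α]
        · intro g a; simp [e.map_smul_β, f.map_smul_β]
        · intro a; simp [e.comm_p, f.comm_p]
        · intro a; simp [e.comm_q, f.comm_q]
        · intro a; simp [e.comm_r, f.comm_r] }

/-- The identity bispan. -/
def ident (X : FinGSet G) : Bispan X X where
  A := X
  B := X
  p := MulActionHom.id G
  q := MulActionHom.id G
  r := MulActionHom.id G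

/-- The underlying set of the right-hand middle term of the composite `ω₁ ∘ ω₀`: the pairs
`(b, s)` with `b ∈ B₁` and `s : q₁⁻¹{b} → B₀` a map (not necessarily equivariant) such that
`r₀ s = p₁`. -/
structure CompB {X₀ X₁ X₂ : FinGSet G} (ω₁ : Bispan X₁ X₂) (ω₀ : Bispan X₀ X₁) where
  b : ω₁.B
  s : {a : ω₁.A // ω₁.q a = b} → ω₀.B
  hs : ∀ a, ω₀.r (s a) = ω₁.p a.1

section comp

variable {X₀ X₁ X₂ : FinGSet G} {ω₁ : Bispan X₁ X₂} {ω₀ : Bispan X₀ X₁}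

theorem CompB.ext' {x y : CompB ω₁ ω₀} (hb : x.b = y.b)
    (h : ∀ a hx hy, x.s ⟨a, hx⟩ = y.s ⟨a, hy⟩) : x = y := by
  obtain ⟨b, s, hs⟩ := x
  obtain ⟨b', s', hs'⟩ := y
  obtain rfl : b = b' := hb
  obtain rfl : s = s' := funext fun a => h a.1 a.2 a.2
  rfl

theorem CompB.s_congr {x y : CompB ω₁ ω₀} (h : x = y) {a a' : ω₁.A} (ha : a = a')
    (hx : ω₁.q a = x.b) (hy : ω₁.q a' = y.b) : x.s ⟨a, hx⟩ = y.s ⟨a', hy⟩ := by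
  subst h; subst ha; rfl

instance : Finite (CompB ω₁ ω₀) :=
  Finite.of_injective
    (fun x => (⟨x.b, x.s⟩ : Σ b : ω₁.B, ({a : ω₁.A // ω₁.q a = b} → ω₀.B)))
    (by
      rintro ⟨b, s, hs⟩ ⟨b', s', hs'⟩ h
      obtain ⟨rfl, h⟩ := Sigma.mk.inj_iff.1 h
      obtain rfl := eq_of_heq h
      rfl)

/-- `G` acts by `g • (b, s) = (g b, g s g⁻¹)`. -/
instance : SMul G (CompB ω₁ ω₀) where
  smul g x :=
    { b := g • x.b
      s := fun a => g • x.s ⟨g⁻¹ • a.1, by rw [map_smul, a.2, inv_smul_smul]⟩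
      hs := fun a => by rw [map_smul, x.hs, map_smul, smul_inv_smul] }

theorem CompB.smul_b (g : G) (x : CompB ω₁ ω₀) : (g • x).b = g • x.b := rfl

theorem CompB.smul_s (g : G) (x : CompB ω₁ ω₀) (a : ω₁.A) (h : ω₁.q a = (g • x).b)
    (h' : ω₁.q (g⁻¹ • a) = x.b) : (g • x).s ⟨a, h⟩ = g • x.s ⟨g⁻¹ • a, h'⟩ := rfl

instance : MulAction G (CompB ω₁ ω₀) where
  one_smul x := CompB.ext' (one_smul G x.b) fun a hx hy => by
    rw [CompB.smul_s 1 x a hx (by simpa using hy), one_smul]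
    exact CompB.s_congr rfl (by simp) _ _
  mul_smul g h x := CompB.ext' (mul_smul g h x.b) fun a hx hy => by
    have e : ω₁.q a = g • h • x.b := hy
    have h1 : ω₁.q (g⁻¹ • a) = h • x.b := by rw [map_smul, e, inv_smul_smul]
    have h2 : ω₁.q (h⁻¹ • g⁻¹ • a) = x.b := by rw [map_smul, h1, inv_smul_smul]
    have h3 : ω₁.q ((g * h)⁻¹ • a) = x.b := by rw [mul_inv_rev, mul_smul]; exact h2
    rw [CompB.smul_s (g * h) x a hx h3, CompB.smul_s g (h • x) a hy h1,
      CompB.smul_s h x (g⁻¹ • a) h1 h2, mul_smul]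
    congr 2
    exact CompB.s_congr rfl (by rw [mul_inv_rev, mul_smul]) _ _

/-- The underlying set of the left-hand middle term of the composite `ω₁ ∘ ω₀`: the triples
`(a₀, a₁, s)` with `s : q₁⁻¹{q₁ a₁} → B₀` such that `r₀ s = p₁`, and `q₀ a₀ = s a₁`. The pair
`(q₁ a₁, s)` is recorded as `t`. -/
@[ext]
structure CompA {X₀ X₁ X₂ : FinGSet G} (ω₁ : Bispan X₁ X₂) (ω₀ : Bispan X₀ X₁) where
  a₀ : ω₀.A
  a₁ : ω₁.A
  t : CompB ω₁ ω₀
  h₁ : ω₁.q a₁ = t.b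
  h₀ : ω₀.q a₀ = t.s ⟨a₁, h₁⟩

instance : Finite (CompA ω₁ ω₀) :=
  Finite.of_injective (fun x => (x.a₀, x.a₁, x.t)) (by
    intro x y h
    simp only [Prod.mk.injEq] at h
    exact CompA.ext h.1 h.2.1 h.2.2)

/-- `G` acts by `g • (a₀, a₁, s) = (g a₀, g a₁, g s g⁻¹)`. -/
instance : SMul G (CompA ω₁ ω₀) where
  smul g x :=
    { a₀ := g • x.a₀
      a₁ := g • x.a₁
      t := g • x.t
      h₁ := by rw [map_smul, x.h₁]; rfl
      h₀ := by
        rw [map_smul, x.h₀, CompB.smul_s g x.t _ _ (by rw [inv_smul_smul, x.h₁])]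
        congr 1
        exact CompB.s_congr rfl (inv_smul_smul g x.a₁).symm _ _ }

instance : MulAction G (CompA ω₁ ω₀) where
  one_smul x := CompA.ext (one_smul G x.a₀) (one_smul G x.a₁) (one_smul G x.t)
  mul_smul g h x := CompA.ext (mul_smul g h x.a₀) (mul_smul g h x.a₁) (mul_smul g h x.t)

end comp

/-- The composite `ω₁ ∘ ω₀` of bispans. -/
def comp {X₀ X₁ X₂ : FinGSet G} (ω₁ : Bispan X₁ X₂) (ω₀ : Bispan X₀ X₁) : Bispan X₀ X₂ where
  A := { carrier := CompA ω₁ ω₀ }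
  B := { carrier := CompB ω₁ ω₀ }
  p := { toFun := fun x => ω₀.p x.a₀, map_smul' := fun g x => map_smul ω₀.p g x.a₀ }
  q := { toFun := fun x => x.t, map_smul' := fun _ _ => rfl }
  r := { toFun := fun x => ω₁.r x.b, map_smul' := fun g x => map_smul ω₁.r g x.b }

/-- To give an isomorphism it is enough to give compatible equivariant bijections. -/
theorem equiv_of_bijective {X Y : FinGSet G} {ω ω' : Bispan X Y}
    (α : ω.A → ω'.A) (β : ω.B → ω'.B) (hα : α.Bijective) (hβ : β.Bijective)
    (sα : ∀ (g : G) a, α (g • a) = g • α a) (sβ : ∀ (g : G) b, β (g • b) = g • β b)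
    (cp : ∀ a, ω'.p (α a) = ω.p a) (cq : ∀ a, ω'.q (α a) = β (ω.q a))
    (cr : ∀ b, ω'.r (β b) = ω.r b) : ω ≈ ω' :=
  ⟨⟨Equiv.ofBijective α hα, Equiv.ofBijective β hβ, sα, sβ, cp, cq, cr⟩⟩

section congr

variable {X₀ X₁ X₂ : FinGSet G}

/-- Transport along isomorphisms, on the right-hand middle term of a composite. -/
def congrB {ω₁ ω₁' : Bispan X₁ X₂} {ω₀ ω₀' : Bispan X₀ X₁} (e₁ : Iso ω₁ ω₁') (e₀ : Iso ω₀ ω₀')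
    (x : CompB ω₁ ω₀) : CompB ω₁' ω₀' where
  b := e₁.β x.b
  s a := e₀.β (x.s ⟨e₁.α.symm a.1, by
    rw [← e₁.β.apply_eq_iff_eq, ← e₁.comm_q, Equiv.apply_symm_apply, a.2]⟩)
  hs a := by rw [e₀.comm_r, x.hs, ← e₁.comm_p, Equiv.apply_symm_apply]

theorem congrB_s {ω₁ ω₁' : Bispan X₁ X₂} {ω₀ ω₀' : Bispan X₀ X₁} (e₁ : Iso ω₁ ω₁')
    (e₀ : Iso ω₀ ω₀') (x : CompB ω₁ ω₀) (a : ω₁.A) (a' : ω₁'.A) (ha : e₁.α a = a')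
    (h : ω₁'.q a' = (congrB e₁ e₀ x).b) (h' : ω₁.q a = x.b) :
    (congrB e₁ e₀ x).s ⟨a', h⟩ = e₀.β (x.s ⟨a, h'⟩) := by
  subst ha
  exact congrArg e₀.β (CompB.s_congr rfl (by simp) _ _)

theorem comp_congr {ω₁ ω₁' : Bispan X₁ X₂} {ω₀ ω₀' : Bispan X₀ X₁} (h₁ : ω₁ ≈ ω₁')
    (h₀ : ω₀ ≈ ω₀') : comp ω₁ ω₀ ≈ comp ω₁' ω₀' := by
  obtain ⟨e₁⟩ := h₁
  obtain ⟨e₀⟩ := h₀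
  have qiff : ∀ (a : ω₁.A) (b : ω₁.B), ω₁'.q (e₁.α a) = e₁.β b ↔ ω₁.q a = b := fun a b => by
    rw [e₁.comm_q, e₁.β.apply_eq_iff_eq]
  have hB : Function.Bijective (congrB e₁ e₀) := by
    constructor
    · intro x y h
      have hb : x.b = y.b := e₁.β.injective (congrArg CompB.b h)
      refine CompB.ext' hb fun a hx hy => e₀.β.injective ?_
      rw [← congrB_s e₁ e₀ x a _ rfl ((qiff _ _).2 hx) hx,
        ← congrB_s e₁ e₀ y a _ rfl ((qiff _ _).2 hy) hy]
      exact CompB.s_congr h rfl _ _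
    · intro y
      refine ⟨⟨e₁.β.symm y.b, fun a => e₀.β.symm (y.s ⟨e₁.α a.1, ?_⟩), ?_⟩, ?_⟩
      · rw [e₁.comm_q, a.2, Equiv.apply_symm_apply]
      · intro a
        rw [← e₀.comm_r, Equiv.apply_symm_apply, y.hs, e₁.comm_p]
      · refine CompB.ext' (e₁.β.apply_symm_apply _) fun a hx hy => ?_
        rw [congrB_s e₁ e₀ _ (e₁.α.symm a) a (by simp) hx
          (by rw [← qiff, e₁.α.apply_symm_apply]; exact hx), Equiv.apply_symm_apply]
        exact CompB.s_congr rfl (by simp) _ _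
  have hS : ∀ (g : G) (x : CompB ω₁ ω₀), congrB e₁ e₀ (g • x) = g • congrB e₁ e₀ x := by
    intro g x
    refine CompB.ext' (e₁.map_smul_β g x.b) fun a hx hy => ?_
    have h1 : ω₁.q (e₁.α.symm a) = g • x.b := by
      rw [← qiff, e₁.α.apply_symm_apply]; exact hx
    have h2 : ω₁.q (g⁻¹ • e₁.α.symm a) = x.b := by rw [map_smul, h1, inv_smul_smul]
    rw [congrB_s e₁ e₀ _ (e₁.α.symm a) a (by simp) hx h1, CompB.smul_s g x _ h1 h2,
      CompB.smul_s g (congrB e₁ e₀ x) a hy (by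
        rw [map_smul, hx, inv_smul_eq_iff]; exact e₁.map_smul_β g x.b),
      congrB_s e₁ e₀ x (g⁻¹ • e₁.α.symm a) _ (by rw [e₁.map_smul_α]; simp) _ h2,
      e₀.map_smul_β]
  refine equiv_of_bijective (ω := comp ω₁ ω₀) (ω' := comp ω₁' ω₀')
    (fun x : CompA ω₁ ω₀ => (⟨e₀.α x.a₀, e₁.α x.a₁, congrB e₁ e₀ x.t,
      (qiff _ _).2 x.h₁, by
        rw [congrB_s e₁ e₀ x.t _ _ rfl ((qiff _ _).2 x.h₁) x.h₁, e₀.comm_q, x.h₀]⟩ :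
        CompA ω₁' ω₀'))
    (congrB e₁ e₀) ⟨?_, ?_⟩ hB ?_ ?_ ?_ ?_ ?_
  · intro x y h
    have h1 := congrArg CompA.a₀ h
    have h2 := congrArg CompA.a₁ h
    have h3 := congrArg CompA.t h
    exact CompA.ext (e₀.α.injective h1) (e₁.α.injective h2) (hB.1 h3)
  · intro y
    obtain ⟨t, ht⟩ := hB.2 y.t
    have h1 : ω₁.q (e₁.α.symm y.a₁) = t.b := by
      rw [← qiff, e₁.α.apply_symm_apply, y.h₁, ← ht]; rfl
    have h1' : ω₁'.q y.a₁ = (congrB e₁ e₀ t).b := by rw [y.h₁, ht]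
    refine ⟨⟨e₀.α.symm y.a₀, e₁.α.symm y.a₁, t, h1, ?_⟩, ?_⟩
    · apply e₀.β.injective
      rw [← e₀.comm_q, e₀.α.apply_symm_apply, y.h₀,
        ← congrB_s e₁ e₀ t _ y.a₁ (by simp) h1' h1]
      exact CompB.s_congr ht.symm rfl _ _
    · exact CompA.ext (by simp) (by simp) ht
  · intro g x
    exact CompA.ext (e₀.map_smul_α g x.a₀) (e₁.map_smul_α g x.a₁) (hS g x.t)
  · exact hS
  · intro x; exact e₀.comm_p x.a₀
  · intro x; rfl
  · intro x; exact e₁.comm_r x.b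

end congr

section laws

theorem ident_comp {X Y : FinGSet G} (ω : Bispan X Y) : comp (ident Y) ω ≈ ω := by
  have hs : ∀ (x : CompB (ident Y) ω) (a : Y) (h : a = x.b), x.s ⟨a, h⟩ = x.s ⟨x.b, rfl⟩ :=
    fun x a h => CompB.s_congr rfl h _ _
  have sβ : ∀ (g : G) (x : CompB (ident Y) ω),
      (g • x).s ⟨(g • x).b, rfl⟩ = g • x.s ⟨x.b, rfl⟩ := by
    intro g x
    exact (CompB.smul_s g x _ rfl (inv_smul_smul g x.b)).trans
      (congrArg _ (hs x _ (inv_smul_smul g x.b)))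
  have hβ : Function.Bijective (fun x : CompB (ident Y) ω => x.s ⟨x.b, rfl⟩) := by
    constructor
    · intro x y h
      have hb : x.b = y.b := by
        have h1 : ω.r (x.s ⟨x.b, rfl⟩) = x.b := x.hs ⟨x.b, rfl⟩
        have h2 : ω.r (y.s ⟨y.b, rfl⟩) = y.b := y.hs ⟨y.b, rfl⟩
        rw [← h1, ← h2]; exact congrArg ω.r h
      refine CompB.ext' hb fun a hx hy => ?_
      rw [hs x a hx, hs y a hy]; exact h
    · intro b
      exact ⟨⟨ω.r b, fun _ => b, fun a => a.2.symm⟩, rfl⟩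
  refine equiv_of_bijective (ω := comp (ident Y) ω) (ω' := ω)
    (fun x : CompA (ident Y) ω => x.a₀) (fun x : CompB (ident Y) ω => x.s ⟨x.b, rfl⟩)
    ⟨?_, ?_⟩ hβ (fun _ _ => rfl) sβ (fun _ => rfl) ?_ ?_
  · intro x y (h : x.a₀ = y.a₀)
    have ht : x.t = y.t := hβ.1 (by
      have h1 := x.h₀.trans (hs x.t _ x.h₁)
      have h2 := y.h₀.trans (hs y.t _ y.h₁)
      exact h1.symm.trans ((congrArg ω.q h).trans h2))
    have e1 : x.a₁ = x.t.b := x.h₁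
    have e2 : y.a₁ = y.t.b := y.h₁
    exact CompA.ext h (by rw [e1, e2, ht]) ht
  · intro a
    exact ⟨⟨a, ω.r (ω.q a), ⟨ω.r (ω.q a), fun _ => ω.q a, fun a => a.2.symm⟩, rfl, rfl⟩, rfl⟩
  · intro x
    exact x.h₀.trans (hs x.t _ x.h₁)
  · intro x
    exact x.hs ⟨x.b, rfl⟩

theorem comp_ident {X Y : FinGSet G} (ω : Bispan X Y) : comp ω (ident X) ≈ ω := by
  have hs : ∀ (x : CompB ω (ident X)) a, x.s a = ω.p a.1 := fun x a => x.hs a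
  have hβ : Function.Bijective (fun x : CompB ω (ident X) => x.b) := by
    constructor
    · intro x y h
      refine CompB.ext' h fun a hx hy => ?_
      rw [hs, hs]
    · intro b
      exact ⟨⟨b, fun a => ω.p a.1, fun _ => rfl⟩, rfl⟩
  refine equiv_of_bijective (ω := comp ω (ident X)) (ω' := ω)
    (fun x : CompA ω (ident X) => x.a₁) (fun x : CompB ω (ident X) => x.b)
    ⟨?_, ?_⟩ hβ (fun _ _ => rfl) (fun _ _ => rfl) ?_ (fun x => x.h₁) (fun _ => rfl)
  · intro x y (h : x.a₁ = y.a₁)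
    have h1 : x.a₀ = ω.p x.a₁ := x.h₀.trans (hs _ _)
    have h2 : y.a₀ = ω.p y.a₁ := y.h₀.trans (hs _ _)
    exact CompA.ext (by rw [h1, h2, h]) h (hβ.1 (by
      have h3 := x.h₁
      rw [h] at h3
      exact h3.symm.trans y.h₁))
  · intro a
    exact ⟨⟨ω.p a, a, ⟨ω.q a, fun a => ω.p a.1, fun _ => rfl⟩, rfl, rfl⟩, rfl⟩
  · intro x
    exact ((hs x.t ⟨x.a₁, x.h₁⟩).symm.trans x.h₀.symm)

variable {X₀ X₁ X₂ X₃ : FinGSet G}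

/-- The comparison map of the associativity isomorphism on right-hand middle terms. -/
def assocB (ω₂ : Bispan X₂ X₃) (ω₁ : Bispan X₁ X₂) (ω₀ : Bispan X₀ X₁)
    (x : CompB (comp ω₂ ω₁) ω₀) : CompB ω₂ (comp ω₁ ω₀) where
  b := CompB.b (ω₁ := ω₂) (ω₀ := ω₁) x.b
  s a₂ := (
    { b := CompB.s (ω₁ := ω₂) (ω₀ := ω₁) x.b a₂
      s := fun a₁ => x.s ⟨(⟨a₁.1, a₂.1, x.b, a₂.2, a₁.2⟩ : CompA ω₂ ω₁), rfl⟩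
      hs := fun a₁ => x.hs ⟨(⟨a₁.1, a₂.1, x.b, a₂.2, a₁.2⟩ : CompA ω₂ ω₁), rfl⟩ } :
    CompB ω₁ ω₀)
  hs a₂ := CompB.hs (ω₁ := ω₂) (ω₀ := ω₁) x.b a₂

theorem comp_assoc (ω₂ : Bispan X₂ X₃) (ω₁ : Bispan X₁ X₂) (ω₀ : Bispan X₀ X₁) :
    comp (comp ω₂ ω₁) ω₀ ≈ comp ω₂ (comp ω₁ ω₀) := by
  have key : ∀ (x : CompB (comp ω₂ ω₁) ω₀) (a : CompA ω₂ ω₁) (hx : a.t = x.b)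
      (h₁ : ω₂.q a.a₁ = (assocB ω₂ ω₁ ω₀ x).b)
      (h₂ : ω₁.q a.a₀ = CompB.b (ω₁ := ω₁) (ω₀ := ω₀) ((assocB ω₂ ω₁ ω₀ x).s ⟨a.a₁, h₁⟩)),
      x.s ⟨a, hx⟩ =
        CompB.s (ω₁ := ω₁) (ω₀ := ω₀) ((assocB ω₂ ω₁ ω₀ x).s ⟨a.a₁, h₁⟩) ⟨a.a₀, h₂⟩ :=
    fun x a hx h₁ h₂ => CompB.s_congr (ω₁ := comp ω₂ ω₁) (ω₀ := ω₀) (x := x) (a := a)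
      (a' := (⟨a.a₀, a.a₁, x.b, h₁, h₂⟩ : CompA ω₂ ω₁)) rfl
      (CompA.ext (ω₁ := ω₂) (ω₀ := ω₁) rfl rfl hx) hx rfl
  have hB : Function.Bijective (assocB ω₂ ω₁ ω₀) := by
    constructor
    · intro x y h
      have hb : x.b = y.b := by
        refine CompB.ext' (ω₁ := ω₂) (ω₀ := ω₁)
          (congrArg (fun z : CompB ω₂ (comp ω₁ ω₀) => z.b) h) fun a hx hy => ?_
        exact congrArg (fun z : CompB ω₁ ω₀ => z.b)
          (CompB.s_congr h (rfl : a = a) hx hy)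
      refine CompB.ext' hb fun a hx hy => ?_
      have h1 : ω₂.q (CompA.a₁ a) = (assocB ω₂ ω₁ ω₀ x).b :=
        (CompA.h₁ a).trans (congrArg CompB.b hx)
      have h1' : ω₂.q (CompA.a₁ a) = (assocB ω₂ ω₁ ω₀ y).b :=
        (CompA.h₁ a).trans (congrArg CompB.b hy)
      have h2 : ω₁.q (CompA.a₀ a) =
          CompB.b (ω₁ := ω₁) (ω₀ := ω₀) ((assocB ω₂ ω₁ ω₀ x).s ⟨CompA.a₁ a, h1⟩) :=
        (CompA.h₀ a).trans (CompB.s_congr hx rfl _ _)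
      have h2' : ω₁.q (CompA.a₀ a) =
          CompB.b (ω₁ := ω₁) (ω₀ := ω₀) ((assocB ω₂ ω₁ ω₀ y).s ⟨CompA.a₁ a, h1'⟩) :=
        (CompA.h₀ a).trans (CompB.s_congr hy rfl _ _)
      exact (key x a hx h1 h2).trans ((CompB.s_congr (ω₁ := ω₁) (ω₀ := ω₀)
        (CompB.s_congr h rfl h1 h1') rfl h2 h2').trans (key y a hy h1' h2').symm)
    · intro y
      let u : ∀ a : {a : ω₂.A // ω₂.q a = y.b}, CompB ω₁ ω₀ := fun a => y.s a
      let b : CompB ω₂ ω₁ := ⟨y.b, fun a => (u a).b, fun a => y.hs a⟩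
      have e1 : ∀ (a : CompA ω₂ ω₁) (_ : a.t = b), ω₂.q a.a₁ = y.b := fun a h =>
        a.h₁.trans (congrArg CompB.b h)
      have e2 : ∀ (a : CompA ω₂ ω₁) (h : a.t = b), ω₁.q a.a₀ = (u ⟨a.a₁, e1 a h⟩).b := fun a h =>
        a.h₀.trans (CompB.s_congr h rfl _ _)
      exact ⟨⟨b, fun a => (u ⟨CompA.a₁ a.1, e1 a.1 a.2⟩).s ⟨CompA.a₀ a.1, e2 a.1 a.2⟩,
        fun a => (u ⟨CompA.a₁ a.1, e1 a.1 a.2⟩).hs ⟨CompA.a₀ a.1, e2 a.1 a.2⟩⟩, rfl⟩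
  have hS : ∀ (g : G) (x : CompB (comp ω₂ ω₁) ω₀),
      assocB ω₂ ω₁ ω₀ (g • x) = g • assocB ω₂ ω₁ ω₀ x := by
    intro g x
    refine CompB.ext' rfl fun a hx hy => ?_
    refine CompB.ext' (ω₁ := ω₁) (ω₀ := ω₀) rfl fun a' hx' hy' => ?_
    refine congrArg (g • ·) (CompB.s_congr rfl ?_ _ _)
    exact CompA.ext rfl rfl (inv_smul_smul g x.b)
  have ht : ∀ x : CompA (comp ω₂ ω₁) ω₀, CompA.t x.a₁ = x.t.b := fun x => x.h₁
  have e1 : ∀ x : CompA (comp ω₂ ω₁) ω₀,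
      ω₂.q (CompA.a₁ x.a₁) = (assocB ω₂ ω₁ ω₀ x.t).b := fun x =>
    (CompA.h₁ x.a₁).trans (congrArg CompB.b (ht x))
  have e2 : ∀ x : CompA (comp ω₂ ω₁) ω₀, ω₁.q (CompA.a₀ x.a₁) =
      CompB.b (ω₁ := ω₁) (ω₀ := ω₀) ((assocB ω₂ ω₁ ω₀ x.t).s ⟨CompA.a₁ x.a₁, e1 x⟩) := fun x =>
    (CompA.h₀ x.a₁).trans (CompB.s_congr (ht x) rfl _ _)
  refine equiv_of_bijective (ω := comp (comp ω₂ ω₁) ω₀) (ω' := comp ω₂ (comp ω₁ ω₀))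
    (fun x : CompA (comp ω₂ ω₁) ω₀ =>
      (⟨(⟨x.a₀, CompA.a₀ x.a₁, (assocB ω₂ ω₁ ω₀ x.t).s ⟨CompA.a₁ x.a₁, e1 x⟩, e2 x,
        x.h₀.trans (key x.t x.a₁ (ht x) (e1 x) (e2 x))⟩ : CompA ω₁ ω₀),
        CompA.a₁ x.a₁, assocB ω₂ ω₁ ω₀ x.t, e1 x, rfl⟩ : CompA ω₂ (comp ω₁ ω₀)))
    (assocB ω₂ ω₁ ω₀) ⟨?_, ?_⟩ hB ?_ hS (fun _ => rfl) (fun _ => rfl) (fun _ => rfl)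
  · intro x y h
    have h1 := congrArg (fun z : CompA ω₂ (comp ω₁ ω₀) => CompA.a₀ (ω₁ := ω₁) (ω₀ := ω₀) z.a₀) h
    have h2 := congrArg (fun z : CompA ω₂ (comp ω₁ ω₀) => CompA.a₁ (ω₁ := ω₁) (ω₀ := ω₀) z.a₀) h
    have h3 := congrArg (fun z : CompA ω₂ (comp ω₁ ω₀) => z.a₁) h
    have h4 := hB.1 (congrArg (fun z : CompA ω₂ (comp ω₁ ω₀) => z.t) h)
    exact CompA.ext h1 (CompA.ext (ω₁ := ω₂) (ω₀ := ω₁) h2 h3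
      ((ht x).trans ((congrArg CompB.b h4).trans (ht y).symm))) h4
  · rintro ⟨⟨c₀, c₁, u, k₁, k₀⟩, a₁, t', h₁, h₀⟩
    obtain ⟨t, rfl⟩ := hB.2 t'
    obtain rfl : u = _ := h₀
    exact ⟨⟨c₀, (⟨c₁, a₁, t.b, h₁, k₁⟩ : CompA ω₂ ω₁), t, rfl, k₀⟩, rfl⟩
  · intro g x
    refine CompA.ext (CompA.ext rfl rfl ?_) rfl (hS g x.t)
    refine (CompB.s_congr (hS g x.t) rfl _
      ((e1 (g • x)).trans (congrArg CompB.b (hS g x.t)))).trans ?_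
    refine congrArg (g • ·) (CompB.s_congr rfl ?_ _ _)
    exact inv_smul_smul g (CompA.a₁ x.a₁)

end laws

/-- The bispan `R_f = (Y ←f- X -1→ X -1→ X)`. -/
def R {X Y : FinGSet G} (f : X →[G] Y) : Bispan Y X where
  A := X
  B := X
  p := f
  q := MulActionHom.id G
  r := MulActionHom.id G

/-- The bispan `N_f = (X ←1- X -f→ Y -1→ Y)`. -/
def N {X Y : FinGSet G} (f : X →[G] Y) : Bispan X Y where
  A := X
  B := Y
  p := MulActionHom.id G
  q := f
  r := MulActionHom.id G

/-- The bispan `T_f = (X ←1- X -1→ X -f→ Y)`. -/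
def T {X Y : FinGSet G} (f : X →[G] Y) : Bispan X Y where
  A := X
  B := X
  p := MulActionHom.id G
  q := MulActionHom.id G
  r := f

end Bispan

/-- The category whose objects are the finite `G`-sets and whose morphisms from `X` to `Y` are the
isomorphism classes of bispans from `X` to `Y`. -/
instance bispanCategory (G : Type) [Group G] : Category (FinGSet G) where
  Hom X Y := Quotient (Bispan.setoid X Y)
  id X := Quotient.mk _ (Bispan.ident X)
  comp f g := Quotient.map₂ (fun ω₀ ω₁ => Bispan.comp ω₁ ω₀)
    (fun _ _ h₀ _ _ h₁ => Bispan.comp_congr h₁ h₀) f g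
  id_comp f := Quotient.inductionOn f fun ω => Quotient.sound (Bispan.comp_ident ω)
  comp_id f := Quotient.inductionOn f fun ω => Quotient.sound (Bispan.ident_comp ω)
  assoc f g h := Quotient.inductionOn₃ f g h fun ω₀ ω₁ ω₂ =>
    Quotient.sound (Setoid.symm (Bispan.comp_assoc ω₂ ω₁ ω₀))

namespace FinGSet

variable {G : Type} [Group G]

/-- The morphism `R_f : Y → X` attached to a `G`-map `f : X → Y`. -/
def R {X Y : FinGSet G} (f : X →[G] Y) : Y ⟶ X := Quotient.mk _ (Bispan.R f)

/-- The morphism `N_f : X → Y` attached to a `G`-map `f : X → Y`. -/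
def N {X Y : FinGSet G} (f : X →[G] Y) : X ⟶ Y := Quotient.mk _ (Bispan.N f)

/-- The morphism `T_f : X → Y` attached to a `G`-map `f : X → Y`. -/
def T {X Y : FinGSet G} (f : X →[G] Y) : X ⟶ Y := Quotient.mk _ (Bispan.T f)

end FinGSet

/-! Disjoint unions are products in the category of bispans, and the empty set is terminal. -/

namespace Bispan

variable {G : Type} [Group G] {U X Y : FinGSet G}

/-- The pullback of a finite `G`-set along a `G`-map. -/
def pullSet {Z : FinGSet G} (f : X →[G] Y) (k : Z →[G] Y) : FinGSet G where
  carrier := {z : X × Z // f z.1 = k z.2}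
  action :=
    { smul := fun g z => ⟨g • z.1, by
        rw [Prod.smul_fst, Prod.smul_snd, map_smul, map_smul, z.2]⟩
      one_smul := fun z => Subtype.ext (one_smul G z.1)
      mul_smul := fun g h z => Subtype.ext (mul_smul g h z.1) }

/-- The pullback of a bispan `U → Y` along `f : X → Y`; it represents the composite with `R_f`. -/
def pull (f : X →[G] Y) (ω : Bispan U Y) : Bispan U X where
  A := pullSet f (ω.r.comp ω.q)
  B := pullSet f ω.r
  p := { toFun := fun z => ω.p z.1.2, map_smul' := fun g z => map_smul ω.p g z.1.2 }
  q :=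
    { toFun := fun z => ⟨(z.1.1, ω.q z.1.2), z.2⟩
      map_smul' := fun g z => Subtype.ext (Prod.ext rfl (map_smul ω.q g z.1.2)) }
  r := { toFun := fun z => z.1.1, map_smul' := fun _ _ => rfl }

theorem R_comp (f : X →[G] Y) (ω : Bispan U Y) : comp (R f) ω ≈ pull f ω := by
  have hs : ∀ (x : CompB (R f) ω) (a : X) (h : a = x.b), x.s ⟨a, h⟩ = x.s ⟨x.b, rfl⟩ :=
    fun x a h => CompB.s_congr rfl h _ _
  have sβ : ∀ (g : G) (x : CompB (R f) ω),
      (g • x).s ⟨(g • x).b, rfl⟩ = g • x.s ⟨x.b, rfl⟩ := by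
    intro g x
    exact (CompB.smul_s g x _ rfl (inv_smul_smul g x.b)).trans
      (congrArg _ (hs x _ (inv_smul_smul g x.b)))
  have e₁ : ∀ x : CompA (R f) ω, x.a₁ = x.t.b := fun x => x.h₁
  have e₀ : ∀ x : CompA (R f) ω, ω.q x.a₀ = x.t.s ⟨x.t.b, rfl⟩ := fun x =>
    x.h₀.trans (hs x.t _ x.h₁)
  have hb : ∀ x : CompB (R f) ω, f x.b = ω.r (x.s ⟨x.b, rfl⟩) := fun x => (x.hs ⟨x.b, rfl⟩).symm
  have inj : ∀ x y : CompB (R f) ω, x.b = y.b → x.s ⟨x.b, rfl⟩ = y.s ⟨y.b, rfl⟩ → x = y :=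
    fun x y h h' => CompB.ext' h fun a hx hy => (hs x a hx).trans (h'.trans (hs y a hy).symm)
  refine equiv_of_bijective (ω := comp (R f) ω) (ω' := pull f ω)
    (fun x : CompA (R f) ω => ⟨(x.t.b, x.a₀), (hb x.t).trans (congrArg ω.r (e₀ x).symm)⟩)
    (fun x : CompB (R f) ω => ⟨(x.b, x.s ⟨x.b, rfl⟩), hb x⟩)
    ⟨?_, ?_⟩ ⟨?_, ?_⟩ ?_ ?_ ?_ ?_ ?_
  · intro x y h
    have h1 := congrArg (fun z => z.1.1) h
    have h2 := congrArg (fun z => z.1.2) h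
    exact CompA.ext h2 ((e₁ x).trans (h1.trans (e₁ y).symm))
      (inj _ _ h1 ((e₀ x).symm.trans ((congrArg ω.q h2).trans (e₀ y))))
  · rintro ⟨⟨x, a⟩, h⟩
    exact ⟨⟨a, x, ⟨x, fun _ => ω.q a, fun c => h.symm.trans (congrArg f c.2.symm)⟩, rfl, rfl⟩, rfl⟩
  · intro x y h
    exact inj x y (congrArg (fun z => z.1.1) h) (congrArg (fun z => z.1.2) h)
  · rintro ⟨⟨x, b⟩, h⟩
    exact ⟨⟨x, fun _ => b, fun c => h.symm.trans (congrArg f c.2.symm)⟩, rfl⟩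
  · intro g x; rfl
  · intro g x; exact Subtype.ext (Prod.ext rfl (sβ g x))
  · intro x; rfl
  · intro x; exact Subtype.ext (Prod.ext rfl (e₀ x))
  · intro x; rfl

/-- The bispan `U ← A ⊔ A' → B ⊔ B' → X ⊔ Y` built from bispans `U → X` and `U → Y`. -/
def pair (ω : Bispan U X) (ω' : Bispan U Y) : Bispan U (FinGSet.sum X Y) where
  A := FinGSet.sum ω.A ω'.A
  B := FinGSet.sum ω.B ω'.B
  p := { toFun := Sum.elim ω.p ω'.p
         map_smul' := by rintro g (x | x); exacts [map_smul ω.p g x, map_smul ω'.p g x] }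
  q := { toFun := Sum.map ω.q ω'.q
         map_smul' := by
          rintro g (x | x)
          exacts [congrArg Sum.inl (map_smul ω.q g x), congrArg Sum.inr (map_smul ω'.q g x)] }
  r := { toFun := Sum.map ω.r ω'.r
         map_smul' := by
          rintro g (x | x)
          exacts [congrArg Sum.inl (map_smul ω.r g x), congrArg Sum.inr (map_smul ω'.r g x)] }

theorem pair_congr {ω₁ ω₂ : Bispan U X} {ω₁' ω₂' : Bispan U Y} (h : ω₁ ≈ ω₂) (h' : ω₁' ≈ ω₂') :
    pair ω₁ ω₁' ≈ pair ω₂ ω₂' := by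
  obtain ⟨e⟩ := h
  obtain ⟨e'⟩ := h'
  refine ⟨⟨Equiv.sumCongr e.α e'.α, Equiv.sumCongr e.β e'.β, ?_, ?_, ?_, ?_, ?_⟩⟩
  · rintro g (x | x)
    exacts [congrArg Sum.inl (e.map_smul_α g x), congrArg Sum.inr (e'.map_smul_α g x)]
  · rintro g (x | x)
    exacts [congrArg Sum.inl (e.map_smul_β g x), congrArg Sum.inr (e'.map_smul_β g x)]
  · rintro (x | x)
    exacts [e.comm_p x, e'.comm_p x]
  · rintro (x | x)
    exacts [congrArg Sum.inl (e.comm_q x), congrArg Sum.inr (e'.comm_q x)]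
  · rintro (x | x)
    exacts [congrArg Sum.inl (e.comm_r x), congrArg Sum.inr (e'.comm_r x)]

theorem pull_inl_pair (ω : Bispan U X) (ω' : Bispan U Y) :
    ω ≈ pull (FinGSet.inl X Y) (pair ω ω') := by
  refine equiv_of_bijective (ω' := pull (FinGSet.inl X Y) (pair ω ω'))
    (fun a => ⟨(ω.r (ω.q a), Sum.inl a), rfl⟩) (fun b => ⟨(ω.r b, Sum.inl b), rfl⟩)
    ⟨?_, ?_⟩ ⟨?_, ?_⟩ ?_ ?_ (fun _ => rfl) (fun _ => rfl) (fun _ => rfl)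
  · intro a a' h
    exact Sum.inl_injective (congrArg (fun z => z.1.2) h)
  · rintro ⟨⟨x, a | a⟩, h⟩
    · exact ⟨a, Subtype.ext (Prod.ext (Sum.inl_injective h).symm rfl)⟩
    · exact absurd h Sum.inl_ne_inr
  · intro a a' h
    exact Sum.inl_injective (congrArg (fun z => z.1.2) h)
  · rintro ⟨⟨x, a | a⟩, h⟩
    · exact ⟨a, Subtype.ext (Prod.ext (Sum.inl_injective h).symm rfl)⟩
    · exact absurd h Sum.inl_ne_inr
  · intro g a
    exact Subtype.ext (Prod.ext ((congrArg ω.r (map_smul ω.q g a)).trans (map_smul ω.r g _)) rfl)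
  · intro g a
    exact Subtype.ext (Prod.ext (map_smul ω.r g _) rfl)

theorem pull_inr_pair (ω : Bispan U X) (ω' : Bispan U Y) :
    ω' ≈ pull (FinGSet.inr X Y) (pair ω ω') := by
  refine equiv_of_bijective (ω' := pull (FinGSet.inr X Y) (pair ω ω'))
    (fun a => ⟨(ω'.r (ω'.q a), Sum.inr a), rfl⟩) (fun b => ⟨(ω'.r b, Sum.inr b), rfl⟩)
    ⟨?_, ?_⟩ ⟨?_, ?_⟩ ?_ ?_ (fun _ => rfl) (fun _ => rfl) (fun _ => rfl)
  · intro a a' h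
    exact Sum.inr_injective (congrArg (fun z => z.1.2) h)
  · rintro ⟨⟨x, a | a⟩, h⟩
    · exact absurd h Sum.inr_ne_inl
    · exact ⟨a, Subtype.ext (Prod.ext (Sum.inr_injective h).symm rfl)⟩
  · intro a a' h
    exact Sum.inr_injective (congrArg (fun z => z.1.2) h)
  · rintro ⟨⟨x, a | a⟩, h⟩
    · exact absurd h Sum.inr_ne_inl
    · exact ⟨a, Subtype.ext (Prod.ext (Sum.inr_injective h).symm rfl)⟩
  · intro g a
    exact Subtype.ext (Prod.ext ((congrArg ω'.r (map_smul ω'.q g a)).trans (map_smul ω'.r g _)) rfl)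
  · intro g a
    exact Subtype.ext (Prod.ext (map_smul ω'.r g _) rfl)

theorem pair_pull (ω : Bispan U (FinGSet.sum X Y)) :
    pair (pull (FinGSet.inl X Y) ω) (pull (FinGSet.inr X Y) ω) ≈ ω := by
  have bij : ∀ {Z : FinGSet G} (k : Z →[G] FinGSet.sum X Y),
      Function.Bijective (Sum.elim
        (fun z : {z : X × Z // FinGSet.inl X Y z.1 = k z.2} => z.1.2)
        (fun z : {z : Y × Z // FinGSet.inr X Y z.1 = k z.2} => z.1.2)) := by
    intro Z k
    constructor
    · rintro (⟨⟨x, z⟩, h⟩ | ⟨⟨x, z⟩, h⟩) (⟨⟨x', z'⟩, h'⟩ | ⟨⟨x', z'⟩, h'⟩) (e : z = z') <;> subst e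
      · obtain rfl := Sum.inl_injective (h.trans h'.symm); rfl
      · exact absurd (h.trans h'.symm) Sum.inl_ne_inr
      · exact absurd (h.trans h'.symm) Sum.inr_ne_inl
      · obtain rfl := Sum.inr_injective (h.trans h'.symm); rfl
    · intro z
      rcases hz : (show X.carrier ⊕ Y.carrier from k z) with x | x
      · exact ⟨Sum.inl ⟨(x, z), hz.symm⟩, rfl⟩
      · exact ⟨Sum.inr ⟨(x, z), hz.symm⟩, rfl⟩
  refine equiv_of_bijective
    (ω := pair (pull (FinGSet.inl X Y) ω) (pull (FinGSet.inr X Y) ω))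
    (Sum.elim (fun z => z.1.2) (fun z => z.1.2)) (Sum.elim (fun z => z.1.2) (fun z => z.1.2))
    (bij (ω.r.comp ω.q)) (bij ω.r) ?_ ?_ ?_ ?_ ?_
  · rintro g (x | x) <;> rfl
  · rintro g (x | x) <;> rfl
  · rintro (x | x) <;> rfl
  · rintro (x | x) <;> rfl
  · rintro (⟨x, h⟩ | ⟨x, h⟩)
    exacts [h.symm, h.symm]

end Bispan

namespace FinGSet

variable {G : Type} [Group G]

/-- The diagram `X ←R_i- X ⊔ Y -R_j→ Y` is a product diagram in the category of bispans. -/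
def isProduct (X Y : FinGSet G) : IsLimit (BinaryFan.mk (R (inl X Y)) (R (inr X Y))) :=
  BinaryFan.IsLimit.mk _
    (fun f g => Quotient.map₂ Bispan.pair (fun _ _ h _ _ h' => Bispan.pair_congr h h') f g)
    (fun f g => Quotient.inductionOn₂ f g fun ω ω' =>
      Quotient.sound (Setoid.trans (Bispan.R_comp _ _) (Setoid.symm (Bispan.pull_inl_pair ω ω'))))
    (fun f g => Quotient.inductionOn₂ f g fun ω ω' =>
      Quotient.sound (Setoid.trans (Bispan.R_comp _ _) (Setoid.symm (Bispan.pull_inr_pair ω ω'))))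
    (by
      rintro U f g m rfl rfl
      refine Quotient.inductionOn m fun ω => Quotient.sound (Setoid.symm ?_)
      exact Setoid.trans (Bispan.pair_congr (Bispan.R_comp _ ω) (Bispan.R_comp _ ω))
        (Bispan.pair_pull ω))

/-- The empty set is terminal in the category of bispans. -/
def isTerminalEmpty : IsTerminal (empty G) :=
  letI (U : FinGSet G) : Unique (U ⟶ empty G) :=
    { default := R (fromEmpty U)
      uniq := fun m => Quotient.inductionOn m fun ω => by
        have : IsEmpty ω.B := ⟨fun b => PEmpty.elim (ω.r b)⟩
        have : IsEmpty ω.A := ⟨fun a => isEmptyElim (ω.q a)⟩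
        have : IsEmpty (Bispan.R (fromEmpty U)).A := inferInstanceAs (IsEmpty PEmpty)
        have : IsEmpty (Bispan.R (fromEmpty U)).B := inferInstanceAs (IsEmpty PEmpty)
        exact Quotient.sound (Bispan.equiv_of_bijective (ω' := Bispan.R (fromEmpty U))
          isEmptyElim isEmptyElim
          ⟨fun a => isEmptyElim a, fun a => isEmptyElim a⟩
          ⟨fun a => isEmptyElim a, fun a => isEmptyElim a⟩
          (fun _ a => isEmptyElim a) (fun _ a => isEmptyElim a)
          (fun a => isEmptyElim a) (fun a => isEmptyElim a) (fun a => isEmptyElim a)) }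
  IsTerminal.ofUnique _

end FinGSet

/-- A Tambara functor for `G` is a product-preserving functor from the category of bispans of
finite `G`-sets to the category of sets. Morphisms are natural transformations. -/
abbrev TambaraFunctor (G : Type) [Group G] :=
  ObjectProperty.FullSubcategory (fun S : FinGSet G ⥤ Type w => PreservesFiniteProducts S)

namespace TambaraFunctor

variable {G : Type} [Group G]

/-- The map `(R_i, R_j) : S(X ⊔ Y) → S(X) × S(Y)` is bijective. -/
theorem bijective_restrict (S : TambaraFunctor.{w} G) (X Y : FinGSet G) :
    Function.Bijective (fun c : S.obj.obj (FinGSet.sum X Y) =>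
      (S.obj.map (FinGSet.R (FinGSet.inl X Y)) c, S.obj.map (FinGSet.R (FinGSet.inr X Y)) c)) := by
  have : PreservesFiniteProducts S.obj := S.property
  let l := mapIsLimitOfPreservesOfIsLimit S.obj _ _ (FinGSet.isProduct X Y)
  let m := Types.binaryProductLimit (S.obj.obj X) (S.obj.obj Y)
  let e := l.conePointUniqueUpToIso m
  have h₁ : e.hom ≫ (Types.binaryProductCone _ _).fst = S.obj.map (FinGSet.R (FinGSet.inl X Y)) :=
    l.conePointUniqueUpToIso_hom_comp m ⟨WalkingPair.left⟩
  have h₂ : e.hom ≫ (Types.binaryProductCone _ _).snd = S.obj.map (FinGSet.R (FinGSet.inr X Y)) :=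
    l.conePointUniqueUpToIso_hom_comp m ⟨WalkingPair.right⟩
  rw [← h₁, ← h₂]
  exact e.toEquiv.bijective

/-- The bijection `S(X ⊔ Y) ≃ S(X) × S(Y)`. -/
noncomputable def prodEquiv (S : TambaraFunctor.{w} G) (X Y : FinGSet G) :
    S.obj.obj (FinGSet.sum X Y) ≃ S.obj.obj X × S.obj.obj Y :=
  Equiv.ofBijective _ (S.bijective_restrict X Y)

/-- The unique element of `S(∅)`. -/
noncomputable def emptyElt (S : TambaraFunctor.{w} G) : S.obj.obj (FinGSet.empty G) :=
  have : PreservesFiniteProducts S.obj := S.property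
  (Types.isTerminalEquivUnique _
    (IsTerminal.isTerminalObj S.obj (FinGSet.empty G) FinGSet.isTerminalEmpty)).default

theorem eq_emptyElt (S : TambaraFunctor.{w} G) (a : S.obj.obj (FinGSet.empty G)) :
    a = S.emptyElt :=
  have : PreservesFiniteProducts S.obj := S.property
  (Types.isTerminalEquivUnique _
    (IsTerminal.isTerminalObj S.obj (FinGSet.empty G) FinGSet.isTerminalEmpty)).uniq a

/-- The element `0 = T_z()` of `S(X)`, where `z : ∅ → X`. -/
noncomputable def zero (S : TambaraFunctor.{w} G) (X : FinGSet G) : S.obj.obj X :=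
  S.obj.map (FinGSet.T X.fromEmpty) S.emptyElt

/-- The element `1 = N_z()` of `S(X)`, where `z : ∅ → X`. -/
noncomputable def one (S : TambaraFunctor.{w} G) (X : FinGSet G) : S.obj.obj X :=
  S.obj.map (FinGSet.N X.fromEmpty) S.emptyElt

/-- The addition `a + b = T_s(a, b)` on `S(X)`, where `s : X ⊔ X → X` is the fold map. -/
noncomputable def add (S : TambaraFunctor.{w} G) (X : FinGSet G) (a b : S.obj.obj X) :
    S.obj.obj X :=
  S.obj.map (FinGSet.T X.fold) ((S.prodEquiv X X).symm (a, b))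

/-- The multiplication `a b = N_s(a, b)` on `S(X)`, where `s : X ⊔ X → X` is the fold map. -/
noncomputable def mul (S : TambaraFunctor.{w} G) (X : FinGSet G) (a b : S.obj.obj X) :
    S.obj.obj X :=
  S.obj.map (FinGSet.N X.fold) ((S.prodEquiv X X).symm (a, b))

section naturality

variable {S S' : TambaraFunctor.{w} G} (φ : S ⟶ S')

theorem app_map {X Y : FinGSet G} (f : X ⟶ Y) (a : S.obj.obj X) :
    φ.hom.app Y (S.obj.map f a) = S'.obj.map f (φ.hom.app X a) :=
  NatTrans.naturality_apply φ.hom f a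

theorem app_pair (X Y : FinGSet G) (a : S.obj.obj X) (b : S.obj.obj Y) :
    φ.hom.app _ ((S.prodEquiv X Y).symm (a, b)) =
      (S'.prodEquiv X Y).symm (φ.hom.app X a, φ.hom.app Y b) := by
  rw [Equiv.eq_symm_apply]
  have h := (S.prodEquiv X Y).apply_symm_apply (a, b)
  refine Prod.ext ?_ ?_
  · exact (app_map φ _ _).symm.trans (congrArg (fun z => φ.hom.app X z.1) h)
  · exact (app_map φ _ _).symm.trans (congrArg (fun z => φ.hom.app Y z.2) h)

theorem app_zero (X : FinGSet G) : φ.hom.app X (S.zero X) = S'.zero X := by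
  rw [zero, app_map, S'.eq_emptyElt (φ.hom.app _ _)]; rfl

theorem app_one (X : FinGSet G) : φ.hom.app X (S.one X) = S'.one X := by
  rw [one, app_map, S'.eq_emptyElt (φ.hom.app _ _)]; rfl

theorem app_add (X : FinGSet G) (a b : S.obj.obj X) :
    φ.hom.app X (S.add X a b) = S'.add X (φ.hom.app X a) (φ.hom.app X b) := by
  rw [add, app_map, app_pair]; rfl

theorem app_mul (X : FinGSet G) (a b : S.obj.obj X) :
    φ.hom.app X (S.mul X a b) = S'.mul X (φ.hom.app X a) (φ.hom.app X b) := by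
  rw [mul, app_map, app_pair]; rfl

end naturality

end TambaraFunctor

/-- Two sets `A` and `B` with the operations of a Tambara pair (no axioms): `0`, `1`, `+`, `·` on
each, scalars from `G` on `A`, and maps `res : B → A`, `trc, nrm : A → B`. -/
structure PairData (G : Type) where
  A : Type w
  B : Type w
  [zeroA : Zero A]
  [oneA : One A]
  [addA : Add A]
  [mulA : Mul A]
  [smulA : SMul G A]
  [zeroB : Zero B]
  [oneB : One B]
  [addB : Add B]
  [mulB : Mul B]
  res : B → A
  trc : A → B
  nrm : A → B

namespace PairData

attribute [instance] zeroA oneA addA mulA smulA zeroB oneB addB mulB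

/-- A pair of maps that preserve all the operations. -/
@[ext]
structure Hom {G : Type} (P Q : PairData.{w} G) where
  onA : P.A → Q.A
  onB : P.B → Q.B
  zeroA : onA 0 = 0
  oneA : onA 1 = 1
  addA : ∀ a a', onA (a + a') = onA a + onA a'
  mulA : ∀ a a', onA (a * a') = onA a * onA a'
  smulA : ∀ (g : G) a, onA (g • a) = g • onA a
  zeroB : onB 0 = 0
  oneB : onB 1 = 1
  addB : ∀ b b', onB (b + b') = onB b + onB b'
  mulB : ∀ b b', onB (b * b') = onB b * onB b'
  res : ∀ b, onA (P.res b) = Q.res (onB b)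
  trc : ∀ a, onB (P.trc a) = Q.trc (onA a)
  nrm : ∀ a, onB (P.nrm a) = Q.nrm (onA a)

instance (G : Type) : Category (PairData.{w} G) where
  Hom P Q := Hom P Q
  id P := ⟨id, id, rfl, rfl, fun _ _ => rfl, fun _ _ => rfl, fun _ _ => rfl, rfl, rfl,
    fun _ _ => rfl, fun _ _ => rfl, fun _ => rfl, fun _ => rfl, fun _ => rfl⟩
  comp f g :=
    { onA := g.onA ∘ f.onA
      onB := g.onB ∘ f.onB
      zeroA := by simp [f.zeroA, g.zeroA]
      oneA := by simp [f.oneA, g.oneA]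
      addA := by simp [f.addA, g.addA]
      mulA := by simp [f.mulA, g.mulA]
      smulA := by simp [f.smulA, g.smulA]
      zeroB := by simp [f.zeroB, g.zeroB]
      oneB := by simp [f.oneB, g.oneB]
      addB := by simp [f.addB, g.addB]
      mulB := by simp [f.mulB, g.mulB]
      res := by simp [f.res, g.res]
      trc := by simp [f.trc, g.trc]
      nrm := by simp [f.nrm, g.nrm] }

end PairData

/-- A Tambara pair, for a group `G` of order two with nontrivial element `χ`. The conjugate of
`a : A` is `χ • a`. Since `G` is commutative, left and right actions of `G` are the same. -/
structure TambaraPair {G : Type} [Group G] (χ : G) where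
  A : Type w
  B : Type w
  [semiringA : CommSemiring A]
  [semiringB : CommSemiring B]
  [action : MulSemiringAction G A]
  res : B →+* A
  trc : A → B
  nrm : A → B
  smul_res : ∀ (g : G) (b : B), g • res b = res b
  trc_zero : trc 0 = 0
  trc_add : ∀ a₀ a₁, trc (a₀ + a₁) = trc a₀ + trc a₁
  trc_conj : ∀ a, trc (χ • a) = trc a
  res_trc : ∀ a, res (trc a) = a + χ • a
  nrm_one : nrm 1 = 1
  nrm_mul : ∀ a₀ a₁, nrm (a₀ * a₁) = nrm a₀ * nrm a₁
  nrm_conj : ∀ a, nrm (χ • a) = nrm a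
  res_nrm : ∀ a, res (nrm a) = a * χ • a
  nrm_zero : nrm 0 = 0
  nrm_add : ∀ a₀ a₁, nrm (a₀ + a₁) = nrm a₀ + nrm a₁ + trc (a₀ * χ • a₁)
  trc_mul_res : ∀ a b, trc (a * res b) = trc a * b

namespace TambaraPair

attribute [instance] semiringA semiringB action

variable {G : Type} [Group G] {χ : G}

/-- A morphism of Tambara pairs: a pair of semiring maps that commute with the action of `G`
and with `res`, `trc` and `nrm`. -/
@[ext]
structure Hom (P Q : TambaraPair.{w} χ) where
  onA : P.A →+* Q.A
  onB : P.B →+* Q.B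
  smul : ∀ (g : G) a, onA (g • a) = g • onA a
  res : ∀ b, onA (P.res b) = Q.res (onB b)
  trc : ∀ a, onB (P.trc a) = Q.trc (onA a)
  nrm : ∀ a, onB (P.nrm a) = Q.nrm (onA a)

/-- The category of Tambara pairs. -/
instance : Category (TambaraPair.{w} χ) where
  Hom P Q := Hom P Q
  id P := ⟨RingHom.id _, RingHom.id _, fun _ _ => rfl, fun _ => rfl, fun _ => rfl, fun _ => rfl⟩
  comp f g :=
    { onA := g.onA.comp f.onA
      onB := g.onB.comp f.onB
      smul := by simp [f.smul, g.smul]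
      res := by simp [f.res, g.res]
      trc := by simp [f.trc, g.trc]
      nrm := by simp [f.nrm, g.nrm] }

/-- The functor that forgets the axioms of a Tambara pair and keeps all the operations. -/
def forget (χ : G) : TambaraPair.{w} χ ⥤ PairData.{w} G where
  obj P := { A := P.A, B := P.B, res := P.res, trc := P.trc, nrm := P.nrm }
  map f :=
    { onA := f.onA
      onB := f.onB
      zeroA := map_zero f.onA
      oneA := map_one f.onA
      addA := map_add f.onA
      mulA := map_mul f.onA
      smulA := f.smul
      zeroB := map_zero f.onB
      oneB := map_one f.onB
      addB := map_add f.onB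
      mulB := map_mul f.onB
      res := f.res
      trc := f.trc
      nrm := f.nrm }

end TambaraPair

namespace TambaraFunctor

variable {G : Type} [Group G] [Finite G]

/-- The sets `A = S(G)` and `B = S(1)`, with their additions and multiplications, with `g ∈ G`
acting on `A` by `R_f` for the `G`-map `f : G → G`, `f(x) = x g`, and with `res = R_ε`,
`trc = T_ε`, `nrm = N_ε` for the projection `ε : G → 1`. -/
noncomputable def pairData (S : TambaraFunctor.{w} G) : PairData.{w} G where
  A := S.obj.obj (FinGSet.regular G)
  B := S.obj.obj (FinGSet.point G)
  zeroA := ⟨S.zero _⟩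
  oneA := ⟨S.one _⟩
  addA := ⟨S.add _⟩
  mulA := ⟨S.mul _⟩
  smulA := ⟨fun g a => S.obj.map (FinGSet.R (FinGSet.rightMul g)) a⟩
  zeroB := ⟨S.zero _⟩
  oneB := ⟨S.one _⟩
  addB := ⟨S.add _⟩
  mulB := ⟨S.mul _⟩
  res := fun b => S.obj.map (FinGSet.R (FinGSet.regular G).toPoint) b
  trc := fun a => S.obj.map (FinGSet.T (FinGSet.regular G).toPoint) a
  nrm := fun a => S.obj.map (FinGSet.N (FinGSet.regular G).toPoint) a

/-- The functor that sends `S` to `(S(G), S(1))` with all its operations, and a morphism `φ` to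
`(φ_G, φ_1)`. -/
noncomputable def pairFunctor (G : Type) [Group G] [Finite G] :
    TambaraFunctor.{w} G ⥤ PairData.{w} G where
  obj S := S.pairData
  map {S S'} φ :=
    { onA := fun a => φ.hom.app (FinGSet.regular G) a
      onB := fun b => φ.hom.app (FinGSet.point G) b
      zeroA := app_zero φ _
      oneA := app_one φ _
      addA := app_add φ _
      mulA := app_mul φ _
      smulA := fun _ _ => app_map φ _ _
      zeroB := app_zero φ _
      oneB := app_one φ _
      addB := app_add φ _
      mulB := app_mul φ _
      res := app_map φ _
      trc := app_map φ _
      nrm := app_map φ _ }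

end TambaraFunctor

/-! The explicit inverse construction `(A, B) ↦ EP`. -/

section inverse

variable {G : Type} [Group G]

/-- The map `f^G : X^G → Y^G` of fixed points induced by a `G`-map `f : X → Y`. -/
def FinGSet.onFixed {X Y : FinGSet G} (f : X →[G] Y)
    (x : MulAction.fixedPoints G X) : MulAction.fixedPoints G Y :=
  ⟨f x, fun g => by rw [← map_smul, x.2 g]⟩

/-- The set of pairs `(u, v)` with `u : X → A` equivariant and `v : X^G → B` any map, such that
`u(x) = res(v(x))` for all `x ∈ X^G`. -/
@[ext]
structure EP {χ : G} (P : TambaraPair.{w} χ) (X : FinGSet G) where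
  u : X →[G] P.A
  v : MulAction.fixedPoints G X → P.B
  compat : ∀ x : MulAction.fixedPoints G X, u x = P.res (v x)

/-- `X₁` contains exactly one point of each free orbit in `f⁻¹(Y^G)`, i.e. `f⁻¹(Y^G)` is the
disjoint union of `X^G`, `X₁` and `χ X₁`. -/
structure IsFreeSection (χ : G) {X Y : FinGSet G} (f : X →[G] Y) (X₁ : Set X) : Prop where
  union : f ⁻¹' MulAction.fixedPoints G Y =
    MulAction.fixedPoints G X ∪ X₁ ∪ (fun x => χ • x) '' X₁
  disjoint_fixed : Disjoint (MulAction.fixedPoints G X) X₁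
  disjoint_fixed' : Disjoint (MulAction.fixedPoints G X) ((fun x => χ • x) '' X₁)
  disjoint_conj : Disjoint X₁ ((fun x => χ • x) '' X₁)

/-- An identification of the values `E(P)(X)` of a functor `E` from Tambara pairs to Tambara
functors with the sets `EP P X`, such that `E` is given by the evident formulas on morphisms of
pairs, and the operators `R_f`, `T_f` and `N_f` are given by the explicit formulas. All sums and
products are over finite sets. -/
structure IsExplicitInverse (χ : G) (E : TambaraPair.{w} χ ⥤ TambaraFunctor.{w} G)
    (ι : ∀ (P : TambaraPair.{w} χ) (X : FinGSet G), (E.obj P).obj.obj X ≃ EP P X) : Prop where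
  map_u : ∀ {P Q : TambaraPair.{w} χ} (φ : P ⟶ Q) (X : FinGSet G) (c : (E.obj P).obj.obj X)
    (x : X), (ι Q X ((E.map φ).hom.app X c)).u x = φ.onA ((ι P X c).u x)
  map_v : ∀ {P Q : TambaraPair.{w} χ} (φ : P ⟶ Q) (X : FinGSet G) (c : (E.obj P).obj.obj X)
    (x : MulAction.fixedPoints G X),
    (ι Q X ((E.map φ).hom.app X c)).v x = φ.onB ((ι P X c).v x)
  R_u : ∀ (P : TambaraPair.{w} χ) {X Y : FinGSet G} (f : X →[G] Y) (c : (E.obj P).obj.obj Y)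
    (x : X), (ι P X ((E.obj P).obj.map (FinGSet.R f) c)).u x = (ι P Y c).u (f x)
  R_v : ∀ (P : TambaraPair.{w} χ) {X Y : FinGSet G} (f : X →[G] Y) (c : (E.obj P).obj.obj Y)
    (x : MulAction.fixedPoints G X),
    (ι P X ((E.obj P).obj.map (FinGSet.R f) c)).v x = (ι P Y c).v (FinGSet.onFixed f x)
  T_u : ∀ (P : TambaraPair.{w} χ) {X Y : FinGSet G} (f : X →[G] Y) (c : (E.obj P).obj.obj X)
    (y : Y), (ι P Y ((E.obj P).obj.map (FinGSet.T f) c)).u y =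
      ∑ᶠ x : {x : X // f x = y}, (ι P X c).u x
  T_v : ∀ (P : TambaraPair.{w} χ) {X Y : FinGSet G} (f : X →[G] Y) (X₁ : Set X),
    IsFreeSection χ f X₁ → ∀ (c : (E.obj P).obj.obj X) (y : MulAction.fixedPoints G Y),
    (ι P Y ((E.obj P).obj.map (FinGSet.T f) c)).v y =
      (∑ᶠ x : {x : MulAction.fixedPoints G X // f x = y}, (ι P X c).v x) +
        ∑ᶠ x : {x : X // x ∈ X₁ ∧ f x = y}, P.trc ((ι P X c).u x)
  N_u : ∀ (P : TambaraPair.{w} χ) {X Y : FinGSet G} (f : X →[G] Y) (c : (E.obj P).obj.obj X)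
    (y : Y), (ι P Y ((E.obj P).obj.map (FinGSet.N f) c)).u y =
      ∏ᶠ x : {x : X // f x = y}, (ι P X c).u x
  N_v : ∀ (P : TambaraPair.{w} χ) {X Y : FinGSet G} (f : X →[G] Y) (X₁ : Set X),
    IsFreeSection χ f X₁ → ∀ (c : (E.obj P).obj.obj X) (y : MulAction.fixedPoints G Y),
    (ι P Y ((E.obj P).obj.map (FinGSet.N f) c)).v y =
      (∏ᶠ x : {x : MulAction.fixedPoints G X // f x = y}, (ι P X c).v x) *
        ∏ᶠ x : {x : X // x ∈ X₁ ∧ f x = y}, P.nrm ((ι P X c).u x)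

end inverse

/-!
Every finite `G`-set is a disjoint union of copies of the orbits `1` and `G`, so a Tambara functor
`S` is determined as a family of sets by `S(G)` and `S(1)`: an element of `S(X)` amounts to its
restrictions along all maps `G → X` and `1 → X`, which form an element of `EP (F S) X`
(`TambaraFunctor.toEP`). The theorem says that the operators are determined as well, and that the
axioms of a pair are sufficient for them to exist.

Transfers and norms have a common formal structure, a functor with restrictions and one kind of
covariant operators (`SemiMackey`). A `G`-map is built from `∅ → Y`, bijections and `G → 1` by
disjoint unions, up to base change along maps from orbits (`FinGSet.map_induction_on`). Therefore a
family of maps that preserves restrictions, the monoid structure and the operator of `G → 1`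
preserves all covariant operators (`SemiMackey.map_M`). This gives the naturality of `toEP` and the
functoriality of `EP P` in `P`.

That `F S` is a pair comes down to three composites of bispans, which express the projection
formula (`FinGSet.T_comp_N_fold`) and the axioms on `nrm(0)` and `nrm(a + b)`
(`FinGSet.T_fromEmpty_comp_N`, `FinGSet.T_fold_comp_N`).

The main point is that `EP P` is a functor on bispans. The action `T_r N_q R_p` of a bispan is
visibly compatible with composition by transfers, and by the Beck–Chevalley property also by
restrictions. For the composition with a norm `N_f` no general distributive law is needed
(`EP.map_comp_N`): induction on `f` leaves the fold maps and `G → 1`. For a fold map, both sides are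
products, in the Tambara functor represented by `U` and in `EP P`, and the projection formula, valid
in both, reduces them to products of bispans without transfers (`EP.map_mul`). For `G → 1`,
induction on the source of the transfer reduces to the formula for `nrm(a + b)`, again valid in both
(`EP.map_comp_T_comp_N_toPoint`).

The operators on `EP P` are defined by products over orbits (`orbitProd`), which need no choice of a
set `X₁` of representatives and agree with the formula for any such choice (`EP.extend_v`).
-/

universe w'

/-! ### The category of bispans: composites with the basic operators -/

namespace FinGSet

variable {G : Type} [Group G] {X Y Z W : FinGSet G}

/-- The `G`-map out of a disjoint union with given components. -/
def elim (f : X →[G] Z) (g : Y →[G] Z) : sum X Y →[G] Z where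
  toFun := Sum.elim f g
  map_smul' := by rintro h (x | x); exacts [map_smul f h x, map_smul g h x]

/-- The disjoint union of two `G`-maps. -/
def sumMap (f : X →[G] Z) (g : Y →[G] W) : sum X Y →[G] sum Z W :=
  elim ((inl Z W).comp f) ((inr Z W).comp g)

/-- A commutative square of `G`-maps that is cartesian: `X'` is the pullback of `f` and `g`. -/
structure IsPull {X' X Y' Y : FinGSet G} (f' : X' →[G] Y') (g' : X' →[G] X) (g : Y' →[G] Y)
    (f : X →[G] Y) : Prop where
  comm : ∀ x, f (g' x) = g (f' x)
  inj : ∀ x₁ x₂, g' x₁ = g' x₂ → f' x₁ = f' x₂ → x₁ = x₂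
  surj : ∀ x y, f x = g y → ∃ x', g' x' = x ∧ f' x' = y

end FinGSet

namespace Bispan

variable {G : Type} [Group G] {U X Y Z : FinGSet G}

/-- The bispan obtained by composing the last map with `f`. -/
def push (f : X →[G] Y) (ω : Bispan U X) : Bispan U Y := { ω with r := f.comp ω.r }

/-- The bispan obtained by composing the first map with `f`. -/
def restrict (f : X →[G] Y) (ω : Bispan X U) : Bispan Y U := { ω with p := f.comp ω.p }

/-- The bispan `X ←p- A -q→ B -1→ B`. -/
def RN {A B : FinGSet G} (p : A →[G] X) (q : A →[G] B) : Bispan X B where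
  A := A
  B := B
  p := p
  q := q
  r := MulActionHom.id G

/-- In the composite with `T_f`, a point of the right-hand middle term is a map on a fibre of the
identity, that is, a point of `ω.B`. -/
theorem T_comp (f : X →[G] Y) (ω : Bispan U X) : comp (T f) ω ≈ push f ω := by
  have hs : ∀ (x : CompB (T f) ω) (a : X) (h : a = x.b), x.s ⟨a, h⟩ = x.s ⟨x.b, rfl⟩ :=
    fun x a h => CompB.s_congr rfl h _ _
  have sβ : ∀ (g : G) (x : CompB (T f) ω),
      (g • x).s ⟨(g • x).b, rfl⟩ = g • x.s ⟨x.b, rfl⟩ := by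
    intro g x
    exact (CompB.smul_s g x _ rfl (inv_smul_smul g x.b)).trans
      (congrArg _ (hs x _ (inv_smul_smul g x.b)))
  have e₁ : ∀ x : CompA (T f) ω, x.a₁ = x.t.b := fun x => x.h₁
  have e₀ : ∀ x : CompA (T f) ω, ω.q x.a₀ = x.t.s ⟨x.t.b, rfl⟩ := fun x =>
    x.h₀.trans (hs x.t _ x.h₁)
  have hb : ∀ x : CompB (T f) ω, x.b = ω.r (x.s ⟨x.b, rfl⟩) := fun x => (x.hs ⟨x.b, rfl⟩).symm
  have inj : ∀ x y : CompB (T f) ω, x.s ⟨x.b, rfl⟩ = y.s ⟨y.b, rfl⟩ → x = y :=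
    fun x y h => CompB.ext' ((hb x).trans ((congrArg ω.r h).trans (hb y).symm))
      fun a hx hy => (hs x a hx).trans (h.trans (hs y a hy).symm)
  refine equiv_of_bijective (ω := comp (T f) ω) (ω' := push f ω)
    (fun x : CompA (T f) ω => x.a₀) (fun x : CompB (T f) ω => x.s ⟨x.b, rfl⟩)
    ⟨?_, ?_⟩ ⟨fun x y h => inj x y h, ?_⟩ (fun _ _ => rfl) sβ (fun _ => rfl) e₀ ?_
  · intro x y (h : x.a₀ = y.a₀)
    have ht := inj _ _ ((e₀ x).symm.trans ((congrArg ω.q h).trans (e₀ y)))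
    exact CompA.ext h ((e₁ x).trans ((congrArg CompB.b ht).trans (e₁ y).symm)) ht
  · intro a
    exact ⟨⟨a, ω.r (ω.q a), ⟨ω.r (ω.q a), fun _ => ω.q a, fun c => c.2.symm⟩, rfl, rfl⟩, rfl⟩
  · intro b
    exact ⟨⟨ω.r b, fun _ => b, fun c => c.2.symm⟩, rfl⟩
  · intro x
    exact congrArg f (hb x).symm

/-- In a composite `ω ∘ R_f` the condition on `s` forces `s = ω.p`. -/
theorem comp_R (f : X →[G] Y) (ω : Bispan X U) : comp ω (R f) ≈ restrict f ω := by
  have hs : ∀ (x : CompB ω (R f)) a, x.s a = ω.p a.1 := fun x a => x.hs a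
  have hβ : Function.Bijective (fun x : CompB ω (R f) => x.b) := by
    refine ⟨fun x y h => CompB.ext' h fun a hx hy => ?_,
      fun b => ⟨⟨b, fun a => ω.p a.1, fun _ => rfl⟩, rfl⟩⟩
    rw [hs, hs]
  refine equiv_of_bijective (ω := comp ω (R f)) (ω' := restrict f ω)
    (fun x : CompA ω (R f) => x.a₁) (fun x : CompB ω (R f) => x.b)
    ⟨?_, ?_⟩ hβ (fun _ _ => rfl) (fun _ _ => rfl) ?_ (fun x => x.h₁) (fun _ => rfl)
  · intro x y (h : x.a₁ = y.a₁)
    have h1 : x.a₀ = ω.p x.a₁ := x.h₀.trans (hs _ _)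
    have h2 : y.a₀ = ω.p y.a₁ := y.h₀.trans (hs _ _)
    exact CompA.ext (by rw [h1, h2, h]) h
      (hβ.1 (x.h₁.symm.trans ((congrArg ω.q h).trans y.h₁)))
  · intro a
    exact ⟨⟨ω.p a, a, ⟨ω.q a, fun a => ω.p a.1, fun _ => rfl⟩, rfl, rfl⟩, rfl⟩
  · intro x
    exact congrArg f ((hs x.t ⟨x.a₁, x.h₁⟩).symm.trans x.h₀.symm)

/-- In a composite of `N_f` with a transfer-free bispan the map `s` is forced to be the inclusion
of the fibre. -/
theorem N_comp_RN {A B : FinGSet G} (p : A →[G] X) (q : A →[G] B) (f : B →[G] Y) :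
    comp (N f) (RN p q) ≈ RN p (f.comp q) := by
  have hs : ∀ (x : CompB (N f) (RN p q)) a, x.s a = a.1 := fun x a => x.hs a
  have e : ∀ x : CompA (N f) (RN p q), q x.a₀ = x.a₁ := fun x => x.h₀.trans (hs _ _)
  have hβ : Function.Bijective (fun x : CompB (N f) (RN p q) => x.b) := by
    refine ⟨fun x y h => CompB.ext' h fun a hx hy => ?_,
      fun b => ⟨⟨b, fun a => a.1, fun _ => rfl⟩, rfl⟩⟩
    rw [hs, hs]
  refine equiv_of_bijective (ω := comp (N f) (RN p q)) (ω' := RN p (f.comp q))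
    (fun x : CompA (N f) (RN p q) => x.a₀) (fun x : CompB (N f) (RN p q) => x.b)
    ⟨?_, ?_⟩ hβ (fun _ _ => rfl) (fun _ _ => rfl) (fun _ => rfl) ?_ (fun _ => rfl)
  · intro x y (h : x.a₀ = y.a₀)
    have h1 : x.a₁ = y.a₁ := (e x).symm.trans ((congrArg q h).trans (e y))
    exact CompA.ext h h1 (hβ.1 (x.h₁.symm.trans ((congrArg f h1).trans y.h₁)))
  · intro a
    exact ⟨⟨a, q a, ⟨f (q a), fun a => a.1, fun _ => rfl⟩, rfl, rfl⟩, rfl⟩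
  · intro x
    exact (congrArg f (e x)).trans x.h₁

/-- Recognition of a composite `N_f ∘ T_g` for `Z -g→ X -f→ Y`. The bispan `ω` represents it when
its right-hand middle term parametrizes the pairs of a point `y : Y` and a section of `g` over
`f⁻¹{y}`, and its left-hand middle term the points of `X` over those `y`, with `ω.p` the evaluation
of sections. -/
theorem N_comp_T (g : Z →[G] X) (f : X →[G] Y) (ω : Bispan Z Y)
    (h₁ : ∀ a, f (g (ω.p a)) = ω.r (ω.q a))
    (h₂ : ∀ b x, f x = ω.r b → ∃! a, ω.q a = b ∧ g (ω.p a) = x)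
    (inj : ∀ b b', ω.r b = ω.r b' → (∀ a a', ω.q a = b → ω.q a' = b' →
      g (ω.p a) = g (ω.p a') → ω.p a = ω.p a') → b = b')
    (surj : ∀ (y : Y) (s : {x : X // f x = y} → Z), (∀ x, g (s x) = x) →
      ∃ b, ω.r b = y ∧ ∀ a, ω.q a = b → ∀ h, ω.p a = s ⟨g (ω.p a), h⟩) :
    comp (N f) (T g) ≈ ω := by
  -- `a b x` is the point over `b` at which the section attached to `b` is evaluated at `x`.
  choose a ha using fun b x h => (h₂ b x h)
  have ha' : ∀ c h, a (ω.q c) (g (ω.p c)) h = c := fun c h =>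
    ((ha (ω.q c) (g (ω.p c)) h).2 c ⟨rfl, rfl⟩).symm
  let β : ω.B → CompB (N f) (T g) := fun b =>
    { b := ω.r b
      s := fun x => ω.p (a b x.1 x.2)
      hs := fun x => (ha b x.1 x.2).1.2 }
  have βs : ∀ c b (hb : ω.q c = b) h, (β b).s ⟨g (ω.p c), h⟩ = ω.p c := by
    rintro c b rfl h
    exact congrArg ω.p (ha' c h)
  let α : ω.A → CompA (N f) (T g) := fun c =>
    { a₀ := ω.p c
      a₁ := g (ω.p c)
      t := β (ω.q c)
      h₁ := h₁ c
      h₀ := (βs c _ rfl _).symm }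
  have βinj : Function.Injective β := by
    intro b b' h
    refine inj b b' (congrArg CompB.b h) fun c c' hc hc' e => ?_
    rw [← βs c b hc (by rw [← hc]; exact h₁ c), ← βs c' b' hc' (by rw [← hc']; exact h₁ c')]
    exact CompB.s_congr h e _ _
  have βsmul : ∀ (k : G) b, β (k • b) = k • β b := by
    intro k b
    refine CompB.ext' (map_smul ω.r k b) fun (x : X) hx hy => ?_
    have hx' : f x = ω.r (k • b) := hx
    have hx'' : f (k⁻¹ • x) = ω.r b := by rw [map_smul, hx', map_smul, inv_smul_smul]
    obtain ⟨e₁, e₂⟩ := (ha b (k⁻¹ • x) hx'').1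
    rw [CompB.smul_s k (β b) x hy hx'']
    change ω.p (a (k • b) x hx') = k • ω.p (a b (k⁻¹ • x) hx'')
    rw [← map_smul]
    refine congrArg ω.p ((ha (k • b) x hx').2 _ ⟨?_, ?_⟩).symm
    · rw [map_smul, e₁]
    · rw [map_smul, map_smul, e₂, smul_inv_smul]
  refine Setoid.symm (equiv_of_bijective (ω := ω) (ω' := comp (N f) (T g)) α β ⟨?_, ?_⟩
    ⟨βinj, ?_⟩ ?_ βsmul (fun _ => rfl) (fun _ => rfl) (fun _ => rfl))
  · intro c c' h
    have e₁ : ω.q c = ω.q c' := βinj (congrArg CompA.t h)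
    have e₂ : g (ω.p c) = g (ω.p c') := congrArg CompA.a₁ h
    exact (h₂ (ω.q c') (g (ω.p c')) (h₁ c')).unique ⟨e₁, e₂⟩ ⟨rfl, rfl⟩
  · intro x
    obtain ⟨b, hb, hb'⟩ := surj x.t.b x.t.s x.t.hs
    have ht : β b = x.t := by
      refine CompB.ext' hb fun z hz hz' => ?_
      obtain ⟨e₁, e₂⟩ := (ha b z hz).1
      have h : f (g (ω.p (a b z hz))) = x.t.b := by rw [e₂]; exact hz'
      refine (hb' _ e₁ h).trans (CompB.s_congr rfl e₂ _ _)
    have hx : f x.a₁ = ω.r b := x.h₁.trans hb.symm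
    obtain ⟨e₁, e₂⟩ := (ha b x.a₁ hx).1
    have e₃ : β (ω.q (a b x.a₁ hx)) = x.t := by rw [e₁, ht]
    refine ⟨a b x.a₁ hx, CompA.ext ?_ e₂ e₃⟩
    refine Eq.trans ?_ x.h₀.symm
    exact CompB.s_congr ht (rfl : x.a₁ = x.a₁) hx x.h₁
  · intro t
    obtain ⟨b, hb, hb'⟩ := surj t.b t.s t.hs
    refine ⟨b, CompB.ext' hb fun z hz hz' => ?_⟩
    obtain ⟨e₁, e₂⟩ := (ha b z hz).1
    have h : f (g (ω.p (a b z hz))) = t.b := by rw [e₂]; exact hz'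
    exact (hb' _ e₁ h).trans (CompB.s_congr rfl e₂ _ _)
  · intro k c
    refine CompA.ext (map_smul ω.p k c) ?_ ?_
    · change g (ω.p (k • c)) = k • g (ω.p c)
      rw [map_smul, map_smul]
    · change β (ω.q (k • c)) = k • β (ω.q c)
      rw [map_smul, βsmul]

variable {X' Y' : FinGSet G} {f' : X' →[G] Y'} {g' : X' →[G] X} {g : Y' →[G] Y} {f : X →[G] Y}

/-- The two composites of a Beck–Chevalley square for transfers agree. -/
theorem pull_T (h : FinGSet.IsPull f' g' g f) : push f' (R g') ≈ pull g (T f) := by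
  have hb : Function.Bijective
      (fun x => ⟨(f' x, g' x), (h.comm x).symm⟩ : X' → {z : Y' × X // g z.1 = f z.2}) := by
    constructor
    · intro x x' e
      exact h.inj x x' (congrArg (fun z => z.1.2) e) (congrArg (fun z => z.1.1) e)
    · rintro ⟨⟨y, x⟩, e⟩
      obtain ⟨x', rfl, rfl⟩ := h.surj x y e.symm
      exact ⟨x', rfl⟩
  have hs : ∀ (k : G) (x : X'), (⟨(f' (k • x), g' (k • x)), (h.comm _).symm⟩ :
      {z : Y' × X // g z.1 = f z.2}) = ⟨(k • f' x, k • g' x), by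
        rw [map_smul, map_smul, h.comm]⟩ := fun k x =>
    Subtype.ext (Prod.ext (map_smul f' k x) (map_smul g' k x))
  exact equiv_of_bijective (ω := push f' (R g')) (ω' := pull g (T f)) _ _ hb hb hs hs
    (fun _ => rfl) (fun _ => rfl) (fun _ => rfl)

/-- The two composites of a Beck–Chevalley square for norms agree. -/
theorem pull_N (h : FinGSet.IsPull f' g' g f) : RN g' f' ≈ pull g (N f) := by
  refine equiv_of_bijective (ω := RN g' f') (ω' := pull g (N f))
    (fun x : X' => (⟨(f' x, g' x), (h.comm x).symm⟩ : {z : Y' × X // g z.1 = f z.2}))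
    (fun y : Y' => (⟨(y, g y), rfl⟩ : {z : Y' × Y // g z.1 = z.2}))
    ⟨?_, ?_⟩ ⟨?_, ?_⟩ ?_ ?_ (fun _ => rfl) ?_ (fun _ => rfl)
  · intro x x' e
    exact h.inj x x' (congrArg (fun z => z.1.2) e) (congrArg (fun z => z.1.1) e)
  · rintro ⟨⟨y, x⟩, e⟩
    obtain ⟨x', rfl, rfl⟩ := h.surj x y e.symm
    exact ⟨x', rfl⟩
  · intro y y' e
    exact congrArg (fun z => z.1.1) e
  · rintro ⟨⟨y, x⟩, e⟩
    exact ⟨y, Subtype.ext (Prod.ext rfl e)⟩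
  · intro k x
    exact Subtype.ext (Prod.ext (map_smul f' k x) (map_smul g' k x))
  · intro k y
    exact Subtype.ext (Prod.ext rfl (map_smul g k y))
  · intro x
    exact Subtype.ext (Prod.ext rfl (h.comm x))

end Bispan

namespace FinGSet

variable {G : Type} [Group G] {U X Y Z : FinGSet G}

theorem R_id : R (MulActionHom.id G : X →[G] X) = 𝟙 X := rfl

theorem N_id : N (MulActionHom.id G : X →[G] X) = 𝟙 X := rfl

theorem R_comp (f : X →[G] Y) (g : Y →[G] Z) : R g ≫ R f = R (g.comp f) :=
  Quotient.sound (Bispan.comp_R g (Bispan.R f))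

theorem T_comp (f : X →[G] Y) (g : Y →[G] Z) : T f ≫ T g = T (g.comp f) :=
  Quotient.sound (Bispan.T_comp g (Bispan.T f))

theorem R_comp_N {A B : FinGSet G} (p : A →[G] X) (q : A →[G] B) :
    R p ≫ N q = (Quotient.mk _ (Bispan.RN p q) : X ⟶ B) :=
  Quotient.sound (Bispan.comp_R p (Bispan.N q))

theorem N_comp (f : X →[G] Y) (g : Y →[G] Z) : N f ≫ N g = N (g.comp f) :=
  Quotient.sound (Bispan.N_comp_RN (MulActionHom.id G) f g)

/-- Every morphism is of the form `T_r N_q R_p`. -/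
theorem mk_eq (ω : Bispan X Y) :
    (Quotient.mk _ ω : X ⟶ Y) = R ω.p ≫ N ω.q ≫ T ω.r := by
  rw [← Category.assoc, R_comp_N]
  exact (Quotient.sound (Bispan.T_comp ω.r (Bispan.RN ω.p ω.q))).symm

/-- Beck–Chevalley for transfers. -/
theorem T_comp_R {X' Y' : FinGSet G} {f' : X' →[G] Y'} {g' : X' →[G] X} {g : Y' →[G] Y}
    {f : X →[G] Y} (h : IsPull f' g' g f) : T f ≫ R g = R g' ≫ T f' :=
  Quotient.sound (Setoid.trans (Bispan.R_comp g (Bispan.T f)) (Setoid.trans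
    (Setoid.symm (Bispan.pull_T h)) (Setoid.symm (Bispan.T_comp f' (Bispan.R g')))))

/-- Beck–Chevalley for norms. -/
theorem N_comp_R {X' Y' : FinGSet G} {f' : X' →[G] Y'} {g' : X' →[G] X} {g : Y' →[G] Y}
    {f : X →[G] Y} (h : IsPull f' g' g f) : N f ≫ R g = R g' ≫ N f' := by
  rw [R_comp_N]
  exact Quotient.sound (Setoid.trans (Bispan.R_comp g (Bispan.N f))
    (Setoid.symm (Bispan.pull_N h)))

end FinGSet

/-! ### Groups of order two and the distributive identities -/

/-- The element `χ` is the only nontrivial element of its group, which therefore has order two. -/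
class OrderTwo {G : Type} [Group G] (χ : G) : Prop where
  ne_one : χ ≠ 1
  eq_or : ∀ g : G, g = 1 ∨ g = χ

namespace OrderTwo

variable {G : Type} [Group G] {χ : G}

theorem of_card (hG : Nat.card G = 2) (hχ : χ ≠ 1) : OrderTwo χ where
  ne_one := hχ
  eq_or g := by
    obtain ⟨a, b, -, h⟩ := Nat.card_eq_two_iff.1 hG
    have key : ∀ x : G, x = a ∨ x = b := fun x => by
      have : x ∈ ({a, b} : Set G) := h ▸ Set.mem_univ x
      simpa using this
    rcases key 1 with h1 | h1 <;> rcases key χ with h2 | h2 <;> rcases key g with h3 | h3 <;>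
      simp_all

theorem mul_self [h : OrderTwo χ] : χ * χ = 1 := by
  rcases h.eq_or (χ * χ) with e | e
  · exact e
  · exact absurd (mul_eq_left.1 e) h.ne_one

variable {α : Type*} [MulAction G α]

theorem smul_smul [OrderTwo χ] (x : α) : χ • χ • x = x := by
  rw [← mul_smul, mul_self, one_smul]

theorem mem_fixedPoints [h : OrderTwo χ] {x : α} :
    x ∈ MulAction.fixedPoints G α ↔ χ • x = x := by
  refine ⟨fun hx => hx χ, fun hx g => ?_⟩
  rcases h.eq_or g with rfl | rfl
  · exact one_smul G x
  · exact hx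

end OrderTwo

namespace FinGSet

variable {G : Type} [Group G] {X Y Z : FinGSet G}

/-- The bispan form of the projection formula `a · T_f(b) = T_f(f^*(a) · b)`. -/
theorem T_comp_N_fold (f : X →[G] Y) :
    T (sumMap (MulActionHom.id G) f) ≫ N (fold Y) =
      R (sumMap f (MulActionHom.id G)) ≫ N (fold X) ≫ T f := by
  let ω : Bispan (sum Y X) Y :=
    ⟨sum X X, X, sumMap f (MulActionHom.id G), fold X, f⟩
  rw [← show (Quotient.mk _ ω : sum Y X ⟶ Y) = _ from mk_eq ω]
  refine Quotient.sound (Bispan.N_comp_T _ _ ω ?_ ?_ ?_ ?_)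
  · rintro (x | x) <;> rfl
  -- The fibre of the fold map over `f b` consists of two points, one in each copy of `Y`.
  · rintro (b : X) (y | y) (h : y = f b)
    · refine ⟨Sum.inl b, ⟨rfl, congrArg Sum.inl h.symm⟩, ?_⟩
      rintro (a | a) ⟨rfl, e⟩
      · rfl
      · exact absurd e Sum.inr_ne_inl
    · refine ⟨Sum.inr b, ⟨rfl, congrArg Sum.inr h.symm⟩, ?_⟩
      rintro (a | a) ⟨rfl, e⟩
      · exact absurd e Sum.inl_ne_inr
      · rfl
  · intro (b : X) (b' : X) (h : f b = f b') H
    exact Sum.inr_injective (H (Sum.inr b) (Sum.inr b') rfl rfl (congrArg Sum.inr h))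
  · intro y s hs
    -- A section over `{y, y}` is determined by its value at the second `y`, which lies in `X`.
    have key : ∃ b : X, s ⟨Sum.inr y, rfl⟩ = Sum.inr b := by
      rcases e : s ⟨Sum.inr y, rfl⟩ with z | z
      · have := hs ⟨Sum.inr y, rfl⟩
        rw [e] at this
        exact absurd this Sum.inl_ne_inr
      · exact ⟨z, rfl⟩
    obtain ⟨b, hb⟩ := key
    have hfb : f b = y := by
      have := hs ⟨Sum.inr y, rfl⟩
      rw [hb] at this
      exact Sum.inr_injective this
    subst hfb
    refine ⟨b, rfl, ?_⟩
    rintro (a | a) (rfl : a = b) h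
    · rcases e : s ⟨Sum.inl (f a), rfl⟩ with z | z
      · have := hs ⟨Sum.inl (f a), rfl⟩
        rw [e] at this
        exact (congrArg Sum.inl (Sum.inl_injective this).symm).trans e.symm
      · have := hs ⟨Sum.inl (f a), rfl⟩
        rw [e] at this
        exact absurd this Sum.inr_ne_inl
    · exact hb.symm

/-- The bispan form of `N_f(0) = 0`, for `f` surjective. -/
theorem T_fromEmpty_comp_N (f : X →[G] Y) (hf : Function.Surjective f) :
    T (fromEmpty X) ≫ N f = T (fromEmpty Y) := by
  refine Quotient.sound (Bispan.N_comp_T _ _ (Bispan.T (fromEmpty Y)) ?_ ?_ ?_ ?_)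
  · intro a
    exact PEmpty.elim a
  · intro b
    exact PEmpty.elim b
  · intro b
    exact PEmpty.elim b
  · intro y s
    obtain ⟨x, hx⟩ := hf y
    exact PEmpty.elim (s ⟨x, hx⟩)

/-- A bijective `G`-map has an inverse `G`-map. -/
theorem exists_inverse (f : X →[G] Y) (hf : Function.Bijective f) :
    ∃ g : Y →[G] X, f.comp g = MulActionHom.id G ∧ g.comp f = MulActionHom.id G := by
  let e := Equiv.ofBijective f hf
  refine ⟨⟨e.symm, fun k y => ?_⟩, ?_, ?_⟩
  · rw [Equiv.symm_apply_eq]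
    change k • y = f (k • e.symm y)
    rw [map_smul]
    exact congrArg (k • ·) (e.apply_symm_apply y).symm
  · exact MulActionHom.ext fun y => e.apply_symm_apply y
  · exact MulActionHom.ext fun y => e.symm_apply_apply y

variable [Finite G]

/-- The element of `G` underlying a point of the `G`-set `G`; the coercion makes products of such
points elaborate. -/
def elt (x : regular G) : G := x

/-- The bispan form of `nrm(a + b) = nrm(a) + nrm(b) + trc(a χb)`. The sections of the fold map
over `G` are the two constant ones, which are fixed, and two others, which are interchanged. -/
theorem T_fold_comp_N {χ : G} [hχ : OrderTwo χ] :
    T (fold (regular G)) ≫ N (toPoint (regular G)) =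
      R (elim (MulActionHom.id G)
        (elim (inl _ _) ((inr (regular G) (regular G)).comp (rightMul χ)))) ≫
      N (sumMap (sumMap (toPoint (regular G)) (toPoint (regular G))) (fold (regular G))) ≫
      T (toPoint (sum (sum (point G) (point G)) (regular G))) := by
  let ω : Bispan (sum (regular G) (regular G)) (point G) :=
    ⟨sum (sum (regular G) (regular G)) (sum (regular G) (regular G)),
      sum (sum (point G) (point G)) (regular G),
      elim (MulActionHom.id G) (elim (inl _ _) ((inr (regular G) (regular G)).comp (rightMul χ))),
      sumMap (sumMap (toPoint (regular G)) (toPoint (regular G))) (fold (regular G)),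
      toPoint (sum (sum (point G) (point G)) (regular G))⟩
  rw [← show (Quotient.mk _ ω : _ ⟶ point G) = _ from mk_eq ω]
  have χχ : ∀ g : G, g * χ * χ = g := fun g => by rw [mul_assoc, hχ.mul_self, mul_one]
  have ne : ∀ g : G, g * χ ≠ g := fun g h => hχ.ne_one (mul_eq_left.1 h)
  refine Quotient.sound (Bispan.N_comp_T _ _ ω (fun _ => rfl) ?_ ?_ ?_)
  -- The points of `1 ⊔ 1` stand for the sections `inl` and `inr`, and `b : G` for the section with
  -- `b ↦ inl b` and `bχ ↦ inr (bχ)`.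
  · rintro ((b | b) | b) (x : G) -
    · refine ⟨Sum.inl (Sum.inl x), ⟨rfl, rfl⟩, ?_⟩
      rintro ((a | a) | (a | a)) ⟨h, h'⟩
      · exact congrArg (Sum.inl ∘ Sum.inl) h'
      · exact absurd (Sum.inl_injective h) Sum.inr_ne_inl
      · exact absurd h Sum.inr_ne_inl
      · exact absurd h Sum.inr_ne_inl
    · refine ⟨Sum.inl (Sum.inr x), ⟨rfl, rfl⟩, ?_⟩
      rintro ((a | a) | (a | a)) ⟨h, h'⟩
      · exact absurd (Sum.inl_injective h) Sum.inl_ne_inr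
      · exact congrArg (Sum.inl ∘ Sum.inr) h'
      · exact absurd h Sum.inr_ne_inl
      · exact absurd h Sum.inr_ne_inl
    · have hx : x = elt b ∨ x = elt b * χ := by
        rcases hχ.eq_or ((elt b)⁻¹ * x) with h | h
        · exact Or.inl (inv_mul_eq_one.1 h).symm
        · exact Or.inr (inv_mul_eq_iff_eq_mul.1 h)
      rcases hx with rfl | rfl
      · refine ⟨Sum.inr (Sum.inl x), ⟨rfl, rfl⟩, ?_⟩
        rintro ((a | a) | (a | a)) ⟨h, h'⟩
        · exact absurd h Sum.inl_ne_inr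
        · exact absurd h Sum.inl_ne_inr
        · exact congrArg (Sum.inr ∘ Sum.inl) h'
        · obtain rfl : a = x := Sum.inr_injective h
          exact absurd h' (ne a)
      · refine ⟨Sum.inr (Sum.inr b), ⟨rfl, rfl⟩, ?_⟩
        rintro ((a | a) | (a | a)) ⟨h, h'⟩
        · exact absurd h Sum.inl_ne_inr
        · exact absurd h Sum.inl_ne_inr
        · obtain rfl : a = b := Sum.inr_injective h
          exact absurd h'.symm (ne a)
        · exact congrArg (Sum.inr ∘ Sum.inr) (Sum.inr_injective h)
  -- Different points give different sections: in each case a point of `G` is named at which they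
  -- differ.
  · have lr : ∀ x y : G, (Sum.inl x : G ⊕ G) ≠ Sum.inr y := fun _ _ => Sum.inl_ne_inr
    rintro ((b | b) | b) ((b' | b') | b') - H
    · rfl
    · exact absurd (H (Sum.inl (Sum.inl (1 : G))) (Sum.inl (Sum.inr (1 : G))) rfl rfl rfl)
        (lr _ _)
    · exact absurd (H (Sum.inl (Sum.inl (elt b' * χ))) (Sum.inr (Sum.inr b')) rfl rfl
        rfl) (lr _ _)
    · exact absurd (H (Sum.inl (Sum.inr (1 : G))) (Sum.inl (Sum.inl (1 : G))) rfl rfl rfl).symm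
        (lr _ _)
    · rfl
    · exact absurd (H (Sum.inl (Sum.inr b')) (Sum.inr (Sum.inl b')) rfl rfl rfl).symm (lr _ _)
    · exact absurd (H (Sum.inr (Sum.inr b)) (Sum.inl (Sum.inl (elt b * χ))) rfl rfl
        rfl).symm (lr _ _)
    · exact absurd (H (Sum.inr (Sum.inl b)) (Sum.inl (Sum.inr b)) rfl rfl rfl) (lr _ _)
    · rcases hχ.eq_or ((elt b)⁻¹ * elt b') with h | h
      · exact congrArg Sum.inr (inv_mul_eq_one (a := elt b) (b := elt b').1 h)
      · have h' : elt b' = elt b * χ := inv_mul_eq_iff_eq_mul.1 h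
        have := H (Sum.inr (Sum.inr b)) (Sum.inr (Sum.inl b')) rfl rfl h'.symm
        exact absurd this.symm (lr _ _)
  -- A section is given by its values at `1` and `χ`, each of which is `inl` or `inr`.
  · intro y s hs
    have hs' : ∀ x : G, s ⟨x, rfl⟩ = Sum.inl x ∨ s ⟨x, rfl⟩ = Sum.inr x := by
      intro x
      have := hs ⟨x, rfl⟩
      rcases e : s ⟨x, rfl⟩ with z | z <;> rw [e] at this
      · exact Or.inl (congrArg Sum.inl this)
      · exact Or.inr (congrArg Sum.inr this)
    have red : ∀ (P : G → Prop), P 1 → P χ → ∀ x, P x := fun P h1 h2 x => by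
      rcases hχ.eq_or x with rfl | rfl <;> assumption
    rcases hs' 1 with h1 | h1 <;> rcases hs' χ with h2 | h2
    · have h : ∀ x : G, s ⟨x, rfl⟩ = Sum.inl x := red _ h1 h2
      refine ⟨Sum.inl (Sum.inl PUnit.unit), rfl, ?_⟩
      rintro ((a | a) | (a | a)) e h'
      · exact (h a).symm
      · exact absurd (Sum.inl_injective e) Sum.inr_ne_inl
      · exact absurd e Sum.inr_ne_inl
      · exact absurd e Sum.inr_ne_inl
    · refine ⟨Sum.inr (1 : G), rfl, ?_⟩
      rintro ((a | a) | (a | a)) e h'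
      · exact absurd e Sum.inl_ne_inr
      · exact absurd e Sum.inl_ne_inr
      · obtain rfl : a = (1 : G) := Sum.inr_injective e
        exact h1.symm
      · obtain rfl : a = (1 : G) := Sum.inr_injective e
        have e' : (1 : G) * χ = χ := one_mul χ
        change Sum.inr ((1 : G) * χ) = s ⟨(1 : G) * χ, _⟩
        rw [e', h2]
    · refine ⟨Sum.inr χ, rfl, ?_⟩
      rintro ((a | a) | (a | a)) e h'
      · exact absurd e Sum.inl_ne_inr
      · exact absurd e Sum.inl_ne_inr
      · obtain rfl : a = χ := Sum.inr_injective e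
        exact h2.symm
      · obtain rfl : a = χ := Sum.inr_injective e
        have e' : elt a * elt a = (1 : G) := hχ.mul_self
        change Sum.inr (elt a * elt a) = s ⟨elt a * elt a, _⟩
        rw [e', h1]
    · have h : ∀ x : G, s ⟨x, rfl⟩ = Sum.inr x := red _ h1 h2
      refine ⟨Sum.inl (Sum.inr PUnit.unit), rfl, ?_⟩
      rintro ((a | a) | (a | a)) e h'
      · exact absurd (Sum.inl_injective e) Sum.inl_ne_inr
      · exact (h a).symm
      · exact absurd e Sum.inr_ne_inl
      · exact absurd e Sum.inr_ne_inl

/-! ### Induction on finite `G`-sets and on equivariant maps -/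

/-- The `G`-map `G → X` with `1 ↦ x`. -/
def orbitMap (x : X) : regular G →[G] X where
  toFun := fun g : G => g • x
  map_smul' := fun g h => mul_smul g h x

/-- The inclusion of a fixed point. -/
def fixedMap (x : X) (hx : x ∈ MulAction.fixedPoints G X) : point G →[G] X where
  toFun := fun _ => x
  map_smul' := fun g _ => (hx g).symm

/-- The sub-`G`-set with a given invariant underlying set. -/
def sub (X : FinGSet G) (s : Set X) (hs : ∀ (g : G) x, x ∈ s → g • x ∈ s) : FinGSet G where
  carrier := s
  action :=
    { smul := fun g x => ⟨g • x.1, hs g x.1 x.2⟩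
      one_smul := fun x => Subtype.ext (one_smul G x.1)
      mul_smul := fun g h x => Subtype.ext (mul_smul g h x.1) }

/-- The inclusion of a sub-`G`-set. -/
def subVal (s : Set X) (hs : ∀ (g : G) x, x ∈ s → g • x ∈ s) : X.sub s hs →[G] X where
  toFun := Subtype.val
  map_smul' := fun _ _ => rfl

/-- Every finite `G`-set is a disjoint union of copies of the orbits `1` and `G`. -/
theorem induction_on (χ : G) [hχ : OrderTwo χ] {P : FinGSet G → Prop}
    (iso : ∀ {X Y : FinGSet G} (f : X →[G] Y), Function.Bijective f → P X → P Y)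
    (empty : P (empty G)) (point : P (point G)) (regular : P (regular G))
    (sum : ∀ {X Y : FinGSet G}, P X → P Y → P (sum X Y)) (X : FinGSet G) : P X := by
  induction hn : Nat.card X using Nat.strong_induction_on generalizing X with
  | _ n ih =>
  rcases isEmpty_or_nonempty X with hX | ⟨⟨x⟩⟩
  · exact iso (fromEmpty X) ⟨fun a => PEmpty.elim a, fun x => isEmptyElim x⟩ empty
  let s : Set X := MulAction.orbit G x
  have hs : ∀ (g : G) y, y ∈ s → g • y ∈ s := fun g y hy => by
    obtain ⟨k, rfl⟩ := hy
    exact ⟨g * k, mul_smul g k x⟩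
  have hsc : ∀ (g : G) y, y ∈ sᶜ → g • y ∈ sᶜ := fun g y hy h => by
    refine hy ?_
    have := hs g⁻¹ _ h
    rwa [inv_smul_smul] at this
  -- The orbit of `x` is a point if `x` is fixed, and a copy of `G` otherwise.
  have hO : P (X.sub s hs) := by
    by_cases hx : χ • x = x
    · have hfix := OrderTwo.mem_fixedPoints.2 hx
      refine iso (fixedMap (X := X.sub s hs) ⟨x, MulAction.mem_orbit_self x⟩
        fun g => Subtype.ext (hfix g)) ⟨fun _ _ _ => rfl, ?_⟩ point
      rintro ⟨y, g, rfl⟩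
      exact ⟨PUnit.unit, Subtype.ext (hfix g).symm⟩
    · refine iso (orbitMap (X := X.sub s hs) ⟨x, MulAction.mem_orbit_self x⟩) ⟨?_, ?_⟩ regular
      · intro (g : G) (h : G) e
        have e : g • x = h • x := congrArg Subtype.val e
        have e' : (h⁻¹ * g) • x = x := by rw [mul_smul, e, inv_smul_smul]
        rcases hχ.eq_or (h⁻¹ * g) with e₁ | e₁
        · exact (inv_mul_eq_one.1 e₁).symm
        · rw [e₁] at e'
          exact absurd e' hx
      · rintro ⟨y, g, rfl⟩
        exact ⟨g, rfl⟩
  have hC : P (X.sub sᶜ hsc) := by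
    refine ih _ ?_ _ rfl
    rw [← hn]
    exact Finite.card_subtype_lt (p := (· ∈ sᶜ)) (x := x)
      fun h => h (MulAction.mem_orbit_self x)
  refine iso (elim (subVal s hs) (subVal sᶜ hsc)) ⟨?_, ?_⟩ (sum hO hC)
  · rintro (⟨a, ha⟩ | ⟨a, ha⟩) (⟨b, hb⟩ | ⟨b, hb⟩) (h : a = b) <;> subst h
    · rfl
    · exact absurd ha hb
    · exact absurd hb ha
    · rfl
  · intro y
    by_cases hy : y ∈ s
    · exact ⟨Sum.inl ⟨y, hy⟩, rfl⟩
    · exact ⟨Sum.inr ⟨y, hy⟩, rfl⟩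

/-- Every `G`-map is obtained from `∅ → Y`, bijections and the projection `G → 1` by composition
and disjoint union, up to base change along maps from orbits. -/
theorem map_induction_on (χ : G) [hχ : OrderTwo χ]
    {P : ∀ {X Y : FinGSet G}, (X →[G] Y) → Prop}
    (loc : ∀ {X Y : FinGSet G} (f : X →[G] Y),
      (∀ {X' Y' : FinGSet G} (f' : X' →[G] Y') (g' : X' →[G] X) (g : Y' →[G] Y),
        Y' = point G ∨ Y' = regular G → IsPull f' g' g f → P f') → P f)
    (comp : ∀ {X Y Z : FinGSet G} (f : X →[G] Y) (g : Y →[G] Z), P f → P g → P (g.comp f))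
    (bij : ∀ {X Y : FinGSet G} (f : X →[G] Y), Function.Bijective f → P f)
    (empty : ∀ Y : FinGSet G, P (fromEmpty Y))
    (sum : ∀ {X X' Y : FinGSet G} (f : FinGSet.sum X X' →[G] Y),
      P (f.comp (inl X X')) → P (f.comp (inr X X')) → P f)
    (toPoint : P (toPoint (regular G))) {X Y : FinGSet G} (f : X →[G] Y) : P f := by
  -- Over an orbit the source may be decomposed into orbits. A map between orbits is bijective or
  -- the projection `G → 1`, as there is no map `1 → G`.
  have key : ∀ Y : FinGSet G, Y = point G ∨ Y = regular G → ∀ (X : FinGSet G) (f : X →[G] Y),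
      P f := by
    intro Y hY X
    induction X using induction_on χ with
    | iso e he ih =>
      intro f
      obtain ⟨g, h₁, h₂⟩ := exists_inverse e he
      have hg : Function.Bijective g := Function.bijective_iff_has_inverse.2
        ⟨e, fun x => DFunLike.congr_fun h₁ x, fun x => DFunLike.congr_fun h₂ x⟩
      have := comp g (f.comp e) (bij g hg) (ih (f.comp e))
      have e' : (f.comp e).comp g = f :=
        MulActionHom.ext fun x => congrArg f (DFunLike.congr_fun h₁ x)
      rwa [e'] at this
    | empty =>
      intro f
      have : f = fromEmpty Y := MulActionHom.ext fun x => PEmpty.elim x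
      exact this ▸ empty Y
    | point =>
      intro f
      rcases hY with rfl | rfl
      · exact bij f ⟨fun _ _ _ => rfl, fun _ => ⟨PUnit.unit, rfl⟩⟩
      · have h : χ • f PUnit.unit = f PUnit.unit := (map_smul f χ PUnit.unit).symm
        exact absurd (mul_eq_right.1 (show χ * elt (f PUnit.unit) = _ from h)) hχ.ne_one
    | regular =>
      intro f
      rcases hY with rfl | rfl
      · exact toPoint
      · have hf : ∀ x : G, elt (f x) = x * elt (f (1 : G)) := fun x =>
          (congrArg f (mul_one x).symm).trans (map_smul f x (1 : G))
        refine bij f ⟨fun (x : G) (y : G) h => ?_, fun (y : G) => ?_⟩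
        · have h' : elt (f x) = elt (f y) := h
          exact (mul_left_inj (G := G) _).1 (((hf x).symm.trans h').trans (hf y))
        · exact ⟨y * (elt (f (1 : G)))⁻¹, (hf _).trans (inv_mul_cancel_right _ _)⟩
    | sum h₁ h₂ =>
      intro f
      exact sum f (h₁ _) (h₂ _)
  exact loc f fun f' _ _ h _ => key _ h _ f'

end FinGSet

/-! ### Semi-Mackey functors -/

/-- A product-preserving family of sets indexed by the finite `G`-sets, with restrictions `R` and
one kind of covariant operators `M`, functorial and subject to the Beck–Chevalley condition. The
transfers of a Tambara functor are an example, and so are its norms. -/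
@[ext]
structure SemiMackey {G : Type} [Group G] (E : FinGSet G → Type w) where
  R : ∀ {X Y : FinGSet G}, (X →[G] Y) → E Y → E X
  M : ∀ {X Y : FinGSet G}, (X →[G] Y) → E X → E Y
  R_id : ∀ {X : FinGSet G} (c : E X), R (MulActionHom.id G : X →[G] X) c = c
  R_comp : ∀ {X Y Z : FinGSet G} (f : X →[G] Y) (g : Y →[G] Z) (c : E Z),
    R (g.comp f) c = R f (R g c)
  M_id : ∀ {X : FinGSet G} (c : E X), M (MulActionHom.id G : X →[G] X) c = c
  M_comp : ∀ {X Y Z : FinGSet G} (f : X →[G] Y) (g : Y →[G] Z) (c : E X),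
    M (g.comp f) c = M g (M f c)
  bc : ∀ {X' X Y' Y : FinGSet G} {f' : X' →[G] Y'} {g' : X' →[G] X} {g : Y' →[G] Y}
    {f : X →[G] Y}, FinGSet.IsPull f' g' g f → ∀ c, R g (M f c) = M f' (R g' c)
  nonempty_empty : Nonempty (E (FinGSet.empty G))
  subsingleton_empty : Subsingleton (E (FinGSet.empty G))
  bijective_sum : ∀ X Y : FinGSet G, Function.Bijective fun c : E (FinGSet.sum X Y) =>
    (R (FinGSet.inl X Y) c, R (FinGSet.inr X Y) c)

namespace FinGSet.IsPull

variable {G : Type} [Group G] {X Y Z W : FinGSet G}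

/-- The pullback square of `f` and `g`. -/
theorem pullSet (g : Y →[G] Z) (f : X →[G] Z) :
    IsPull (X' := Bispan.pullSet g f) ⟨fun z => z.1.1, fun _ _ => rfl⟩
      ⟨fun z => z.1.2, fun _ _ => rfl⟩ g f where
  comm z := z.2.symm
  inj _ _ h h' := Subtype.ext (Prod.ext h' h)
  surj x y h := ⟨⟨(y, x), h.symm⟩, rfl, rfl⟩

theorem sum_inl (f : X →[G] Z) (g : Y →[G] W) : IsPull f (inl X Y) (inl Z W) (sumMap f g) where
  comm _ := rfl
  inj _ _ h _ := Sum.inl_injective h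
  surj := by
    rintro (x | x) y h
    · exact ⟨x, rfl, Sum.inl_injective h⟩
    · exact absurd h Sum.inr_ne_inl

theorem sum_inr (f : X →[G] Z) (g : Y →[G] W) : IsPull g (inr X Y) (inr Z W) (sumMap f g) where
  comm _ := rfl
  inj _ _ h _ := Sum.inr_injective h
  surj := by
    rintro (x | x) y h
    · exact absurd h Sum.inl_ne_inr
    · exact ⟨x, rfl, Sum.inr_injective h⟩

theorem fold (f : X →[G] Y) : IsPull (fold X) (sumMap f f) f (fold Y) where
  comm := by rintro (x | x) <;> rfl
  inj := by
    rintro (x | x) (y | y) h (rfl : x = y)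
    · rfl
    · exact absurd h Sum.inl_ne_inr
    · exact absurd h Sum.inr_ne_inl
    · rfl
  surj := by
    rintro (x | x) y h
    · exact ⟨Sum.inl y, congrArg Sum.inl h.symm, rfl⟩
    · exact ⟨Sum.inr y, congrArg Sum.inr h.symm, rfl⟩

theorem fromEmpty (f : X →[G] Y) :
    IsPull (fromEmpty X) (MulActionHom.id G) f (fromEmpty Y) where
  comm x := PEmpty.elim x
  inj x := PEmpty.elim x
  surj x := PEmpty.elim x

theorem of_inverse {f : X →[G] Y} {g : Y →[G] X} (h₁ : f.comp g = MulActionHom.id G)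
    (h₂ : g.comp f = MulActionHom.id G) : IsPull (MulActionHom.id G) g (MulActionHom.id G) f where
  comm y := DFunLike.congr_fun h₁ y
  inj _ _ _ h := h
  surj x y h := ⟨y, (congrArg g h).symm.trans (DFunLike.congr_fun h₂ x), rfl⟩

/-- The double coset formula for the trivial subgroup: `G × G` is the disjoint union of two copies
of `G`. -/
theorem toPoint [Finite G] (χ : G) [hχ : OrderTwo χ] :
    IsPull (FinGSet.fold (regular G)) (elim (MulActionHom.id G) (rightMul χ))
      (toPoint (regular G)) (toPoint (regular G)) where
  comm _ := rfl
  inj := by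
    have ne : ∀ g : G, g * χ ≠ g := fun g h => hχ.ne_one (mul_eq_left.1 h)
    rintro (x | x) (y | y) h (rfl : x = y)
    · rfl
    · exact absurd h.symm (ne x)
    · exact absurd h (ne x)
    · rfl
  surj (x : G) (y : G) _ := by
    rcases hχ.eq_or (y⁻¹ * x) with h | h
    · exact ⟨Sum.inl y, inv_mul_eq_one (G := G).1 h, rfl⟩
    · exact ⟨Sum.inr y, (inv_mul_eq_iff_eq_mul.1 h).symm, rfl⟩

end FinGSet.IsPull

namespace FinGSet

variable {G : Type} [Group G] {X Y Z : FinGSet G}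

theorem elim_comp_inl_inr (f : sum X Y →[G] Z) : elim (f.comp (inl X Y)) (f.comp (inr X Y)) = f :=
  MulActionHom.ext (by rintro (x | x) <;> rfl)

theorem fold_comp_sumMap (f : X →[G] Z) (g : Y →[G] Z) : (fold Z).comp (sumMap f g) = elim f g :=
  MulActionHom.ext (by rintro (x | x) <;> rfl)

theorem rightMul_comp_rightMul [Finite G] (g h : G) :
    (rightMul g).comp (rightMul h) = rightMul (h * g) :=
  MulActionHom.ext fun x => mul_assoc (elt x) h g

theorem rightMul_one [Finite G] : rightMul (1 : G) = MulActionHom.id G :=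
  MulActionHom.ext fun x => mul_one (elt x)

theorem rightMul_comp_self [Finite G] (χ : G) [OrderTwo χ] :
    (rightMul χ).comp (rightMul χ) = MulActionHom.id G := by
  rw [rightMul_comp_rightMul, OrderTwo.mul_self, rightMul_one]

end FinGSet

namespace SemiMackey

open FinGSet

variable {G : Type} [Group G] {E : FinGSet G → Type w} (s : SemiMackey E) {X Y Z : FinGSet G}

theorem ext_sum {c c' : E (sum X Y)} (h₁ : s.R (inl X Y) c = s.R (inl X Y) c')
    (h₂ : s.R (inr X Y) c = s.R (inr X Y) c') : c = c' :=
  (s.bijective_sum X Y).1 (Prod.ext h₁ h₂)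

/-- The element of `E(X ⊔ Y)` with given restrictions to `X` and `Y`. -/
noncomputable def pair (a : E X) (b : E Y) : E (sum X Y) :=
  (Equiv.ofBijective _ (s.bijective_sum X Y)).symm (a, b)

theorem R_inl_pair (a : E X) (b : E Y) : s.R (inl X Y) (s.pair a b) = a :=
  congrArg Prod.fst ((Equiv.ofBijective _ (s.bijective_sum X Y)).apply_symm_apply (a, b))

theorem R_inr_pair (a : E X) (b : E Y) : s.R (inr X Y) (s.pair a b) = b :=
  congrArg Prod.snd ((Equiv.ofBijective _ (s.bijective_sum X Y)).apply_symm_apply (a, b))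

theorem eq_pair {c : E (sum X Y)} {a : E X} {b : E Y} (h₁ : s.R (inl X Y) c = a)
    (h₂ : s.R (inr X Y) c = b) : c = s.pair a b :=
  s.ext_sum (h₁.trans (s.R_inl_pair a b).symm) (h₂.trans (s.R_inr_pair a b).symm)

/-- The binary operation on `E(X)` given by the fold map. -/
noncomputable def op (a b : E X) : E X := s.M (fold X) (s.pair a b)

/-- The element of `E(X)` given by the map `∅ → X`. -/
noncomputable def unit (X : FinGSet G) : E X :=
  s.M (fromEmpty X) (Classical.choice s.nonempty_empty)

theorem M_fromEmpty (e : E (empty G)) : s.M (fromEmpty X) e = s.unit X := by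
  have := s.subsingleton_empty
  exact congrArg _ (Subsingleton.elim _ _)

/-- The covariant operator of an isomorphism is the restriction along its inverse. -/
theorem M_eq_R {f : X →[G] Y} {g : Y →[G] X} (h₁ : f.comp g = MulActionHom.id G)
    (h₂ : g.comp f = MulActionHom.id G) (c : E X) : s.M f c = s.R g c := by
  have := s.bc (IsPull.of_inverse h₁ h₂) c
  rwa [s.R_id, s.M_id] at this

theorem M_sumMap_pair {X' Y' : FinGSet G} (f : X →[G] X') (g : Y →[G] Y') (a : E X)
    (b : E Y) : s.M (sumMap f g) (s.pair a b) = s.pair (s.M f a) (s.M g b) := by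
  apply s.eq_pair
  · rw [s.bc (IsPull.sum_inl f g), R_inl_pair]
  · rw [s.bc (IsPull.sum_inr f g), R_inr_pair]

theorem M_elim_pair (f : X →[G] Z) (g : Y →[G] Z) (a : E X) (b : E Y) :
    s.M (elim f g) (s.pair a b) = s.op (s.M f a) (s.M g b) := by
  rw [← fold_comp_sumMap, s.M_comp, M_sumMap_pair]
  rfl

/-- The value of a covariant operator on a disjoint union is the sum of the values on the parts. -/
theorem M_eq_op (f : sum X Y →[G] Z) (c : E (sum X Y)) :
    s.M f c = s.op (s.M (f.comp (inl X Y)) (s.R (inl X Y) c))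
      (s.M (f.comp (inr X Y)) (s.R (inr X Y) c)) := by
  rw [← M_elim_pair, elim_comp_inl_inr]
  exact congrArg _ (s.eq_pair rfl rfl)

theorem M_fold (c : E (sum X X)) :
    s.M (fold X) c = s.op (s.R (inl X X) c) (s.R (inr X X) c) :=
  congrArg _ (s.eq_pair rfl rfl)

theorem R_sumMap_pair {X' Y' : FinGSet G} (f : X' →[G] X) (g : Y' →[G] Y) (a : E X)
    (b : E Y) : s.R (sumMap f g) (s.pair a b) = s.pair (s.R f a) (s.R g b) := by
  apply s.eq_pair
  · rw [← s.R_comp]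
    change s.R ((inl X Y).comp f) _ = _
    rw [s.R_comp, R_inl_pair]
  · rw [← s.R_comp]
    change s.R ((inr X Y).comp g) _ = _
    rw [s.R_comp, R_inr_pair]

theorem R_elim (f : X →[G] Z) (g : Y →[G] Z) (a : E Z) :
    s.R (elim f g) a = s.pair (s.R f a) (s.R g a) :=
  s.eq_pair (s.R_comp _ _ _).symm (s.R_comp _ _ _).symm

theorem R_op (f : X →[G] Y) (a b : E Y) : s.R f (s.op a b) = s.op (s.R f a) (s.R f b) := by
  unfold op
  rw [s.bc (IsPull.fold f), R_sumMap_pair]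

theorem R_unit (f : X →[G] Y) : s.R f (s.unit Y) = s.unit X := by
  unfold unit
  rw [s.bc (IsPull.fromEmpty f), s.R_id]

theorem M_op (f : X →[G] Y) (a b : E X) : s.M f (s.op a b) = s.op (s.M f a) (s.M f b) := by
  rw [← M_elim_pair]
  unfold op
  rw [← s.M_comp]
  congr 1
  exact MulActionHom.ext (by rintro (x | x) <;> rfl)

theorem M_unit (f : X →[G] Y) : s.M f (s.unit X) = s.unit Y := by
  unfold unit
  rw [← s.M_comp]
  congr 1
  exact MulActionHom.ext fun x => PEmpty.elim x

theorem op_comm (a b : E X) : s.op a b = s.op b a := by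
  let σ : sum X X →[G] sum X X := elim (inr X X) (inl X X)
  have hσ : σ.comp σ = MulActionHom.id G := MulActionHom.ext (by rintro (x | x) <;> rfl)
  have h : s.M σ (s.pair a b) = s.pair b a := by
    rw [s.M_eq_R hσ hσ, s.R_elim, R_inl_pair, R_inr_pair]
  have h' : (fold X).comp σ = fold X := MulActionHom.ext (by rintro (x | x) <;> rfl)
  unfold op
  rw [← h, ← s.M_comp, h']

theorem op_unit (a : E X) : s.op a (s.unit X) = a := by
  obtain ⟨e⟩ := s.nonempty_empty
  let f : sum X (empty G) →[G] X := elim (MulActionHom.id G) (fromEmpty X)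
  have h₁ : f.comp (inl X (empty G)) = MulActionHom.id G := rfl
  have h₂ : (inl X (empty G)).comp f = MulActionHom.id G :=
    MulActionHom.ext (by rintro (x | x); exacts [rfl, PEmpty.elim x])
  have := s.M_eq_R h₁ h₂ (s.pair a e)
  rwa [R_inl_pair, M_elim_pair, s.M_id, M_fromEmpty] at this

theorem op_assoc (a b c : E X) : s.op (s.op a b) c = s.op a (s.op b c) := by
  let σ : sum (sum X X) X →[G] sum X (sum X X) :=
    elim (sumMap (MulActionHom.id G) (inl X X)) ((inr X (sum X X)).comp (inr X X))
  let τ : sum X (sum X X) →[G] sum (sum X X) X :=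
    elim ((inl (sum X X) X).comp (inl X X)) (sumMap (inr X X) (MulActionHom.id G))
  have h₁ : σ.comp τ = MulActionHom.id G :=
    MulActionHom.ext (by rintro (x | (x | x)) <;> rfl)
  have h₂ : τ.comp σ = MulActionHom.id G :=
    MulActionHom.ext (by rintro ((x | x) | x) <;> rfl)
  have h : s.M τ (s.pair a (s.pair b c)) = s.pair (s.pair a b) c := by
    rw [s.M_eq_R h₂ h₁]
    refine s.eq_pair (s.eq_pair ?_ ?_) ?_
    · rw [← s.R_comp, ← s.R_comp]
      exact s.R_inl_pair _ _
    · rw [← s.R_comp, ← s.R_comp]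
      change s.R ((inr X (sum X X)).comp (inl X X)) _ = _
      rw [s.R_comp, R_inr_pair, R_inl_pair]
    · rw [← s.R_comp]
      change s.R ((inr X (sum X X)).comp (inr X X)) _ = _
      rw [s.R_comp, R_inr_pair, R_inr_pair]
  have h' : (elim (fold X) (MulActionHom.id G)).comp τ = elim (MulActionHom.id G) (fold X) :=
    MulActionHom.ext (by rintro (x | (x | x)) <;> rfl)
  have h₃ := s.M_elim_pair (fold X) (MulActionHom.id G) (s.pair a b) c
  rw [← h, ← s.M_comp, h', M_elim_pair, s.M_id, s.M_id] at h₃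
  exact h₃.symm

section regular

variable [Finite G]

/-- The double coset formula: it specializes to `res(trc(a)) = a + χa` and to
`res(nrm(a)) = a · χa`. -/
theorem R_M_toPoint (χ : G) [OrderTwo χ] (a : E (regular G)) :
    s.R (toPoint (regular G)) (s.M (toPoint (regular G)) a) = s.op a (s.R (rightMul χ) a) := by
  rw [s.bc (IsPull.toPoint χ), s.R_elim, s.R_id]
  rfl

theorem M_toPoint_R (χ : G) [OrderTwo χ] (a : E (regular G)) :
    s.M (toPoint (regular G)) (s.R (rightMul χ) a) = s.M (toPoint (regular G)) a := by
  rw [← s.M_eq_R (rightMul_comp_self χ) (rightMul_comp_self χ), ← s.M_comp]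
  rfl

/-- Elements are determined by their restrictions to orbits. -/
theorem ext_orbits (χ : G) [OrderTwo χ]
    {c c' : E X} (h : ∀ (Y : FinGSet G) (f : Y →[G] X),
    Y = point G ∨ Y = regular G → s.R f c = s.R f c') : c = c' := by
  induction X using induction_on χ with
  | iso f hf ih =>
    obtain ⟨g, h₁, h₂⟩ := exists_inverse f hf
    have : s.R f c = s.R f c' := ih fun Y k hY => by
      rw [← s.R_comp, ← s.R_comp]
      exact h Y _ hY
    have := congrArg (s.R g) this
    rwa [← s.R_comp, ← s.R_comp, h₁, s.R_id, s.R_id] at this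
  | empty =>
    have := s.subsingleton_empty
    exact Subsingleton.elim _ _
  | point =>
    have := h _ (MulActionHom.id G) (Or.inl rfl)
    rwa [s.R_id, s.R_id] at this
  | regular =>
    have := h _ (MulActionHom.id G) (Or.inr rfl)
    rwa [s.R_id, s.R_id] at this
  | sum ih₁ ih₂ =>
    refine s.ext_sum (ih₁ fun Y k hY => ?_) (ih₂ fun Y k hY => ?_) <;>
    · rw [← s.R_comp, ← s.R_comp]
      exact h Y _ hY

variable {s}

/-- A family of maps that is compatible with restrictions and with the covariant operators of
`∅ → X`, `X ⊔ X → X` and `G → 1` is compatible with all covariant operators. -/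
theorem map_M (χ : G) [OrderTwo χ]
    {E' : FinGSet G → Type w'} {s' : SemiMackey E'} (φ : ∀ X, E X → E' X)
    (hR : ∀ {X Y : FinGSet G} (f : X →[G] Y) c, φ X (s.R f c) = s'.R f (φ Y c))
    (hop : ∀ (X : FinGSet G) a b, φ X (s.op a b) = s'.op (φ X a) (φ X b))
    (hunit : ∀ X, φ X (s.unit X) = s'.unit X)
    (hM : ∀ a, φ _ (s.M (toPoint (regular G)) a) = s'.M (toPoint (regular G)) (φ _ a))
    (f : X →[G] Y) (c : E X) : φ Y (s.M f c) = s'.M f (φ X c) := by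
  induction f using map_induction_on χ with
  | loc f ih =>
    refine s'.ext_orbits χ fun Y' g hY => ?_
    have h := IsPull.pullSet g f
    rw [← hR, s.bc h, s'.bc h, ih _ _ g hY h, hR]
  | comp f g hf hg => rw [s.M_comp, s'.M_comp, hg, hf]
  | bij f hf =>
    obtain ⟨g, h₁, h₂⟩ := exists_inverse f hf
    rw [s.M_eq_R h₁ h₂, s'.M_eq_R h₁ h₂, hR]
  | empty Y => rw [s.M_fromEmpty, s'.M_fromEmpty, hunit]
  | sum f h₁ h₂ => rw [s.M_eq_op, s'.M_eq_op, hop, h₁, h₂, hR, hR]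
  | toPoint => exact hM c

end regular

end SemiMackey

/-! ### The pair of a Tambara functor -/

namespace TambaraFunctor

open FinGSet

variable {G : Type} [Group G] (S : TambaraFunctor.{w} G) {X Y Z : FinGSet G}

theorem map_comp_apply (f : X ⟶ Y) (g : Y ⟶ Z) (c : S.obj.obj X) :
    S.obj.map (f ≫ g) c = S.obj.map g (S.obj.map f c) := by
  simp

theorem map_id_apply (c : S.obj.obj X) : S.obj.map (𝟙 X) c = c := by
  simp

/-- The restrictions and transfers of a Tambara functor. -/
def transfers : SemiMackey S.obj.obj where
  R f c := S.obj.map (R f) c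
  M f c := S.obj.map (T f) c
  R_id c := S.map_id_apply c
  R_comp f g c := by rw [← S.map_comp_apply, FinGSet.R_comp]
  M_id c := S.map_id_apply c
  M_comp f g c := by rw [← S.map_comp_apply, FinGSet.T_comp]
  bc h c := by rw [← S.map_comp_apply, ← S.map_comp_apply, FinGSet.T_comp_R h]
  nonempty_empty := ⟨S.emptyElt⟩
  subsingleton_empty := ⟨fun a b => (S.eq_emptyElt a).trans (S.eq_emptyElt b).symm⟩
  bijective_sum := S.bijective_restrict

/-- The restrictions and norms of a Tambara functor. -/
def norms : SemiMackey S.obj.obj where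
  R f c := S.obj.map (R f) c
  M f c := S.obj.map (N f) c
  R_id c := S.map_id_apply c
  R_comp f g c := by rw [← S.map_comp_apply, FinGSet.R_comp]
  M_id c := S.map_id_apply c
  M_comp f g c := by rw [← S.map_comp_apply, FinGSet.N_comp]
  bc h c := by rw [← S.map_comp_apply, ← S.map_comp_apply, FinGSet.N_comp_R h]
  nonempty_empty := ⟨S.emptyElt⟩
  subsingleton_empty := ⟨fun a b => (S.eq_emptyElt a).trans (S.eq_emptyElt b).symm⟩
  bijective_sum := S.bijective_restrict

theorem transfers_op (a b : S.obj.obj X) : S.transfers.op a b = S.add X a b := rfl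

theorem norms_op (a b : S.obj.obj X) : S.norms.op a b = S.mul X a b := rfl

theorem transfers_unit (X : FinGSet G) : S.transfers.unit X = S.zero X :=
  (S.transfers.M_fromEmpty S.emptyElt).symm

theorem norms_unit (X : FinGSet G) : S.norms.unit X = S.one X :=
  (S.norms.M_fromEmpty S.emptyElt).symm

theorem map_eq (ω : Bispan X Y) (c : S.obj.obj X) :
    S.obj.map (Quotient.mk _ ω : X ⟶ Y) c =
      S.transfers.M ω.r (S.norms.M ω.q (S.norms.R ω.p c)) := by
  rw [mk_eq, map_comp_apply, map_comp_apply]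
  rfl

/-- The projection formula. -/
theorem mul_transfer (f : X →[G] Y) (a : S.obj.obj Y) (b : S.obj.obj X) :
    S.mul Y a (S.transfers.M f b) = S.transfers.M f (S.mul X (S.norms.R f a) b) := by
  have h := congrArg (fun φ => S.obj.map φ (S.transfers.pair a b)) (T_comp_N_fold f)
  rw [map_comp_apply, map_comp_apply, map_comp_apply] at h
  have h₁ := S.transfers.M_sumMap_pair (MulActionHom.id G) f a b
  have h₂ := S.norms.R_sumMap_pair f (MulActionHom.id G) a b
  rw [S.transfers.M_id] at h₁
  rw [S.norms.R_id] at h₂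
  exact ((congrArg (S.norms.M (fold Y)) h₁).symm.trans h).trans
    (congrArg (fun c => S.transfers.M f (S.norms.M (fold X) c)) h₂)

/-- Distributivity is the projection formula for the fold map. -/
theorem mul_add' (a b c : S.obj.obj X) :
    S.mul X a (S.add X b c) = S.add X (S.mul X a b) (S.mul X a c) := by
  have h := S.mul_transfer (fold X) a (S.transfers.pair b c)
  rw [S.transfers.M_fold, S.transfers.M_fold, S.transfers.R_inl_pair, S.transfers.R_inr_pair] at h
  have e₁ : S.norms.R (inl X X) (S.norms.R (fold X) a) = a := by
    rw [← S.norms.R_comp]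
    exact S.norms.R_id a
  have e₂ : S.norms.R (inr X X) (S.norms.R (fold X) a) = a := by
    rw [← S.norms.R_comp]
    exact S.norms.R_id a
  have h₁ := S.norms.R_op (inl X X) (S.norms.R (fold X) a) (S.norms.pair b c)
  have h₂ := S.norms.R_op (inr X X) (S.norms.R (fold X) a) (S.norms.pair b c)
  rw [e₁, S.norms.R_inl_pair] at h₁
  rw [e₂, S.norms.R_inr_pair] at h₂
  exact h.trans (congrArg₂ (S.add X) h₁ h₂)

/-- Absorption is the projection formula for `∅ → X`. -/
theorem mul_zero' (a : S.obj.obj X) : S.mul X a (S.zero X) = S.zero X := by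
  have h := S.mul_transfer (fromEmpty X) a S.emptyElt
  rwa [S.transfers.M_fromEmpty, S.transfers.M_fromEmpty, transfers_unit] at h

/-- The values of a Tambara functor are commutative semirings. -/
noncomputable abbrev commSemiring (X : FinGSet G) : CommSemiring (S.obj.obj X) where
  zero := S.zero X
  one := S.one X
  add := S.add X
  mul := S.mul X
  add_assoc := S.transfers.op_assoc
  zero_add a := by
    change S.add X (S.zero X) a = a
    rw [← transfers_unit, ← transfers_op, S.transfers.op_comm, S.transfers.op_unit]
  add_zero a := by
    change S.add X a (S.zero X) = a
    rw [← transfers_unit, ← transfers_op, S.transfers.op_unit]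
  add_comm := S.transfers.op_comm
  mul_assoc := S.norms.op_assoc
  one_mul a := by
    change S.mul X (S.one X) a = a
    rw [← norms_unit, ← norms_op, S.norms.op_comm, S.norms.op_unit]
  mul_one a := by
    change S.mul X a (S.one X) = a
    rw [← norms_unit, ← norms_op, S.norms.op_unit]
  mul_comm := S.norms.op_comm
  left_distrib := S.mul_add'
  right_distrib a b c :=
    (S.norms.op_comm _ _).trans ((S.mul_add' c a b).trans
      (congrArg₂ (S.add X) (S.norms.op_comm _ _) (S.norms.op_comm _ _)))
  zero_mul a := (S.norms.op_comm _ _).trans (S.mul_zero' a)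
  mul_zero := S.mul_zero'
  nsmul := @nsmulRec _ ⟨S.zero X⟩ ⟨S.add X⟩
  npow := @npowRec _ ⟨S.one X⟩ ⟨S.mul X⟩

theorem R_add (f : X →[G] Y) (a b : S.obj.obj Y) :
    S.obj.map (R f) (S.add Y a b) = S.add X (S.obj.map (R f) a) (S.obj.map (R f) b) :=
  S.transfers.R_op f a b

theorem R_mul (f : X →[G] Y) (a b : S.obj.obj Y) :
    S.obj.map (R f) (S.mul Y a b) = S.mul X (S.obj.map (R f) a) (S.obj.map (R f) b) :=
  S.norms.R_op f a b

theorem R_zero (f : X →[G] Y) : S.obj.map (R f) (S.zero Y) = S.zero X := by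
  rw [← transfers_unit, ← transfers_unit]
  exact S.transfers.R_unit f

theorem R_one (f : X →[G] Y) : S.obj.map (R f) (S.one Y) = S.one X := by
  rw [← norms_unit, ← norms_unit]
  exact S.norms.R_unit f

theorem toPoint_sum (X Y : FinGSet G) : toPoint (sum X Y) = elim (toPoint X) (toPoint Y) := rfl

variable [Finite G]

/-- The axiom `nrm(0) = 0`; it holds because `G → 1` is surjective. -/
theorem norm_zero : S.norms.M (toPoint (regular G)) (S.zero _) = S.zero _ := by
  have h := congrArg (fun φ => S.obj.map φ S.emptyElt)
    (T_fromEmpty_comp_N (toPoint (regular G)) fun y => ⟨(1 : G), rfl⟩)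
  rw [map_comp_apply] at h
  exact h

/-- The axiom `nrm(a + b) = nrm(a) + nrm(b) + trc(a · χb)`, which is `T_fold_comp_N` applied to
the pair `(a, b)`. -/
theorem norm_add (χ : G) [OrderTwo χ] (a b : S.obj.obj (regular G)) :
    S.norms.M (toPoint (regular G)) (S.add _ a b) =
      S.add _ (S.add _ (S.norms.M (toPoint (regular G)) a) (S.norms.M (toPoint (regular G)) b))
        (S.transfers.M (toPoint (regular G)) (S.mul _ a (S.norms.R (rightMul χ) b))) := by
  have h := congrArg (fun φ => S.obj.map φ (S.transfers.pair a b)) (T_fold_comp_N (χ := χ))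
  rw [map_comp_apply, map_comp_apply, map_comp_apply] at h
  have e₁ : S.norms.R (elim (MulActionHom.id G) (elim (inl _ _)
      ((inr (regular G) (regular G)).comp (rightMul χ)))) (S.norms.pair a b) =
      S.norms.pair (S.norms.pair a b) (S.norms.pair a (S.norms.R (rightMul χ) b)) := by
    rw [S.norms.R_elim, S.norms.R_elim, S.norms.R_id, S.norms.R_comp, S.norms.R_inl_pair,
      S.norms.R_inr_pair]
  have e₂ := S.norms.M_sumMap_pair (sumMap (toPoint (regular G)) (toPoint (regular G)))
    (fold (regular G)) (S.norms.pair a b) (S.norms.pair a (S.norms.R (rightMul χ) b))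
  rw [← e₁, S.norms.M_sumMap_pair] at e₂
  refine h.trans ((congrArg (S.transfers.M (toPoint (sum (sum (point G) (point G)) (regular G))))
    e₂).trans ?_)
  rw [toPoint_sum, toPoint_sum]
  have e₃ := S.transfers.M_elim_pair (elim (toPoint (point G)) (toPoint (point G)))
    (toPoint (regular G)) (S.transfers.pair (S.norms.M (toPoint (regular G)) a)
      (S.norms.M (toPoint (regular G)) b)) (S.norms.op a (S.norms.R (rightMul χ) b))
  rw [S.transfers.M_elim_pair (toPoint (point G)) (toPoint (point G))] at e₃
  refine e₃.trans ?_
  have e₄ : toPoint (point G) = MulActionHom.id G := rfl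
  rw [e₄, S.transfers.M_id, S.transfers.M_id]
  rfl

/-- The Tambara pair `(S(G), S(1))`. -/
noncomputable def toPair (χ : G) [OrderTwo χ] : TambaraPair.{w} χ where
  A := S.obj.obj (regular G)
  B := S.obj.obj (point G)
  semiringA := S.commSemiring _
  semiringB := S.commSemiring _
  action := letI := S.commSemiring (regular G)
    { smul := fun g a => S.obj.map (R (rightMul g)) a
      one_smul := fun a => by
        change S.obj.map (R (rightMul 1)) a = a
        rw [rightMul_one]
        exact S.map_id_apply a
      mul_smul := fun g h a => by
        change S.obj.map (R (rightMul (g * h))) a =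
          S.obj.map (R (rightMul g)) (S.obj.map (R (rightMul h)) a)
        rw [← rightMul_comp_rightMul]
        exact S.norms.R_comp _ _ a
      smul_zero := fun g => S.R_zero _
      smul_add := fun g => S.R_add _
      smul_one := fun g => S.R_one _
      smul_mul := fun g => S.R_mul _ }
  res := letI := S.commSemiring (regular G); letI := S.commSemiring (point G)
    { toFun := fun b => S.obj.map (R (toPoint (regular G))) b
      map_zero' := S.R_zero _
      map_one' := S.R_one _
      map_add' := S.R_add _
      map_mul' := S.R_mul _ }
  trc a := S.obj.map (T (toPoint (regular G))) a
  nrm a := S.obj.map (N (toPoint (regular G))) a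
  smul_res g b := (S.norms.R_comp (rightMul g) (toPoint (regular G)) b).symm
  trc_zero := by
    have h := S.transfers.M_unit (toPoint (regular G))
    rwa [transfers_unit, transfers_unit] at h
  trc_add := S.transfers.M_op _
  trc_conj := S.transfers.M_toPoint_R χ
  res_trc := S.transfers.R_M_toPoint χ
  nrm_one := by
    have h := S.norms.M_unit (toPoint (regular G))
    rwa [norms_unit, norms_unit] at h
  nrm_mul := S.norms.M_op _
  nrm_conj := S.norms.M_toPoint_R χ
  res_nrm := S.norms.R_M_toPoint χ
  nrm_zero := S.norm_zero
  nrm_add := S.norm_add χ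
  trc_mul_res a b := by
    have h := S.mul_transfer (toPoint (regular G)) b a
    exact ((congrArg _ (S.norms.op_comm _ _)).trans h.symm).trans (S.norms.op_comm _ _)

/-- The functor `S ↦ (S(G), S(1))` from Tambara functors to Tambara pairs. -/
noncomputable def toPairFunctor (χ : G) [OrderTwo χ] :
    TambaraFunctor.{w} G ⥤ TambaraPair.{w} χ where
  obj S := S.toPair χ
  map {S S'} φ :=
    { onA := letI := S.commSemiring (regular G); letI := S'.commSemiring (regular G)
        { toFun := fun a => φ.hom.app (regular G) a
          map_zero' := app_zero φ _
          map_one' := app_one φ _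
          map_add' := app_add φ _
          map_mul' := app_mul φ _ }
      onB := letI := S.commSemiring (point G); letI := S'.commSemiring (point G)
        { toFun := fun b => φ.hom.app (point G) b
          map_zero' := app_zero φ _
          map_one' := app_one φ _
          map_add' := app_add φ _
          map_mul' := app_mul φ _ }
      smul := fun _ _ => app_map φ _ _
      res := app_map φ _
      trc := app_map φ _
      nrm := app_map φ _ }

theorem toPairFunctor_comp_forget (χ : G) [OrderTwo χ] :
    toPairFunctor.{w} χ ⋙ TambaraPair.forget χ = pairFunctor G := rfl

end TambaraFunctor

/-! ### Products over orbits -/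

section finprod

variable {I J M : Type*} [CommMonoid M]

theorem finprod_fiberwise [Finite I] [Finite J] (π : I → J) (F : I → M) :
    ∏ᶠ i, F i = ∏ᶠ j, ∏ᶠ i : {i // π i = j}, F i := by
  classical
  have := Fintype.ofFinite I
  have := Fintype.ofFinite J
  simp_rw [finprod_eq_prod_of_fintype]
  exact (Fintype.prod_fiberwise π F).symm

theorem finprod_sumType [Finite I] [Finite J] (F : I ⊕ J → M) :
    ∏ᶠ i, F i = (∏ᶠ i, F (Sum.inl i)) * ∏ᶠ j, F (Sum.inr j) := by
  have := Fintype.ofFinite I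
  have := Fintype.ofFinite J
  simp_rw [finprod_eq_prod_of_fintype]
  exact Fintype.prod_sum_type F

end finprod

/-- An additive commutative monoid, written multiplicatively. It makes the results on products
below, which concern norms, available for transfers. -/
abbrev addAsMul (A : Type*) [AddCommMonoid A] : CommMonoid A where
  mul := (· + ·)
  one := 0
  mul_assoc := add_assoc
  one_mul := zero_add
  mul_one := add_zero
  mul_comm := add_comm
  npow n a := n • a
  npow_zero := zero_nsmul
  npow_succ n a := succ_nsmul a n

theorem finprod_addAsMul {I A : Type*} [Finite I] [AddCommMonoid A] (F : I → A) :
    @finprod A I (addAsMul A) F = ∑ᶠ i, F i := by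
  have := Fintype.ofFinite I
  rw [finsum_eq_sum_of_fintype, @finprod_eq_prod_of_fintype I A (addAsMul A) _ F]
  rfl

section orbitProd

open MulAction

variable {G : Type} [Group G] {X Y : Type} [MulAction G X] [MulAction G Y] {M : Type*}
  [CommMonoid M]

/-- The product of `w` over the orbits that are contained in the invariant set `s`. Orbits are
represented by `Quotient.out`; for invariant `w` the choice is irrelevant, by `orbitProd_eq`. -/
noncomputable def orbitProd (G : Type) [Group G] {X : Type} [MulAction G X] (s : Set X)
    (w : X → M) : M :=
  ∏ᶠ o : {o : orbitRel.Quotient G X // o.out ∈ s}, w o.1.out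

theorem exists_smul_out (x : X) : ∃ g : G, g • (Quotient.mk (orbitRel G X) x).out = x :=
  orbitRel_apply.1 (Quotient.exact (Quotient.out_eq (Quotient.mk (orbitRel G X) x)).symm)

/-- A product over orbits can be computed with any family of representatives. -/
theorem orbitProd_eq {I : Type*} {s : Set X} {w : X → M} (f : I → X)
    (hs : ∀ (g : G) x, x ∈ s → g • x ∈ s) (hw : ∀ (g : G) x, w (g • x) = w x)
    (mem : ∀ i, f i ∈ s) (hit : ∀ x ∈ s, ∃ i, ∃ g : G, g • f i = x)
    (inj : ∀ i j, ∀ g : G, g • f i = f j → i = j) :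
    orbitProd G s w = ∏ᶠ i, w (f i) := by
  have out' : ∀ x : X, ∃ g : G, g • x = (Quotient.mk (orbitRel G X) x).out := fun x => by
    obtain ⟨g, hg⟩ := exists_smul_out (G := G) x
    exact ⟨g⁻¹, inv_smul_eq_iff.2 hg.symm⟩
  symm
  refine finprod_eq_of_bijective (fun i => ⟨Quotient.mk (orbitRel G X) (f i), ?_⟩) ⟨?_, ?_⟩ ?_
  · obtain ⟨g, hg⟩ := out' (f i)
    rw [← hg]
    exact hs g _ (mem i)
  · intro i j h
    have h : (orbitRel G X) (f j) (f i) := (Quotient.exact (congrArg Subtype.val h).symm)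
    obtain ⟨g, hg⟩ := orbitRel_apply.1 h
    exact inj i j g hg
  · rintro ⟨o, ho⟩
    obtain ⟨i, g, hg⟩ := hit _ ho
    refine ⟨i, Subtype.ext ?_⟩
    refine Eq.trans (Quotient.sound ?_) o.out_eq
    exact orbitRel_apply.2 ⟨g⁻¹, inv_smul_eq_iff.2 hg.symm⟩
  · intro i
    obtain ⟨g, hg⟩ := out' (f i)
    exact (hw g (f i)).symm.trans (congrArg w hg)

theorem orbitRel_out_injective {o o' : orbitRel.Quotient G X} (g : G) (h : g • o.out = o'.out) :
    o = o' := by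
  rw [← o.out_eq, ← o'.out_eq]
  exact (Quotient.sound (orbitRel_apply.2 ⟨g, h⟩)).symm

/-- A product over orbits can be transported along an equivariant bijection. -/
theorem orbitProd_congr {s : Set X} {t : Set Y} {w : X → M} {w' : Y → M} (φ : X →[G] Y)
    (hs : ∀ (g : G) x, x ∈ s → g • x ∈ s) (ht : ∀ (g : G) x, x ∈ t → g • x ∈ t)
    (hw' : ∀ (g : G) x, w' (g • x) = w' x)
    (hφ : Set.BijOn φ s t) (h : ∀ x ∈ s, w' (φ x) = w x) :
    orbitProd G s w = orbitProd G t w' := by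
  rw [orbitProd_eq (fun o : {o : orbitRel.Quotient G X // o.out ∈ s} => φ o.1.out) ht hw'
    (fun o => hφ.mapsTo o.2) ?_ ?_]
  · exact finprod_congr fun o => (h _ o.2).symm
  · intro y hy
    obtain ⟨x, hx, rfl⟩ := hφ.surjOn hy
    obtain ⟨g, hg⟩ := exists_smul_out (G := G) x
    refine ⟨⟨Quotient.mk _ x, ?_⟩, g, ?_⟩
    · rw [← inv_smul_eq_iff.2 hg.symm]
      exact hs _ _ hx
    · rw [← map_smul, hg]
  · intro o o' g hg
    rw [← map_smul] at hg
    exact Subtype.ext (orbitRel_out_injective g (hφ.injOn (hs g _ o.2) o'.2 hg))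

end orbitProd

/-- The axioms that `(+, trc)` and `(·, nrm)` have in common in a Tambara pair. -/
structure IsTransfer {G : Type} [Group G] (χ : G) {A B : Type*} [CommMonoid A] [CommMonoid B]
    [MulAction G A] (res : B → A) (tr : A → B) : Prop where
  smul_one : ∀ g : G, g • (1 : A) = 1
  smul_mul : ∀ (g : G) (a a' : A), g • (a * a') = g • a * g • a'
  res_one : res 1 = 1
  res_mul : ∀ b b', res (b * b') = res b * res b'
  tr_one : tr 1 = 1
  tr_mul : ∀ a a', tr (a * a') = tr a * tr a'
  tr_conj : ∀ a, tr (χ • a) = tr a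
  res_tr : ∀ a, res (tr a) = a * χ • a

section weight

open MulAction

variable {G : Type} [Group G] {χ : G} {A B : Type*}

open Classical in
/-- The contribution of the orbit of `x`: the value of `v` at a fixed point, and the transfer of
the value of `u` on a free orbit. -/
noncomputable def weight {X : Type} [MulAction G X] (tr : A → B) (u : X → A)
    (v : fixedPoints G X → B) (x : X) : B :=
  if h : x ∈ fixedPoints G X then v ⟨x, h⟩ else tr (u x)

section basic

variable {X Y : Type} [MulAction G X] [MulAction G Y] {tr : A → B} {u : X → A}
  {v : fixedPoints G X → B}

theorem weight_fixed {x : X} (h : x ∈ fixedPoints G X) : weight tr u v x = v ⟨x, h⟩ :=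
  dif_pos h

theorem weight_free {x : X} (h : x ∉ fixedPoints G X) : weight tr u v x = tr (u x) :=
  dif_neg h

theorem smul_mem_fixedPoints_iff {g : G} {x : X} :
    g • x ∈ fixedPoints G X ↔ x ∈ fixedPoints G X := by
  constructor
  · intro h
    have e : g • x = x := smul_left_cancel g (h g)
    rwa [e] at h
  · intro h
    rwa [h g]

theorem weight_smul [MulAction G A] (χ : G) [hχ : OrderTwo χ] (htr : ∀ a, tr (χ • a) = tr a)
    (hu : ∀ (g : G) x, u (g • x) = g • u x) (g : G) (x : X) :
    weight tr u v (g • x) = weight tr u v x := by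
  by_cases hx : x ∈ fixedPoints G X
  · rw [hx g]
  · rw [weight_free hx, weight_free (mt smul_mem_fixedPoints_iff.1 hx), hu]
    rcases hχ.eq_or g with rfl | rfl
    · rw [one_smul]
    · exact htr _

theorem smul_mem_fiber (f : X →[G] Y) {y : Y} (hy : y ∈ fixedPoints G Y) (g : G) (x : X)
    (hx : x ∈ f ⁻¹' {y}) : g • x ∈ f ⁻¹' {y} := by
  have hx : f x = y := hx
  change f (g • x) = y
  rw [map_smul, hx, hy g]

end basic

theorem map_finprod_of_mul {I A B : Type*} [Finite I] [CommMonoid A] [CommMonoid B] {φ : A → B}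
    (h₁ : φ 1 = 1) (h₂ : ∀ a b, φ (a * b) = φ a * φ b) (F : I → A) :
    φ (∏ᶠ i, F i) = ∏ᶠ i, φ (F i) :=
  MonoidHom.map_finprod ⟨⟨φ, h₁⟩, h₂⟩ (Set.toFinite _)

/-- The product of `u` over the fibre of `f` at `y`. -/
noncomputable def fiberProd {X Y A : Type*} [CommMonoid A] (f : X → Y) (u : X → A) (y : Y) : A :=
  ∏ᶠ x : {x : X // f x = y}, u x

theorem fiberProd_comp {X Y Z A : Type*} [Finite X] [Finite Y] [CommMonoid A] {u : X → A}
    (f : X → Y) (g : Y → Z) (z : Z) :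
    fiberProd (g ∘ f) u z = fiberProd g (fiberProd f u) z := by
  unfold fiberProd
  rw [finprod_fiberwise (fun x : {x // (g ∘ f) x = z} => (⟨f x.1, x.2⟩ : {y // g y = z}))]
  refine finprod_congr fun y => ?_
  refine finprod_eq_of_bijective (fun x => ⟨x.1.1, congrArg Subtype.val x.2⟩) ⟨?_, ?_⟩
    fun _ => rfl
  · intro x x' h
    exact Subtype.ext (Subtype.ext (congrArg (fun t => t.1) h))
  · rintro ⟨x, hx⟩
    exact ⟨⟨⟨x, (congrArg g hx).trans y.2⟩, Subtype.ext hx⟩, rfl⟩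

variable {X Y Z : Type} [Finite X] [MulAction G X] [MulAction G Y] [MulAction G Z]
  [CommMonoid A] [CommMonoid B] [MulAction G A] {res : B → A} {tr : A → B}
  {u : X → A} {v : fixedPoints G X → B}

theorem fiberProd_smul (h : IsTransfer χ res tr) (f : X →[G] Y)
    (hu : ∀ (g : G) x, u (g • x) = g • u x) (g : G) (y : Y) :
    fiberProd f u (g • y) = g • fiberProd f u y := by
  unfold fiberProd
  rw [map_finprod_of_mul (h.smul_one g) (h.smul_mul g)]
  symm
  refine finprod_eq_of_bijective
    (fun x => ⟨g • x.1, (map_smul f g x.1).trans (congrArg (g • ·) x.2)⟩) ⟨?_, ?_⟩ ?_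
  · intro x x' h
    exact Subtype.ext (smul_left_cancel g (congrArg Subtype.val h))
  · rintro ⟨x, hx⟩
    exact ⟨⟨g⁻¹ • x, by rw [map_smul, hx, inv_smul_smul]⟩, Subtype.ext (smul_inv_smul g x)⟩
  · intro x
    exact (hu g x.1).symm

/-- The product over a fibre of a fixed point is the restriction of the product over its orbits. -/
theorem map_orbitProd [OrderTwo χ] (h : IsTransfer χ res tr)
    (hu : ∀ (g : G) x, u (g • x) = g • u x)
    (huv : ∀ x : fixedPoints G X, u x = res (v x)) (f : X →[G] Y) {y : Y}
    (hy : y ∈ fixedPoints G Y) :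
    fiberProd f u y = res (orbitProd G (f ⁻¹' {y}) (weight tr u v)) := by
  unfold orbitProd fiberProd
  have hs : ∀ (x : X), f x = y → (Quotient.mk (orbitRel G X) x).out ∈ f ⁻¹' {y} := by
    intro x hx
    obtain ⟨g, hg⟩ := exists_smul_out (G := G) x
    rw [← inv_smul_eq_iff.2 hg.symm]
    exact smul_mem_fiber f hy _ _ hx
  rw [map_finprod_of_mul h.res_one h.res_mul, finprod_fiberwise
    (fun x : {x // f x = y} => (⟨Quotient.mk (orbitRel G X) x.1, hs x.1 x.2⟩ :
      {o : orbitRel.Quotient G X // o.out ∈ f ⁻¹' {y}}))]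
  refine finprod_congr fun o => ?_
  -- The part of the fibre in the orbit `o` is `{x, χx}`, where possibly `x = χx`.
  let j : {x : {x // f x = y} // (⟨Quotient.mk (orbitRel G X) x.1, hs x.1 x.2⟩ :
      {o : orbitRel.Quotient G X // o.out ∈ f ⁻¹' {y}}) = o} → X := fun x => x.1.1
  have hj : Function.Injective j := fun _ _ h => Subtype.ext (Subtype.ext h)
  have hr : Set.range j = {o.1.out, χ • o.1.out} := by
    ext x
    constructor
    · rintro ⟨⟨⟨x, hx⟩, rfl⟩, rfl⟩
      obtain ⟨g, hg⟩ := exists_smul_out (G := G) x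
      rcases OrderTwo.eq_or (χ := χ) g with rfl | rfl
      · exact Or.inl (hg.symm.trans (one_smul G _))
      · exact Or.inr hg.symm
    · have key : ∀ g : G, g • o.1.out ∈ Set.range j := fun g =>
        ⟨⟨⟨g • o.1.out, smul_mem_fiber f hy g _ o.2⟩, Subtype.ext ((Quotient.sound
          (orbitRel_apply.2 ⟨g, rfl⟩)).trans o.1.out_eq)⟩, rfl⟩
      rintro (rfl | rfl)
      · have := key 1
        rwa [one_smul] at this
      · exact key χ
  rw [← finprod_mem_range (f := u) hj, hr]
  by_cases hx : o.1.out ∈ fixedPoints G X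
  · rw [hx χ, Set.pair_eq_singleton, finprod_mem_singleton, weight_fixed hx]
    exact huv ⟨_, hx⟩
  · rw [finprod_mem_pair fun h => hx (OrderTwo.mem_fixedPoints.2 h.symm), weight_free hx, h.res_tr,
      hu]

/-- Products over orbits can be computed in two steps along an equivariant map. -/
theorem orbitProd_comp [OrderTwo χ] [Finite Y] (h : IsTransfer χ res tr)
    (hu : ∀ (g : G) x, u (g • x) = g • u x) (f : X →[G] Y) (g : Y →[G] Z) {z : Z}
    (hz : z ∈ fixedPoints G Z) :
    orbitProd G (g.comp f ⁻¹' {z}) (weight tr u v) =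
      orbitProd G (g ⁻¹' {z}) (weight tr (fiberProd f u)
        fun y : fixedPoints G Y => orbitProd G (f ⁻¹' {y.1}) (weight tr u v)) := by
  have hs : ∀ x : X, x ∈ g.comp f ⁻¹' {z} →
      (Quotient.mk (orbitRel G Y) (f x)).out ∈ g ⁻¹' {z} := by
    intro x hx
    obtain ⟨k, hk⟩ := exists_smul_out (G := G) (f x)
    rw [← inv_smul_eq_iff.2 hk.symm]
    exact smul_mem_fiber g hz _ _ (show f x ∈ g ⁻¹' {z} from hx)
  have hw := weight_smul (v := v) χ h.tr_conj hu
  rw [orbitProd, finprod_fiberwise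
    (fun o : {o : orbitRel.Quotient G X // o.out ∈ g.comp f ⁻¹' {z}} =>
      (⟨Quotient.mk (orbitRel G Y) (f o.1.out), hs _ o.2⟩ :
        {o : orbitRel.Quotient G Y // o.out ∈ g ⁻¹' {z}}))]
  refine finprod_congr fun p => ?_
  by_cases hy : p.1.out ∈ fixedPoints G Y
  -- Over a fixed point `y` both sides run over the orbits in the fibre of `y`.
  · rw [weight_fixed hy]
    refine finprod_eq_of_bijective (fun o => ⟨o.1.1, ?_⟩) ⟨?_, ?_⟩ fun _ => rfl
    · obtain ⟨k, hk⟩ := exists_smul_out (G := G) (f o.1.1.out)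
      have e : (Quotient.mk (orbitRel G Y) (f o.1.1.out)) = p.1 := congrArg Subtype.val o.2
      rw [e, hy k] at hk
      exact hk.symm
    · intro o o' h
      exact Subtype.ext (Subtype.ext (congrArg (fun t => t.1) h))
    · rintro ⟨o, ho⟩
      have ho' : f o.out = p.1.out := ho
      refine ⟨⟨⟨o, ?_⟩, ?_⟩, rfl⟩
      · change g (f o.out) = z
        rw [ho']
        exact p.2
      · refine Subtype.ext ?_
        change Quotient.mk (orbitRel G Y) (f o.out) = p.1
        rw [ho', Quotient.out_eq]
  -- Over a free orbit `{y, χy}` every orbit is free and meets the fibre of `y` in one point.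
  · rw [weight_free hy, fiberProd, map_finprod_of_mul h.tr_one h.tr_mul]
    symm
    have free : ∀ x : X, f x = p.1.out → x ∉ fixedPoints G X := fun x hx h => hy fun k => by
      rw [← hx, ← map_smul, h k]
    have mem : ∀ x : X, f x = p.1.out →
        (Quotient.mk (orbitRel G X) x).out ∈ g.comp f ⁻¹' {z} := by
      intro x hx
      obtain ⟨k, hk⟩ := exists_smul_out (G := G) x
      rw [← inv_smul_eq_iff.2 hk.symm]
      refine smul_mem_fiber (g.comp f) hz _ _ ?_
      change g (f x) = z
      rw [hx]
      exact p.2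
    refine finprod_eq_of_bijective (fun x => ⟨⟨Quotient.mk (orbitRel G X) x.1, mem x.1 x.2⟩, ?_⟩)
      ⟨?_, ?_⟩ ?_
    · refine Subtype.ext ?_
      obtain ⟨k, hk⟩ := exists_smul_out (G := G) x.1
      change Quotient.mk (orbitRel G Y) (f (Quotient.mk (orbitRel G X) x.1).out) = p.1
      rw [← inv_smul_eq_iff.2 hk.symm, map_smul, x.2]
      exact (Quotient.sound (orbitRel_apply.2 ⟨k⁻¹, rfl⟩)).trans p.1.out_eq
    · intro x x' h
      have h : Quotient.mk (orbitRel G X) x.1 = Quotient.mk (orbitRel G X) x'.1 :=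
        congrArg (fun o => o.1.1) h
      obtain ⟨k, hk⟩ := orbitRel_apply.1 (Quotient.exact h)
      have hk : k • x'.1 = x.1 := hk
      have hk' : k • p.1.out = p.1.out := by
        rw [← x'.2, ← map_smul, hk, x.2, x'.2]
      rcases OrderTwo.eq_or (χ := χ) k with rfl | rfl
      · exact Subtype.ext (hk.symm.trans (one_smul G _))
      · exact absurd (OrderTwo.mem_fixedPoints.2 hk') hy
    · rintro ⟨⟨o, ho⟩, ho'⟩
      have ho' : Quotient.mk (orbitRel G Y) (f o.out) = p.1 := congrArg Subtype.val ho'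
      obtain ⟨k, hk⟩ := exists_smul_out (G := G) (f o.out)
      rw [ho'] at hk
      refine ⟨⟨k⁻¹ • o.out, by rw [map_smul, ← hk, inv_smul_smul]⟩, ?_⟩
      refine Subtype.ext (Subtype.ext ?_)
      exact (Quotient.sound (orbitRel_apply.2 ⟨k⁻¹, rfl⟩)).trans o.out_eq
    · intro x
      obtain ⟨k, hk⟩ := exists_smul_out (G := G) x.1
      rw [← hw k, hk, weight_free (free x.1 x.2)]

end weight

/-! ### The operators on the sets `EP P X` -/

namespace EP

open FinGSet MulAction

variable {G : Type} [Group G] {χ : G} {P : TambaraPair.{w} χ} {X Y Z : FinGSet G}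

theorem ext_apply {c c' : EP P X} (hu : ∀ x, c.u x = c'.u x) (hv : ∀ x, c.v x = c'.v x) : c = c' :=
  EP.ext (MulActionHom.ext hu) (funext hv)

/-- The restriction operator `R_f`. -/
def restrict (f : X →[G] Y) (c : EP P Y) : EP P X where
  u := c.u.comp f
  v x := c.v (onFixed f x)
  compat x := c.compat (onFixed f x)

theorem weight_restrict {tr : P.A → P.B} {X' : FinGSet G} (g : X' →[G] X) (c : EP P X) {x : X'}
    (hx : g x ∈ fixedPoints G X ↔ x ∈ fixedPoints G X') :
    weight tr c.u c.v (g x) = weight tr (restrict g c).u (restrict g c).v x := by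
  by_cases h : x ∈ fixedPoints G X'
  · rw [weight_fixed h, weight_fixed (hx.2 h)]
    rfl
  · rw [weight_free h, weight_free (mt hx.1 h)]
    rfl

theorem sum_bijective (X Y : FinGSet G) : Function.Bijective fun c : EP P (sum X Y) =>
    (restrict (inl X Y) c, restrict (inr X Y) c) := by
  constructor
  · intro c c' h
    have h₁ : restrict (inl X Y) c = restrict (inl X Y) c' := congrArg Prod.fst h
    have h₂ : restrict (inr X Y) c = restrict (inr X Y) c' := congrArg Prod.snd h
    refine ext_apply ?_ ?_
    · rintro (x | x)
      · exact congrArg (fun d => d.u x) h₁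
      · exact congrArg (fun d => d.u x) h₂
    · rintro ⟨x | x, hx⟩
      · exact congrArg (fun d => d.v ⟨x, fun g => Sum.inl_injective (hx g)⟩) h₁
      · exact congrArg (fun d => d.v ⟨x, fun g => Sum.inr_injective (hx g)⟩) h₂
  · rintro ⟨a, b⟩
    refine ⟨⟨⟨Sum.elim a.u b.u, ?_⟩, fun x => match x with
      | ⟨Sum.inl x, hx⟩ => a.v ⟨x, fun g => Sum.inl_injective (hx g)⟩
      | ⟨Sum.inr x, hx⟩ => b.v ⟨x, fun g => Sum.inr_injective (hx g)⟩, ?_⟩, rfl⟩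
    · rintro g (x | x)
      · exact map_smul a.u g x
      · exact map_smul b.u g x
    · rintro ⟨x | x, hx⟩
      · exact a.compat ⟨x, fun g => Sum.inl_injective (hx g)⟩
      · exact b.compat ⟨x, fun g => Sum.inr_injective (hx g)⟩

section

/-! The monoid structures `monA` and `monB` are independent of the semirings of `P`: they are its
multiplications for norms, and its additions for transfers. Products in them are written with
`monA.mul` and `monB.mul`, since `*` denotes the multiplications of `P`. -/

variable [OrderTwo χ] [monA : CommMonoid P.A] [monB : CommMonoid P.B] {tr : P.A → P.B}

/-- The covariant operator attached to a `G`-map, for one of the two kinds of transfer. At fixed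
points it is a product over orbits, which avoids a choice of representatives of the free ones. -/
noncomputable def extend (h : IsTransfer χ P.res tr) (f : X →[G] Y) (c : EP P X) : EP P Y where
  u := ⟨fiberProd f c.u, fun g y => fiberProd_smul h f (map_smul c.u) g y⟩
  v y := orbitProd G (f ⁻¹' {y.1}) (weight tr c.u c.v)
  compat y := map_orbitProd h (map_smul c.u) c.compat f y.2

theorem weight_invariant (h : IsTransfer χ P.res tr) (c : EP P X) (g : G) (x : X) :
    weight tr c.u c.v (g • x) = weight tr c.u c.v x :=
  weight_smul χ h.tr_conj (map_smul c.u) g x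

variable (h : IsTransfer χ P.res tr)

/-- The formula for `extend` at fixed points: `X^G` and `X₁` together form a set of representatives
of the orbits in `f⁻¹(Y^G)`, so the value does not depend on `X₁`. -/
theorem extend_v (f : X →[G] Y) (X₁ : Set X) (hX : IsFreeSection χ f X₁) (c : EP P X)
    (y : fixedPoints G Y) : (extend h f c).v y =
      monB.mul (∏ᶠ x : {x : fixedPoints G X // f x = y}, c.v x)
        (∏ᶠ x : {x : X // x ∈ X₁ ∧ f x = y}, tr (c.u x)) := by
  have free : ∀ x ∈ X₁, x ∉ fixedPoints G X := fun x hx hx' =>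
    Set.disjoint_left.1 hX.disjoint_fixed hx' hx
  change orbitProd G _ _ = _
  rw [orbitProd_eq (Sum.elim (fun x : {x : fixedPoints G X // f x = y} => x.1.1)
    (fun x : {x : X // x ∈ X₁ ∧ f x = y} => x.1)) (smul_mem_fiber f y.2) (weight_invariant h c)]
  · rw [finprod_sumType]
    exact congrArg₂ monB.mul (finprod_congr fun x => weight_fixed x.1.2)
      (finprod_congr fun x => weight_free (free x.1 x.2.1))
  · rintro (x | x)
    · exact x.2
    · exact x.2.2
  · intro x hx
    have hx' : f x = y := hx
    have : x ∈ fixedPoints G X ∪ X₁ ∪ (fun x => χ • x) '' X₁ := by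
      rw [← hX.union]
      change f x ∈ fixedPoints G Y
      rw [hx']
      exact y.2
    rcases this with (hx₁ | hx₁) | ⟨z, hz, rfl⟩
    · exact ⟨Sum.inl ⟨⟨x, hx₁⟩, hx'⟩, 1, one_smul G x⟩
    · exact ⟨Sum.inr ⟨x, hx₁, hx'⟩, 1, one_smul G x⟩
    · refine ⟨Sum.inr ⟨z, hz, ?_⟩, χ, rfl⟩
      have := smul_mem_fiber f y.2 χ _ hx
      rw [OrderTwo.smul_smul] at this
      exact this
  · rintro (⟨⟨x, hx⟩, hxy⟩ | ⟨x, hx, hxy⟩) (⟨⟨z, hz⟩, hzy⟩ | ⟨z, hz, hzy⟩) g (e : g • x = z)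
    · rw [hx g] at e
      subst e
      rfl
    · rw [hx g] at e
      subst e
      exact absurd hx (free x hz)
    · subst e
      exact absurd (smul_mem_fixedPoints_iff.1 hz) (free x hx)
    · rcases OrderTwo.eq_or (χ := χ) g with rfl | rfl
      · rw [one_smul] at e
        subst e
        rfl
      · exact absurd ⟨x, hx, e⟩ (Set.disjoint_left.1 hX.disjoint_conj hz)

theorem extend_id (c : EP P X) : extend h (MulActionHom.id G) c = c := by
  refine ext_apply (fun x => ?_) fun x => ?_
  · change ∏ᶠ z : {z : X // z = x}, c.u z = c.u x
    rw [finprod_unique]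
    rfl
  · change orbitProd G {z : X | z = x.1} _ = _
    refine (orbitProd_eq (s := {z : X | z = x.1}) (fun _ : Unit => x.1) ?_ (weight_invariant h c)
      (fun _ => rfl) ?_ ?_).trans ?_
    · intro g z (hz : z = x)
      change g • z = x.1
      rw [hz, x.2 g]
    · exact fun z hz => ⟨(), 1, (one_smul G _).trans (Eq.symm hz)⟩
    · exact fun _ _ _ _ => rfl
    · rw [finprod_unique, weight_fixed x.2]

theorem extend_comp (f : X →[G] Y) (g : Y →[G] Z) (c : EP P X) :
    extend h (g.comp f) c = extend h g (extend h f c) :=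
  ext_apply (fun z => fiberProd_comp f g z)
    fun z => orbitProd_comp h (map_smul c.u) f g z.2

theorem restrict_extend {X' Y' : FinGSet G} {f' : X' →[G] Y'} {g' : X' →[G] X} {g : Y' →[G] Y}
    {f : X →[G] Y} (hp : IsPull f' g' g f) (c : EP P X) :
    restrict g (extend h f c) = extend h f' (restrict g' c) := by
  refine ext_apply (fun y => ?_) fun y => ?_
  · symm
    refine finprod_eq_of_bijective
      (fun x : {x // f' x = y} => (⟨g' x.1, (hp.comm x.1).trans (congrArg g x.2)⟩ :
        {x // f x = g y})) ⟨fun x x' e => ?_, ?_⟩ fun _ => rfl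
    · exact Subtype.ext (hp.inj _ _ (congrArg (fun t => t.1) e) (x.2.trans x'.2.symm))
    · rintro ⟨x, hx⟩
      obtain ⟨x', rfl, rfl⟩ := hp.surj x y hx
      exact ⟨⟨x', rfl⟩, rfl⟩
  · symm
    refine orbitProd_congr g' (smul_mem_fiber f' y.2) (smul_mem_fiber f (onFixed g y).2)
      (weight_invariant h c) ⟨?_, ?_, ?_⟩ ?_
    · intro x (hx : f' x = y)
      exact (hp.comm x).trans (congrArg g hx)
    · intro x (hx : f' x = y) x' (hx' : f' x' = y) e
      exact hp.inj x x' e (hx.trans hx'.symm)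
    · intro x hx
      obtain ⟨x', rfl, hx'⟩ := hp.surj x y hx
      exact ⟨x', hx', rfl⟩
    · intro x (hx : f' x = y)
      refine weight_restrict g' c ⟨fun hf k => ?_, fun hf => (onFixed g' ⟨x, hf⟩).2⟩
      refine hp.inj _ _ ?_ ?_
      · rw [map_smul, hf k]
      · rw [map_smul, hx, y.2 k]

/-- The restrictions and one of the two kinds of covariant operators on the sets `EP P X`. -/
noncomputable def semiMackey : SemiMackey (EP P) where
  R f c := restrict f c
  M f c := extend h f c
  R_id _ := rfl
  R_comp _ _ _ := rfl
  M_id := extend_id h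
  M_comp := extend_comp h
  bc := restrict_extend h
  nonempty_empty := ⟨⟨⟨PEmpty.elim, fun _ x => PEmpty.elim x⟩, fun x => PEmpty.elim x.1,
    fun x => PEmpty.elim x.1⟩⟩
  subsingleton_empty := ⟨fun _ _ => ext_apply (fun x => PEmpty.elim x) fun x => PEmpty.elim x.1⟩
  bijective_sum := sum_bijective

theorem op_u (a b : EP P X) (x : X) :
    ((semiMackey h).op a b).u x = monA.mul (a.u x) (b.u x) := by
  have h₁ := congrArg (fun d => d.u x) ((semiMackey h).R_inl_pair a b)
  have h₂ := congrArg (fun d => d.u x) ((semiMackey h).R_inr_pair a b)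
  rw [← h₁, ← h₂]
  let c := (semiMackey h).pair a b
  change fiberProd (fold X) c.u x = monA.mul (c.u (Sum.inl x)) (c.u (Sum.inr x))
  let e : Unit ⊕ Unit → {z // fold X z = x} :=
    Sum.elim (fun _ => ⟨Sum.inl x, rfl⟩) (fun _ => ⟨Sum.inr x, rfl⟩)
  have he : Function.Bijective e := by
    constructor
    · rintro (_ | _) (_ | _) k
      · rfl
      · exact absurd (congrArg Subtype.val k) Sum.inl_ne_inr
      · exact absurd (congrArg Subtype.val k) Sum.inr_ne_inl
      · rfl
    · rintro ⟨z | z, rfl⟩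
      · exact ⟨Sum.inl (), rfl⟩
      · exact ⟨Sum.inr (), rfl⟩
  unfold fiberProd
  rw [← finprod_eq_of_bijective e he (fun _ => rfl), finprod_sumType, finprod_unique,
    finprod_unique]
  rfl

theorem op_v (a b : EP P X) (x : fixedPoints G X) :
    ((semiMackey h).op a b).v x = monB.mul (a.v x) (b.v x) := by
  have h₁ := congrArg (fun d => d.v x) ((semiMackey h).R_inl_pair a b)
  have h₂ := congrArg (fun d => d.v x) ((semiMackey h).R_inr_pair a b)
  rw [← h₁, ← h₂]
  let c := (semiMackey h).pair a b
  change orbitProd G (fold X ⁻¹' {x.1}) (weight tr c.u c.v) =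
    monB.mul (c.v (onFixed (inl X X) x)) (c.v (onFixed (inr X X) x))
  rw [orbitProd_eq (Sum.elim (fun _ : Unit => inl X X x) (fun _ : Unit => inr X X x))
    (smul_mem_fiber _ x.2) (weight_invariant h c), finprod_sumType, finprod_unique,
    finprod_unique]
  · exact congrArg₂ monB.mul (weight_fixed (onFixed (inl X X) x).2)
      (weight_fixed (onFixed (inr X X) x).2)
  · rintro (_ | _) <;> rfl
  · rintro (z | z) (rfl : z = x)
    · exact ⟨Sum.inl (), 1, one_smul G _⟩
    · exact ⟨Sum.inr (), 1, one_smul G _⟩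
  · rintro (_ | _) (_ | _) g k
    · rfl
    · exact absurd k Sum.inl_ne_inr
    · exact absurd k Sum.inr_ne_inl
    · rfl

theorem unit_u (x : X) : ((semiMackey h).unit X).u x = monA.one :=
  have : IsEmpty {z // fromEmpty X z = x} := ⟨fun z => PEmpty.elim z.1⟩
  finprod_of_isEmpty _

theorem unit_v (x : fixedPoints G X) : ((semiMackey h).unit X).v x = monB.one :=
  have : IsEmpty {o : orbitRel.Quotient G (empty G) // o.out ∈ fromEmpty X ⁻¹' {x.1}} :=
    ⟨fun z => PEmpty.elim z.1.out⟩
  finprod_of_isEmpty _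

theorem toPoint_v [Finite G] (c : EP P (regular G)) (y : fixedPoints G (point G)) :
    ((semiMackey h).M (toPoint (regular G)) c).v y = tr (c.u (1 : G)) := by
  change orbitProd G (toPoint (regular G) ⁻¹' {y.1}) (weight tr c.u c.v) = _
  have h₁ : (show regular G from (1 : G)) ∉ fixedPoints G (regular G) := fun hx =>
    OrderTwo.ne_one (χ := χ) ((mul_one χ).symm.trans (hx χ))
  refine (orbitProd_eq (fun _ : Unit => (show regular G from (1 : G))) (smul_mem_fiber _ y.2)
    (weight_invariant h c) (fun _ => rfl) (fun x _ => ⟨(), elt x, mul_one (elt x)⟩)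
    (fun _ _ _ _ => rfl)).trans ?_
  rw [finprod_unique]
  exact weight_free h₁

end

/-- Elements of `EP P 1` are determined by their component `v`. -/
theorem ext_point {c c' : EP P (point G)} (h : ∀ x, c.v x = c'.v x) : c = c' :=
  ext_apply (fun x => by
    rw [c.compat ⟨x, fun _ => rfl⟩, c'.compat ⟨x, fun _ => rfl⟩, h]) h

variable (P)

theorem isTransfer_trc : @IsTransfer G _ χ P.A P.B (addAsMul P.A) (addAsMul P.B) _ P.res P.trc :=
  @IsTransfer.mk G _ χ P.A P.B (addAsMul P.A) (addAsMul P.B) _ P.res P.trc smul_zero smul_add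
    (map_zero P.res) (map_add P.res) P.trc_zero P.trc_add P.trc_conj P.res_trc

theorem isTransfer_nrm : IsTransfer χ P.res P.nrm where
  smul_one := smul_one
  smul_mul g := smul_mul' g
  res_one := map_one P.res
  res_mul := map_mul P.res
  tr_one := P.nrm_one
  tr_mul := P.nrm_mul
  tr_conj := P.nrm_conj
  res_tr := P.res_nrm

variable [OrderTwo χ]

/-- The restrictions and transfers on the sets `EP P X`. -/
noncomputable def transfers : SemiMackey (EP P) :=
  @semiMackey G _ χ P _ (addAsMul P.A) (addAsMul P.B) P.trc (isTransfer_trc P)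

/-- The restrictions and norms on the sets `EP P X`. -/
noncomputable def norms : SemiMackey (EP P) := semiMackey (isTransfer_nrm P)

variable {P}

theorem add_u (a b : EP P X) (x : X) : ((transfers P).op a b).u x = a.u x + b.u x :=
  @op_u G _ χ P X _ (addAsMul P.A) (addAsMul P.B) P.trc (isTransfer_trc P) a b x

theorem add_v (a b : EP P X) (x : fixedPoints G X) :
    ((transfers P).op a b).v x = a.v x + b.v x :=
  @op_v G _ χ P X _ (addAsMul P.A) (addAsMul P.B) P.trc (isTransfer_trc P) a b x

theorem zero_u (x : X) : ((transfers P).unit X).u x = 0 :=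
  @unit_u G _ χ P X _ (addAsMul P.A) (addAsMul P.B) P.trc (isTransfer_trc P) x

theorem zero_v (x : fixedPoints G X) : ((transfers P).unit X).v x = 0 :=
  @unit_v G _ χ P X _ (addAsMul P.A) (addAsMul P.B) P.trc (isTransfer_trc P) x

theorem mul_u (a b : EP P X) (x : X) : ((norms P).op a b).u x = a.u x * b.u x :=
  op_u (isTransfer_nrm P) a b x

theorem mul_v (a b : EP P X) (x : fixedPoints G X) :
    ((norms P).op a b).v x = a.v x * b.v x :=
  op_v (isTransfer_nrm P) a b x

theorem one_u (x : X) : ((norms P).unit X).u x = 1 := unit_u (isTransfer_nrm P) x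

theorem one_v (x : fixedPoints G X) : ((norms P).unit X).v x = 1 := unit_v (isTransfer_nrm P) x

theorem trc_v [Finite G] (c : EP P (regular G)) (y : fixedPoints G (point G)) :
    ((transfers P).M (toPoint (regular G)) c).v y = P.trc (c.u (1 : G)) :=
  @toPoint_v G _ χ P _ (addAsMul P.A) (addAsMul P.B) P.trc (isTransfer_trc P) _ c y

theorem nrm_v [Finite G] (c : EP P (regular G)) (y : fixedPoints G (point G)) :
    ((norms P).M (toPoint (regular G)) c).v y = P.nrm (c.u (1 : G)) :=
  toPoint_v (isTransfer_nrm P) c y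

theorem transfer_u (f : X →[G] Y) (c : EP P X) (y : Y) :
    ((transfers P).M f c).u y = ∑ᶠ x : {x : X // f x = y}, c.u x :=
  finprod_addAsMul _

theorem transfer_v (f : X →[G] Y) (X₁ : Set X) (hX : IsFreeSection χ f X₁) (c : EP P X)
    (y : fixedPoints G Y) : ((transfers P).M f c).v y =
      (∑ᶠ x : {x : fixedPoints G X // f x = y}, c.v x) +
        ∑ᶠ x : {x : X // x ∈ X₁ ∧ f x = y}, P.trc (c.u x) := by
  rw [← finprod_addAsMul, ← finprod_addAsMul]
  exact @extend_v G _ χ P X Y _ (addAsMul P.A) (addAsMul P.B) P.trc (isTransfer_trc P) f X₁ hX c y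

theorem norm_u (f : X →[G] Y) (c : EP P X) (y : Y) :
    ((norms P).M f c).u y = ∏ᶠ x : {x : X // f x = y}, c.u x := rfl

theorem norm_v (f : X →[G] Y) (X₁ : Set X) (hX : IsFreeSection χ f X₁) (c : EP P X)
    (y : fixedPoints G Y) : ((norms P).M f c).v y =
      (∏ᶠ x : {x : fixedPoints G X // f x = y}, c.v x) *
        ∏ᶠ x : {x : X // x ∈ X₁ ∧ f x = y}, P.nrm (c.u x) :=
  extend_v (isTransfer_nrm P) f X₁ hX c y

/-- The projection formula. -/
theorem mul_transfer (f : X →[G] Y) (a : EP P Y) (b : EP P X) :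
    (norms P).op a ((transfers P).M f b) =
      (transfers P).M f ((norms P).op (restrict f a) b) := by
  refine ext_apply (fun y => ?_) fun y => ?_
  · rw [mul_u, transfer_u, transfer_u, mul_finsum' _ _ (Set.toFinite _)]
    refine finsum_congr fun x => ?_
    rw [mul_u]
    congr 1
    exact congrArg a.u x.2.symm
  · rw [mul_v]
    have e : ∀ d : EP P X, ((transfers P).M f d).v y =
        ∑ᶠ o : {o : orbitRel.Quotient G X // o.out ∈ f ⁻¹' {y.1}}, weight P.trc d.u d.v o.1.out :=
      fun d => finprod_addAsMul _
    rw [e, e, mul_finsum' _ _ (Set.toFinite _)]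
    refine finsum_congr fun o => ?_
    have ho : f o.1.out = y.1 := o.2
    by_cases hx : o.1.out ∈ fixedPoints G X
    · rw [weight_fixed hx, weight_fixed hx, mul_v]
      congr 1
      exact congrArg a.v (Subtype.ext ho.symm)
    · rw [weight_free hx, weight_free hx, mul_u]
      have : (restrict f a).u o.1.out = P.res (a.v y) := (congrArg a.u ho).trans (a.compat y)
      rw [this, mul_comm (P.res _), P.trc_mul_res, mul_comm]

end EP

/-! ### Bispans act on the sets `EP P X` -/

namespace FinGSet

variable {G : Type} [Group G] {U X Y Z : FinGSet G}

/-- A morphism that can be written without transfers. -/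
def TransferFree (φ : U ⟶ X) : Prop :=
  ∃ (A : FinGSet G) (p : A →[G] U) (q : A →[G] X), φ = R p ≫ N q

theorem TransferFree.comp_N {φ : U ⟶ X} (h : TransferFree φ) (f : X →[G] Y) :
    TransferFree (φ ≫ N f) := by
  obtain ⟨A, p, q, rfl⟩ := h
  exact ⟨A, p, f.comp q, by rw [Category.assoc, N_comp]⟩

/-- By the Beck–Chevalley property of norms. -/
theorem TransferFree.comp_R {φ : U ⟶ X} (h : TransferFree φ) (f : Y →[G] X) :
    TransferFree (φ ≫ R f) := by
  obtain ⟨A, p, q, rfl⟩ := h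
  exact ⟨_, _, _, by
    rw [Category.assoc, N_comp_R (IsPull.pullSet f q), ← Category.assoc, FinGSet.R_comp]⟩

/-- Every morphism is a transfer-free one followed by a transfer. -/
theorem exists_eq_comp_T (φ : U ⟶ X) : ∃ (B : FinGSet G) (n : U ⟶ B) (r : B →[G] X),
    TransferFree n ∧ φ = n ≫ T r := by
  induction φ using Quotient.inductionOn with
  | _ ω => exact ⟨ω.B, R ω.p ≫ N ω.q, ω.r, ⟨_, _, _, rfl⟩, by rw [mk_eq, Category.assoc]⟩

/-- The Tambara functor represented by `U`. The identities that hold in all Tambara functors are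
thereby identities between morphisms of bispans with source `U`. -/
noncomputable def hom (U : FinGSet G) : TambaraFunctor.{1} G :=
  ⟨coyoneda.obj (Opposite.op U), inferInstance⟩

/-- The transfer along an isomorphism is the restriction along its inverse. -/
theorem T_eq_R {f : X →[G] Y} {g : Y →[G] X} (h₁ : f.comp g = MulActionHom.id G)
    (h₂ : g.comp f = MulActionHom.id G) : T f = R g := by
  have h := (hom X).transfers.M_eq_R h₁ h₂ (𝟙 X)
  change 𝟙 X ≫ T f = 𝟙 X ≫ R g at h
  rwa [Category.id_comp, Category.id_comp] at h

/-- The norm along an isomorphism is the restriction along its inverse. -/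
theorem N_eq_R {f : X →[G] Y} {g : Y →[G] X} (h₁ : f.comp g = MulActionHom.id G)
    (h₂ : g.comp f = MulActionHom.id G) : N f = R g := by
  have h := (hom X).norms.M_eq_R h₁ h₂ (𝟙 X)
  change 𝟙 X ≫ N f = 𝟙 X ≫ R g at h
  rwa [Category.id_comp, Category.id_comp] at h

end FinGSet

namespace EP

open FinGSet MulAction

variable {G : Type} [Group G] {χ : G} [OrderTwo χ] {P : TambaraPair.{w} χ} {U X Y Z : FinGSet G}

/-- The action `T_r N_q R_p` of a bispan. -/
noncomputable def act (ω : Bispan X Y) (c : EP P X) : EP P Y :=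
  (transfers P).M ω.r ((norms P).M ω.q (restrict ω.p c))

theorem act_congr {ω ω' : Bispan X Y} (h : ω ≈ ω') (c : EP P X) : act ω c = act ω' c := by
  obtain ⟨e⟩ := h
  let α : ω.A →[G] ω'.A := ⟨e.α, e.map_smul_α⟩
  let β : ω.B →[G] ω'.B := ⟨e.β, e.map_smul_β⟩
  have hp : ω.p = ω'.p.comp α := MulActionHom.ext fun x => (e.comm_p x).symm
  have hq : IsPull ω.q α β ω'.q :=
    { comm := e.comm_q
      inj := fun _ _ h _ => e.α.injective h
      surj := fun x y h => ⟨e.α.symm x, e.α.apply_symm_apply x, e.β.injective (by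
        rw [← e.comm_q, e.α.apply_symm_apply]
        exact h)⟩ }
  have hr : IsPull ω.r β (MulActionHom.id G) ω'.r :=
    { comm := e.comm_r
      inj := fun _ _ h _ => e.β.injective h
      surj := fun x y h => ⟨e.β.symm x, e.β.apply_symm_apply x, by
        rw [← e.comm_r, e.β.apply_symm_apply]
        exact h⟩ }
  have h₁ : (norms P).M ω.q (restrict α (restrict ω'.p c)) =
      restrict β ((norms P).M ω'.q (restrict ω'.p c)) := ((norms P).bc hq _).symm
  have h₂ := (transfers P).bc hr ((norms P).M ω'.q (restrict ω'.p c))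
  rw [(transfers P).R_id] at h₂
  unfold act
  rw [hp]
  exact (congrArg _ h₁).trans h₂.symm

/-- The action of a morphism in the category of bispans. -/
noncomputable def map (φ : X ⟶ Y) (c : EP P X) : EP P Y :=
  Quotient.lift (fun ω : Bispan X Y => act ω c) (fun _ _ h => act_congr h c) φ

theorem map_R_comp_N {A : FinGSet G} (p : A →[G] X) (q : A →[G] Y) (c : EP P X) :
    map (R p ≫ N q) c = (norms P).M q (restrict p c) := by
  rw [R_comp_N]
  exact (transfers P).M_id _

theorem map_R (f : Y →[G] X) (c : EP P X) : map (R f) c = restrict f c := by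
  rw [← Category.comp_id (R f), ← N_id, map_R_comp_N]
  exact (norms P).M_id _

theorem map_id (c : EP P X) : map (𝟙 X) c = c := map_R (MulActionHom.id G) c

/-- By the Beck–Chevalley property of transfers and norms on the sets `EP P X`. -/
theorem map_comp_R (φ : U ⟶ X) (f : Y →[G] X) (c : EP P U) :
    map (φ ≫ R f) c = restrict f (map φ c) := by
  induction φ using Quotient.inductionOn with
  | _ ω =>
  refine (act_congr (Bispan.R_comp f ω) c).trans ?_
  have hr : IsPull (Bispan.pull f ω).r ⟨fun z => z.1.2, fun _ _ => rfl⟩ f ω.r :=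
    IsPull.pullSet f ω.r
  have hq : IsPull (X' := (Bispan.pull f ω).A) (X := ω.A) (Bispan.pull f ω).q
      ⟨fun z => z.1.2, fun _ _ => rfl⟩ ⟨fun z => z.1.2, fun _ _ => rfl⟩ ω.q :=
    { comm := fun _ => rfl
      inj := fun _ _ h h' => Subtype.ext (Prod.ext (congrArg (fun z => z.1.1) h') h)
      surj := fun a z h => ⟨⟨(z.1.1, a), z.2.trans (congrArg ω.r h.symm)⟩, rfl,
        Subtype.ext (Prod.ext rfl h)⟩ }
  have h₁ := (transfers P).bc hr ((norms P).M ω.q (restrict ω.p c))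
  have h₂ := (norms P).bc hq (restrict ω.p c)
  exact ((congrArg _ h₂).symm.trans h₁.symm)

theorem map_comp_T (φ : U ⟶ X) (f : X →[G] Y) (c : EP P U) :
    map (φ ≫ T f) c = (transfers P).M f (map φ c) := by
  induction φ using Quotient.inductionOn with
  | _ ω =>
  exact (act_congr (Bispan.T_comp f ω) c).trans ((transfers P).M_comp ω.r f _)

theorem map_T (f : X →[G] Y) (c : EP P X) : map (T f) c = (transfers P).M f c := by
  rw [← Category.id_comp (T f), map_comp_T, map_id]

theorem map_N (f : X →[G] Y) (c : EP P X) : map (N f) c = (norms P).M f c := by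
  rw [← Category.id_comp (N f), ← R_id, map_R_comp_N]
  rfl

theorem map_comp_N_of_transferFree {φ : U ⟶ X} (h : TransferFree φ) (f : X →[G] Y) (c : EP P U) :
    map (φ ≫ N f) c = (norms P).M f (map φ c) := by
  obtain ⟨A, p, q, rfl⟩ := h
  rw [Category.assoc, N_comp, map_R_comp_N, map_R_comp_N, (norms P).M_comp]

theorem map_add (φ ψ : U ⟶ X) (c : EP P U) :
    map ((hom U).transfers.op φ ψ) c = (transfers P).op (map φ c) (map ψ c) := by
  have h₁ : (hom U).transfers.pair φ ψ ≫ R (inl X X) = φ := (hom U).transfers.R_inl_pair φ ψ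
  have h₂ : (hom U).transfers.pair φ ψ ≫ R (inr X X) = ψ := (hom U).transfers.R_inr_pair φ ψ
  refine (map_comp_T ((hom U).transfers.pair φ ψ) (fold X) c).trans ?_
  rw [(transfers P).M_fold]
  refine congrArg₂ _ ?_ ?_
  · exact (map_comp_R _ _ c).symm.trans (congrArg (fun φ => map φ c) h₁)
  · exact (map_comp_R _ _ c).symm.trans (congrArg (fun φ => map φ c) h₂)

theorem map_mul_of_transferFree {φ ψ : U ⟶ X} (hφ : TransferFree φ) (hψ : TransferFree ψ)
    (c : EP P U) : map ((hom U).norms.op φ ψ) c = (norms P).op (map φ c) (map ψ c) := by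
  obtain ⟨A, p, q, rfl⟩ := hφ
  obtain ⟨A', p', q', rfl⟩ := hψ
  have h₁ := (hom U).norms.M_elim_pair q q' (R p) (R p')
  have h₂ := (hom U).norms.R_elim p p' (𝟙 U)
  change 𝟙 U ≫ R (elim p p') = (hom U).norms.pair (𝟙 U ≫ R p) (𝟙 U ≫ R p') at h₂
  rw [Category.id_comp, Category.id_comp, Category.id_comp] at h₂
  rw [← h₂] at h₁
  rw [map_R_comp_N, map_R_comp_N]
  refine (congrArg (fun φ => map φ c) h₁).symm.trans
    ((map_R_comp_N (elim p p') (elim q q') c).trans ?_)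
  have h₃ := (norms P).R_elim p p' c
  exact (congrArg _ h₃).trans ((norms P).M_elim_pair q q' _ _)

end EP

/-- The product of two transfers in a Tambara functor is a transfer from a fibre product. -/
theorem TambaraFunctor.transfer_mul_transfer {G : Type} [Group G] (S : TambaraFunctor.{w} G)
    {X X' Y Z : FinGSet G} {f : X →[G] Y} {g : X' →[G] Y} {f' : Z →[G] X'} {g' : Z →[G] X}
    (h : FinGSet.IsPull f' g' g f) (a : S.obj.obj X) (b : S.obj.obj X') :
    S.norms.op (S.transfers.M f a) (S.transfers.M g b) =
      S.transfers.M g (S.transfers.M f' (S.norms.op (S.norms.R f' b) (S.norms.R g' a))) := by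
  have h₁ := S.mul_transfer g (S.transfers.M f a) b
  have h₂ := S.mul_transfer f' b (S.transfers.R g' a)
  refine h₁.trans (congrArg (S.transfers.M g) ?_)
  refine Eq.trans ?_ h₂
  exact (congrArg (fun x => S.norms.op x b) (S.transfers.bc h a)).trans (S.norms.op_comm _ _)

namespace EP

open FinGSet MulAction

variable {G : Type} [Group G] {χ : G} [OrderTwo χ] {P : TambaraPair.{w} χ} {U X Y Z : FinGSet G}

theorem transfer_mul_transfer {X' : FinGSet G} {f : X →[G] Y} {g : X' →[G] Y} {f' : Z →[G] X'}
    {g' : Z →[G] X} (h : IsPull f' g' g f) (a : EP P X) (b : EP P X') :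
    (norms P).op ((transfers P).M f a) ((transfers P).M g b) =
      (transfers P).M g ((transfers P).M f' ((norms P).op (restrict f' b) (restrict g' a))) := by
  rw [mul_transfer]
  refine congrArg _ (Eq.trans ?_ (mul_transfer f' b (restrict g' a)))
  exact (congrArg (fun x => (norms P).op x b) ((transfers P).bc h a)).trans
    ((norms P).op_comm _ _)

/-- Multiplicativity of the action of bispans: the projection formula, which holds both for
bispans and for the sets `EP P X`, reduces it to the case without transfers. -/
theorem map_mul (φ ψ : U ⟶ X) (c : EP P U) :
    map ((hom U).norms.op φ ψ) c = (norms P).op (map φ c) (map ψ c) := by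
  obtain ⟨B, n, r, hn, rfl⟩ := exists_eq_comp_T φ
  obtain ⟨B', n', r', hn', rfl⟩ := exists_eq_comp_T ψ
  have h := IsPull.pullSet r' r
  have h₁ := (hom U).transfer_mul_transfer h n n'
  rw [map_comp_T, map_comp_T, transfer_mul_transfer h, ← map_comp_R, ← map_comp_R,
    ← map_mul_of_transferFree (hn'.comp_R _) (hn.comp_R _)]
  exact (congrArg (fun φ => map φ c) h₁).trans
    ((map_comp_T (_ ≫ T _) r' c).trans (congrArg _ (map_comp_T _ _ c)))

theorem map_comp_N_fold (φ : U ⟶ sum X X) (c : EP P U) :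
    map (φ ≫ N (fold X)) c = (norms P).M (fold X) (map φ c) := by
  rw [(norms P).M_fold]
  refine (congrArg (fun φ => map φ c) ((hom U).norms.M_fold φ)).trans ((map_mul _ _ c).trans ?_)
  exact congrArg₂ _ (map_comp_R φ _ c) (map_comp_R φ _ c)

variable [Finite G]

/-- The axiom `nrm(0) = 0` of `P`, as an identity of operators. -/
theorem norm_zero (d : EP P (FinGSet.empty G)) :
    (norms P).M (toPoint (regular G)) ((transfers P).M (fromEmpty _) d) =
      (transfers P).M (fromEmpty _) d := by
  refine ext_point fun y => ?_
  rw [nrm_v, (transfers P).M_fromEmpty, (transfers P).M_fromEmpty, zero_v]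
  exact (congrArg P.nrm (zero_u (X := regular G) (1 : G))).trans P.nrm_zero

/-- The axiom on `nrm(a + b)` of `P`, as an identity of operators. -/
theorem norm_add (a b : EP P (regular G)) :
    (norms P).M (toPoint (regular G)) ((transfers P).op a b) =
      (transfers P).op ((transfers P).op ((norms P).M (toPoint (regular G)) a)
        ((norms P).M (toPoint (regular G)) b))
        ((transfers P).M (toPoint (regular G)) ((norms P).op a (restrict (rightMul χ) b))) := by
  refine ext_point fun y => ?_
  rw [add_v, add_v, nrm_v, nrm_v, nrm_v, trc_v]
  have e₁ := add_u a b (X := regular G) (1 : G)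
  have e₂ := mul_u a (restrict (rightMul χ) b) (X := regular G) (1 : G)
  have e₃ : (restrict (rightMul χ) b).u (1 : G) = χ • b.u (1 : G) :=
    (congrArg b.u ((one_mul χ).trans (mul_one χ).symm)).trans
      (map_smul b.u χ (show regular G from (1 : G)))
  exact (congrArg P.nrm e₁).trans ((P.nrm_add _ _).trans
    (congrArg (fun t => _ + P.trc t) (e₂.trans (congrArg _ e₃)).symm))

/-- Compatibility with the norm for `G → 1`, by induction on the source of the transfer. Sums are
handled by the formula for `nrm(a + b)`, which holds both for bispans and for the sets `EP P X`. -/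
theorem map_comp_T_comp_N_toPoint {B : FinGSet G} {n : U ⟶ B} (hn : TransferFree n)
    (r : B →[G] regular G) (c : EP P U) :
    map ((n ≫ T r) ≫ N (toPoint (regular G))) c =
      (norms P).M (toPoint (regular G)) (map (n ≫ T r) c) := by
  induction B using induction_on χ with
  | iso e he ih =>
    obtain ⟨g, h₁, h₂⟩ := exists_inverse e he
    have : n ≫ T r = (n ≫ R e) ≫ T (r.comp e) := by
      rw [← T_eq_R h₂ h₁, Category.assoc, T_comp]
      congr 2
      exact MulActionHom.ext fun x => congrArg r (DFunLike.congr_fun h₁ x).symm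
    rw [this]
    exact ih (hn.comp_R e) _
  | empty =>
    obtain rfl : r = fromEmpty _ := MulActionHom.ext fun x => PEmpty.elim x
    rw [Category.assoc, T_fromEmpty_comp_N _ fun y => ⟨(1 : G), rfl⟩, map_comp_T, map_comp_T,
      norm_zero]
  -- There is no equivariant map `1 → G`.
  | point =>
    have h : χ • r PUnit.unit = r PUnit.unit := (map_smul r χ PUnit.unit).symm
    exact absurd (mul_eq_right.1 (show χ * elt (r PUnit.unit) = _ from h))
      (OrderTwo.ne_one (χ := χ))
  -- An equivariant map `G → G` is bijective, so its transfer is also a norm.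
  | regular =>
    have hr : r = rightMul (elt (r (1 : G))) := MulActionHom.ext fun x : G =>
      (congrArg r (mul_one x).symm).trans (map_smul r x (1 : G))
    rw [hr]
    generalize elt (r (1 : G)) = k
    have h₁ : (rightMul k).comp (rightMul k⁻¹) = MulActionHom.id G := by
      rw [rightMul_comp_rightMul, inv_mul_cancel, rightMul_one]
    have h₂ : (rightMul k⁻¹).comp (rightMul k) = MulActionHom.id G := by
      rw [rightMul_comp_rightMul, mul_inv_cancel, rightMul_one]
    rw [T_eq_R h₁ h₂, ← N_eq_R h₁ h₂, map_comp_N_of_transferFree (hn.comp_N _)]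
  | sum ih₁ ih₂ =>
    rename_i X Y
    have h : n ≫ T r = (hom U).transfers.op ((n ≫ R (inl X Y)) ≫ T (r.comp (inl X Y)))
        ((n ≫ R (inr X Y)) ≫ T (r.comp (inr X Y))) := (hom U).transfers.M_eq_op r n
    have h₁ := ih₁ (hn.comp_R (inl X Y)) (r.comp (inl X Y))
    have h₂ := ih₂ (hn.comp_R (inr X Y)) (r.comp (inr X Y))
    rw [h]
    revert h₁ h₂
    generalize (n ≫ R (inl X Y)) ≫ T (r.comp (inl X Y)) = φ
    generalize (n ≫ R (inr X Y)) ≫ T (r.comp (inr X Y)) = ψ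
    intro h₁ h₂
    rw [map_add, norm_add, ← h₁, ← h₂, ← map_comp_R, ← map_mul]
    exact (congrArg (fun φ => map φ c) ((hom U).norm_add χ φ ψ)).trans
      ((map_add _ _ c).trans (congrArg₂ _ (map_add _ _ c) (map_comp_T _ _ c)))

/-- The action of bispans is compatible with all norms: the two sides are local in the target of
`f`, so that it is enough to consider the fold maps and `G → 1`. -/
theorem map_comp_N (f : X →[G] Y) (φ : U ⟶ X) (c : EP P U) :
    map (φ ≫ N f) c = (norms P).M f (map φ c) := by
  induction f using map_induction_on χ with
  | loc f ih =>
    refine (norms P).ext_orbits χ fun Y' g hY => ?_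
    have h := IsPull.pullSet g f
    rw [(norms P).bc h]
    change restrict g _ = (norms P).M _ (restrict _ _)
    rw [← map_comp_R, ← map_comp_R, ← ih _ _ g hY h, Category.assoc, N_comp_R h, Category.assoc]
  | comp f g hf hg => rw [← N_comp, ← Category.assoc, hg, hf, (norms P).M_comp]
  | bij f hf =>
    obtain ⟨g, h₁, h₂⟩ := exists_inverse f hf
    rw [N_eq_R h₁ h₂, (norms P).M_eq_R h₁ h₂, map_comp_R]
    rfl
  | empty Y =>
    obtain rfl : φ = R (fromEmpty U) := isTerminalEmpty.hom_ext _ _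
    rw [map_R_comp_N, map_R]
  | sum f h₁ h₂ =>
    rename_i X X' Y
    have hf : f = (fold Y).comp (sumMap (f.comp (inl X X')) (f.comp (inr X X'))) := by
      rw [fold_comp_sumMap, elim_comp_inl_inr]
    rw [hf, ← N_comp, ← Category.assoc, map_comp_N_fold, (norms P).M_comp]
    refine congrArg _ ((norms P).ext_sum ?_ ?_)
    · rw [(norms P).bc (IsPull.sum_inl _ _)]
      change restrict _ _ = (norms P).M _ (restrict _ _)
      rw [← map_comp_R, ← map_comp_R, ← h₁, Category.assoc, N_comp_R (IsPull.sum_inl _ _),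
        Category.assoc]
    · rw [(norms P).bc (IsPull.sum_inr _ _)]
      change restrict _ _ = (norms P).M _ (restrict _ _)
      rw [← map_comp_R, ← map_comp_R, ← h₂, Category.assoc, N_comp_R (IsPull.sum_inr _ _),
        Category.assoc]
  | toPoint =>
    obtain ⟨B, n, r, hn, rfl⟩ := exists_eq_comp_T φ
    exact map_comp_T_comp_N_toPoint hn r c

theorem map_comp (φ : X ⟶ Y) (ψ : Y ⟶ Z) (c : EP P X) : map (φ ≫ ψ) c = map ψ (map φ c) := by
  induction ψ using Quotient.inductionOn with
  | _ ω =>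
  refine (congrArg (fun ψ => map (φ ≫ ψ) c) (mk_eq ω)).trans ?_
  rw [← Category.assoc, ← Category.assoc, map_comp_T, map_comp_N, map_comp_R]
  rfl

end EP

/-! ### The Tambara functor of a pair -/

namespace FinGSet

variable {G : Type} [Group G]

/-- Product preservation only has to be checked for the empty set and disjoint unions. -/
theorem preservesFiniteProducts (F : FinGSet G ⥤ Type w) (e : F.obj (empty G))
    (he : ∀ c : F.obj (empty G), c = e)
    (h : ∀ X Y : FinGSet G, Function.Bijective fun c : F.obj (sum X Y) =>
      (F.map (R (inl X Y)) c, F.map (R (inr X Y)) c)) : PreservesFiniteProducts F := by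
  have hp (X Y : FinGSet G) : HasLimit (pair X Y) := ⟨⟨⟨_, isProduct X Y⟩⟩⟩
  have : HasBinaryProducts (FinGSet G) := hasBinaryProducts_of_hasLimit_pair _
  have : HasTerminal (FinGSet G) := isTerminalEmpty.hasTerminal
  have : HasFiniteProducts (FinGSet G) := hasFiniteProducts_of_has_binary_and_terminal
  have : PreservesLimit (Functor.empty.{0} (FinGSet G)) F :=
    preservesLimit_of_preserves_limit_cone isTerminalEmpty
      ((isLimitMapConeEmptyConeEquiv F (empty G)).symm
        ((Types.isTerminalEquivUnique _).symm ⟨⟨e⟩, he⟩))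
  have : PreservesLimitsOfShape (Discrete PEmpty.{1}) F :=
    preservesLimitsOfShape_pempty_of_preservesTerminal F
  have (X Y : FinGSet G) : PreservesLimit (pair X Y) F := by
    refine preservesLimit_of_preserves_limit_cone (isProduct X Y)
      ((isLimitMapConeBinaryFanEquiv F _ _).symm ?_)
    -- The comparison with the cartesian product is the bijection of `h`.
    exact IsLimit.ofIsoLimit (Types.binaryProductLimit (F.obj X) (F.obj Y))
      (BinaryFan.ext (Equiv.ofBijective _ (h X Y)).toIso rfl rfl).symm
  have : PreservesLimitsOfShape (Discrete WalkingPair) F :=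
    ⟨fun {K} => preservesLimit_of_iso_diagram F (diagramIsoPair K).symm⟩
  exact .of_preserves_binary_and_terminal F

end FinGSet

namespace EP

open FinGSet MulAction

variable {G : Type} [Group G] [Finite G] {χ : G} [OrderTwo χ]

/-- The Tambara functor `X ↦ EP P X`. -/
noncomputable def tambaraFunctor (P : TambaraPair.{w} χ) : TambaraFunctor.{w} G where
  obj :=
    { obj := fun X => EP P X
      map := fun φ => TypeCat.ofHom (map φ)
      map_id := fun X => ConcreteCategory.hom_ext _ _ fun c => map_id c
      map_comp := fun φ ψ => ConcreteCategory.hom_ext _ _ fun c => map_comp φ ψ c }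
  property := by
    have := (transfers P).subsingleton_empty
    refine preservesFiniteProducts _ (Classical.choice (transfers P).nonempty_empty)
      (fun _ => Subsingleton.elim (α := EP P (FinGSet.empty G)) _ _) fun X Y => ?_
    have h : (fun c : EP P (sum X Y) => (map (R (inl X Y)) c, map (R (inr X Y)) c)) =
        fun c => (restrict (inl X Y) c, restrict (inr X Y) c) :=
      funext fun c => Prod.ext (map_R _ c) (map_R _ c)
    exact (congrArg Function.Bijective h).mpr (sum_bijective X Y)

variable {P Q : TambaraPair.{w} χ} {X Y : FinGSet G}

theorem tambaraFunctor_transfers : (tambaraFunctor P).transfers = transfers P :=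
  SemiMackey.ext (funext fun _ => funext fun _ => funext fun f => funext fun c => map_R f c)
    (funext fun _ => funext fun _ => funext fun f => funext fun c => map_T f c)

theorem tambaraFunctor_norms : (tambaraFunctor P).norms = norms P :=
  SemiMackey.ext (funext fun _ => funext fun _ => funext fun f => funext fun c => map_R f c)
    (funext fun _ => funext fun _ => funext fun f => funext fun c => map_N f c)

/-- A morphism of pairs acts by composition. -/
def comp (φ : P ⟶ Q) (c : EP P X) : EP Q X where
  u := ⟨fun x => φ.onA (c.u x), fun g x => by rw [map_smul, φ.smul]; rfl⟩
  v x := φ.onB (c.v x)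
  compat x := (congrArg φ.onA (c.compat x)).trans (φ.res _)

theorem comp_transfer (φ : P ⟶ Q) (f : X →[G] Y) (c : EP P X) :
    comp φ ((transfers P).M f c) = (transfers Q).M f (comp φ c) := by
  refine SemiMackey.map_M χ (s := transfers P) (s' := transfers Q) (fun X c => comp φ c)
    (fun _ _ => rfl) (fun X a b => ?_) (fun X => ?_) (fun a => ?_) f c
  · refine ext_apply (fun x => ?_) fun x => ?_
    · rw [add_u]
      exact (congrArg φ.onA (add_u a b x)).trans (_root_.map_add φ.onA _ _)
    · rw [add_v]
      exact (congrArg φ.onB (add_v a b x)).trans (_root_.map_add φ.onB _ _)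
  · refine ext_apply (fun x => ?_) fun x => ?_
    · rw [zero_u]
      exact (congrArg φ.onA (zero_u x)).trans (map_zero φ.onA)
    · rw [zero_v]
      exact (congrArg φ.onB (zero_v x)).trans (map_zero φ.onB)
  · refine ext_point fun x => ?_
    rw [trc_v]
    exact (congrArg φ.onB (trc_v a x)).trans (φ.trc _)

theorem comp_norm (φ : P ⟶ Q) (f : X →[G] Y) (c : EP P X) :
    comp φ ((norms P).M f c) = (norms Q).M f (comp φ c) := by
  refine SemiMackey.map_M χ (s := norms P) (s' := norms Q) (fun X c => comp φ c)
    (fun _ _ => rfl) (fun X a b => ?_) (fun X => ?_) (fun a => ?_) f c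
  · refine ext_apply (fun x => ?_) fun x => ?_
    · rw [mul_u]
      exact (congrArg φ.onA (mul_u a b x)).trans (_root_.map_mul φ.onA _ _)
    · rw [mul_v]
      exact (congrArg φ.onB (mul_v a b x)).trans (_root_.map_mul φ.onB _ _)
  · refine ext_apply (fun x => ?_) fun x => ?_
    · rw [one_u]
      exact (congrArg φ.onA (one_u x)).trans (map_one φ.onA)
    · rw [one_v]
      exact (congrArg φ.onB (one_v x)).trans (map_one φ.onB)
  · refine ext_point fun x => ?_
    rw [nrm_v]
    exact (congrArg φ.onB (nrm_v a x)).trans (φ.nrm _)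

theorem comp_map (φ : P ⟶ Q) (ψ : X ⟶ Y) (c : EP P X) : comp φ (map ψ c) = map ψ (comp φ c) := by
  induction ψ using Quotient.inductionOn with
  | _ ω =>
  exact (comp_transfer φ ω.r _).trans (congrArg _ (comp_norm φ ω.q _))

/-- The functor `P ↦ EP P` from Tambara pairs to Tambara functors. -/
noncomputable def functor (χ : G) [OrderTwo χ] : TambaraPair.{w} χ ⥤ TambaraFunctor.{w} G where
  obj := tambaraFunctor
  map φ := ObjectProperty.homMk
    { app := fun _ => TypeCat.ofHom (comp φ)
      naturality := fun _ _ ψ => ConcreteCategory.hom_ext _ _ fun c => comp_map φ ψ c }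
  map_id _ := rfl
  map_comp _ _ := rfl

theorem isExplicitInverse :
    IsExplicitInverse χ (functor.{w} χ) fun P X => Equiv.refl (EP P X) where
  map_u _ _ _ _ := rfl
  map_v _ _ _ _ := rfl
  R_u _ _ _ f c x := congrArg (fun d => d.u x) (map_R f c)
  R_v _ _ _ f c x := congrArg (fun d => d.v x) (map_R f c)
  T_u _ _ _ f c y := (congrArg (fun d => d.u y) (map_T f c)).trans (transfer_u f c y)
  T_v _ _ _ f X₁ hX c y :=
    (congrArg (fun d => d.v y) (map_T f c)).trans (transfer_v f X₁ hX c y)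
  N_u _ _ _ f c y := (congrArg (fun d => d.u y) (map_N f c)).trans (norm_u f c y)
  N_v _ _ _ f X₁ hX c y :=
    (congrArg (fun d => d.v y) (map_N f c)).trans (norm_v f X₁ hX c y)

/-! ### The pair of `EP P` is `P` -/

/-- The value of `EP P` at the point is `P.B`: the component `u` is determined by `v`. -/
def pointEquiv (P : TambaraPair.{w} χ) : EP P (point G) ≃ P.B where
  toFun c := c.v ⟨PUnit.unit, fun _ => rfl⟩
  invFun b := ⟨⟨fun _ => P.res b, fun g _ => (P.smul_res g b).symm⟩, fun _ => b, fun _ => rfl⟩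
  left_inv _ := ext_point fun _ => rfl
  right_inv _ := rfl

theorem not_mem_fixedPoints_regular (χ : G) [OrderTwo χ] (x : regular G) :
    x ∉ fixedPoints G (regular G) := fun hx =>
  OrderTwo.ne_one (χ := χ) (mul_eq_right.1 (show χ * elt x = elt x from hx χ))

/-- The value of `EP P` at `G` is `P.A`: an equivariant map on `G` is determined by its value at
`1`, and there are no fixed points. -/
def regularEquiv (P : TambaraPair.{w} χ) : EP P (regular G) ≃ P.A where
  toFun c := c.u (1 : G)
  invFun a := ⟨⟨fun x => elt x • a, fun g x => mul_smul g (elt x) a⟩,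
    fun x => (not_mem_fixedPoints_regular χ x.1 x.2).elim,
    fun x => (not_mem_fixedPoints_regular χ x.1 x.2).elim⟩
  left_inv c := ext_apply
    (fun x => (map_smul c.u (elt x) (show regular G from (1 : G))).symm.trans
      (congrArg c.u (mul_one (elt x))))
    fun x => (not_mem_fixedPoints_regular χ x.1 x.2).elim
  right_inv a := one_smul G a

theorem tambaraFunctor_add (a b : EP P X) :
    (tambaraFunctor P).add X a b = (transfers P).op a b :=
  congrArg (fun s => s.op a b) tambaraFunctor_transfers

theorem tambaraFunctor_mul (a b : EP P X) :
    (tambaraFunctor P).mul X a b = (norms P).op a b :=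
  congrArg (fun s => s.op a b) tambaraFunctor_norms

theorem tambaraFunctor_zero (X : FinGSet G) : (tambaraFunctor P).zero X = (transfers P).unit X :=
  ((tambaraFunctor P).transfers_unit X).symm.trans
    (congrArg (fun s : SemiMackey (EP P) => s.unit X) tambaraFunctor_transfers)

theorem tambaraFunctor_one (X : FinGSet G) : (tambaraFunctor P).one X = (norms P).unit X :=
  ((tambaraFunctor P).norms_unit X).symm.trans
    (congrArg (fun s : SemiMackey (EP P) => s.unit X) tambaraFunctor_norms)

/-- Evaluation at `1 ∈ G` and at the point, as a morphism of pairs. -/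
noncomputable def eval (P : TambaraPair.{w} χ) : (tambaraFunctor P).toPair χ ⟶ P where
  onA :=
    { toFun := regularEquiv P
      map_zero' := (congrArg (regularEquiv P) (tambaraFunctor_zero _)).trans (zero_u _)
      map_one' := (congrArg (regularEquiv P) (tambaraFunctor_one _)).trans (one_u _)
      map_add' := fun a b => (congrArg (regularEquiv P) (tambaraFunctor_add a b)).trans
        (add_u a b _)
      map_mul' := fun a b => (congrArg (regularEquiv P) (tambaraFunctor_mul a b)).trans
        (mul_u a b _) }
  onB :=
    { toFun := pointEquiv P
      map_zero' := (congrArg (pointEquiv P) (tambaraFunctor_zero _)).trans (zero_v _)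
      map_one' := (congrArg (pointEquiv P) (tambaraFunctor_one _)).trans (one_v _)
      map_add' := fun a b => (congrArg (pointEquiv P) (tambaraFunctor_add a b)).trans
        (add_v a b _)
      map_mul' := fun a b => (congrArg (pointEquiv P) (tambaraFunctor_mul a b)).trans
        (mul_v a b _) }
  smul g a := by
    change EP P (regular G) at a
    refine (congrArg (regularEquiv P) (map_R (rightMul g) a)).trans ?_
    exact (congrArg a.u ((one_mul g).trans (mul_one g).symm)).trans
      (map_smul a.u g (show regular G from (1 : G)))
  res b := by
    change EP P (point G) at b
    exact (congrArg (regularEquiv P) (map_R (toPoint (regular G)) b)).trans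
      (b.compat ⟨PUnit.unit, fun _ => rfl⟩)
  trc a := (congrArg (pointEquiv P) (map_T (toPoint (regular G)) a)).trans (trc_v a _)
  nrm a := (congrArg (pointEquiv P) (map_N (toPoint (regular G)) a)).trans (nrm_v a _)

end EP

/-- A morphism of pairs with bijective components is an isomorphism. -/
noncomputable def TambaraPair.isoOfBijective {G : Type} [Group G] {χ : G} {P Q : TambaraPair.{w} χ}
    (φ : P ⟶ Q) (hA : Function.Bijective φ.onA) (hB : Function.Bijective φ.onB) : P ≅ Q :=
  let eA := RingEquiv.ofBijective φ.onA hA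
  let eB := RingEquiv.ofBijective φ.onB hB
  have hA' (a) : φ.onA (eA.symm a) = a := eA.apply_symm_apply a
  have hB' (b) : φ.onB (eB.symm b) = b := eB.apply_symm_apply b
  { hom := φ
    inv :=
      { onA := eA.symm
        onB := eB.symm
        smul := fun g a => hA.1 (by
          refine (hA' _).trans (Eq.symm ((φ.smul g _).trans ?_))
          exact congrArg _ (hA' a))
        res := fun b => hA.1 (by
          refine (hA' _).trans (Eq.symm ((φ.res _).trans ?_))
          exact congrArg _ (hB' b))
        trc := fun a => hB.1 (by
          refine (hB' _).trans (Eq.symm ((φ.trc _).trans ?_))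
          exact congrArg _ (hA' a))
        nrm := fun a => hB.1 (by
          refine (hB' _).trans (Eq.symm ((φ.nrm _).trans ?_))
          exact congrArg _ (hA' a)) }
    hom_inv_id := TambaraPair.Hom.ext (RingHom.ext eA.symm_apply_apply)
      (RingHom.ext eB.symm_apply_apply)
    inv_hom_id := TambaraPair.Hom.ext (RingHom.ext hA') (RingHom.ext hB') }

/-! ### A Tambara functor is determined by its pair -/

/-- A family of maps that is compatible with restrictions is bijective if it is so for the empty
set, the point and `G`. -/
theorem SemiMackey.bijective {G : Type} [Group G] [Finite G] (χ : G) [OrderTwo χ]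
    {E : FinGSet G → Type w} {E' : FinGSet G → Type w'} (s : SemiMackey E) (s' : SemiMackey E')
    (φ : ∀ X, E X → E' X)
    (hR : ∀ {X Y : FinGSet G} (f : X →[G] Y) c, φ X (s.R f c) = s'.R f (φ Y c))
    (hpoint : Function.Bijective (φ (FinGSet.point G)))
    (hregular : Function.Bijective (φ (FinGSet.regular G))) (X : FinGSet G) :
    Function.Bijective (φ X) := by
  induction X using FinGSet.induction_on χ with
  | iso f hf ih =>
    obtain ⟨g, h₁, h₂⟩ := FinGSet.exists_inverse f hf
    have e (c) : s.R g (s.R f c) = c := by rw [← s.R_comp, h₁, s.R_id]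
    have e' (c) : s'.R g (s'.R f c) = c := by rw [← s'.R_comp, h₁, s'.R_id]
    have k (c) : s'.R f (s'.R g c) = c := by rw [← s'.R_comp, h₂, s'.R_id]
    refine ⟨fun c d h => ?_, fun c => ?_⟩
    · rw [← e c, ih.1 ((hR f c).trans ((congrArg _ h).trans (hR f d).symm)), e]
    · obtain ⟨d, hd⟩ := ih.2 (s'.R f c)
      exact ⟨s.R g d, by rw [hR, hd, e']⟩
  | empty =>
    have := s.subsingleton_empty
    have := s'.subsingleton_empty
    obtain ⟨e⟩ := s.nonempty_empty
    exact ⟨fun _ _ _ => Subsingleton.elim _ _, fun c => ⟨e, Subsingleton.elim _ _⟩⟩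
  | point => exact hpoint
  | regular => exact hregular
  | sum ih₁ ih₂ =>
    rename_i X Y
    refine ⟨fun c d h => s.ext_sum (ih₁.1 ?_) (ih₂.1 ?_), fun c => ?_⟩
    · rw [hR, hR, h]
    · rw [hR, hR, h]
    · obtain ⟨a, ha⟩ := ih₁.2 (s'.R (FinGSet.inl X Y) c)
      obtain ⟨b, hb⟩ := ih₂.2 (s'.R (FinGSet.inr X Y) c)
      refine ⟨s.pair a b, s'.ext_sum ?_ ?_⟩
      · rw [← hR, s.R_inl_pair, ha]
      · rw [← hR, s.R_inr_pair, hb]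

namespace TambaraFunctor

open FinGSet MulAction

variable {G : Type} [Group G] [Finite G] (χ : G) [OrderTwo χ] (S : TambaraFunctor.{w} G)
  {X Y : FinGSet G}

/-- The restrictions of an element of `S(X)` along all maps `G → X` and `1 → X`, which correspond
to the points and the fixed points of `X`. -/
noncomputable def toEP (c : S.obj.obj X) : EP (S.toPair χ) X where
  u := ⟨fun x => S.transfers.R (orbitMap x) c, fun g x => by
    have h : orbitMap (g • x) = (orbitMap x).comp (rightMul g) :=
      MulActionHom.ext fun k => (mul_smul (elt k) g x).symm
    rw [h, S.transfers.R_comp]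
    rfl⟩
  v x := S.transfers.R (fixedMap x.1 x.2) c
  compat x := by
    have h : orbitMap x.1 = (fixedMap x.1 x.2).comp (toPoint (regular G)) :=
      MulActionHom.ext fun k => x.2 (elt k)
    change S.transfers.R (orbitMap x.1) c = _
    rw [h, S.transfers.R_comp]
    rfl

theorem toEP_R (f : X →[G] Y) (c : S.obj.obj Y) :
    S.toEP χ (S.transfers.R f c) = EP.restrict f (S.toEP χ c) := by
  refine EP.ext_apply (fun x => ?_) fun x => ?_
  · have h : orbitMap (f x) = f.comp (orbitMap x) :=
      MulActionHom.ext fun k => (map_smul f (elt k) x).symm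
    change S.transfers.R (orbitMap x) (S.transfers.R f c) = S.transfers.R (orbitMap (f x)) c
    rw [h, S.transfers.R_comp]
  · exact (S.transfers.R_comp (fixedMap x.1 x.2) f c).symm

theorem regularEquiv_toEP (c : S.obj.obj (regular G)) :
    EP.regularEquiv (S.toPair χ) (S.toEP χ c) = c := by
  have h : orbitMap (X := regular G) (1 : G) = MulActionHom.id G :=
    MulActionHom.ext fun k => mul_one (elt k)
  change S.transfers.R (orbitMap (X := regular G) (1 : G)) c = c
  rw [h, S.transfers.R_id]

theorem pointEquiv_toEP (c : S.obj.obj (point G)) :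
    EP.pointEquiv (S.toPair χ) (S.toEP χ c) = c :=
  S.transfers.R_id c

theorem toEP_transfer (f : X →[G] Y) (c : S.obj.obj X) :
    S.toEP χ (S.transfers.M f c) = (EP.transfers _).M f (S.toEP χ c) := by
  refine SemiMackey.map_M χ (s := S.transfers) (s' := EP.transfers (S.toPair χ))
    (fun X c => S.toEP χ c) (S.toEP_R χ) (fun X a b => ?_) (fun X => ?_) (fun a => ?_) f c
  · refine EP.ext_apply (fun x => ?_) fun x => ?_
    · rw [EP.add_u]
      exact S.transfers.R_op _ a b
    · rw [EP.add_v]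
      exact S.transfers.R_op _ a b
  · refine EP.ext_apply (fun x => ?_) fun x => ?_
    · rw [EP.zero_u]
      exact (S.transfers.R_unit _).trans (S.transfers_unit _)
    · rw [EP.zero_v]
      exact (S.transfers.R_unit _).trans (S.transfers_unit _)
  · refine (EP.pointEquiv (S.toPair χ)).injective ((S.pointEquiv_toEP χ _).trans ?_)
    refine Eq.trans ?_ (EP.trc_v (S.toEP χ a) _).symm
    exact congrArg (S.toPair χ).trc (S.regularEquiv_toEP χ a).symm

theorem toEP_norm (f : X →[G] Y) (c : S.obj.obj X) :
    S.toEP χ (S.norms.M f c) = (EP.norms _).M f (S.toEP χ c) := by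
  refine SemiMackey.map_M χ (s := S.norms) (s' := EP.norms (S.toPair χ))
    (fun X c => S.toEP χ c) (S.toEP_R χ) (fun X a b => ?_) (fun X => ?_) (fun a => ?_) f c
  · refine EP.ext_apply (fun x => ?_) fun x => ?_
    · rw [EP.mul_u]
      exact S.norms.R_op _ a b
    · rw [EP.mul_v]
      exact S.norms.R_op _ a b
  · refine EP.ext_apply (fun x => ?_) fun x => ?_
    · rw [EP.one_u]
      exact (S.norms.R_unit _).trans (S.norms_unit _)
    · rw [EP.one_v]
      exact (S.norms.R_unit _).trans (S.norms_unit _)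
  · refine (EP.pointEquiv (S.toPair χ)).injective ((S.pointEquiv_toEP χ _).trans ?_)
    refine Eq.trans ?_ (EP.nrm_v (S.toEP χ a) _).symm
    exact congrArg (S.toPair χ).nrm (S.regularEquiv_toEP χ a).symm

theorem toEP_map (ψ : X ⟶ Y) (c : S.obj.obj X) :
    S.toEP χ (S.obj.map ψ c) = EP.map ψ (S.toEP χ c) := by
  induction ψ using Quotient.inductionOn with
  | _ ω =>
  refine (congrArg (S.toEP χ) (S.map_eq ω c)).trans ((S.toEP_transfer χ ω.r _).trans ?_)
  refine congrArg _ ((S.toEP_norm χ ω.q _).trans ?_)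
  exact congrArg _ (S.toEP_R χ ω.p c)

theorem toEP_bijective (X : FinGSet G) : Function.Bijective (S.toEP χ : S.obj.obj X → _) := by
  refine SemiMackey.bijective χ S.transfers (EP.transfers (S.toPair χ)) (fun X c => S.toEP χ c)
    (S.toEP_R χ) ?_ ?_ X
  · refine (EP.pointEquiv (S.toPair χ)).bijective.of_comp_iff' _ |>.1 ?_
    rw [show EP.pointEquiv (S.toPair χ) ∘ S.toEP χ = id from funext (S.pointEquiv_toEP χ)]
    exact Function.bijective_id
  · refine (EP.regularEquiv (S.toPair χ)).bijective.of_comp_iff' _ |>.1 ?_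
    rw [show EP.regularEquiv (S.toPair χ) ∘ S.toEP χ = id from funext (S.regularEquiv_toEP χ)]
    exact Function.bijective_id

/-- The isomorphism from `S` to the Tambara functor of its pair. -/
noncomputable def isoEP : S ≅ EP.tambaraFunctor (S.toPair χ) :=
  ObjectProperty.isoMk _ (NatIso.ofComponents
    (fun X => (Equiv.ofBijective _ (S.toEP_bijective χ X)).toIso)
    fun ψ => ConcreteCategory.hom_ext _ _ fun c => S.toEP_map χ ψ c)

/-- The equivalence between Tambara functors and Tambara pairs. The naturality of `toEP` in `S` is
the compatibility of a morphism of Tambara functors with restrictions. -/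
noncomputable def equivalence : TambaraFunctor.{w} G ≌ TambaraPair.{w} χ :=
  CategoryTheory.Equivalence.mk (toPairFunctor χ) (EP.functor χ)
    (NatIso.ofComponents (fun S => S.isoEP χ) fun φ =>
      ObjectProperty.hom_ext _ (NatTrans.ext (funext fun _ =>
        ConcreteCategory.hom_ext _ _ fun c => EP.ext_apply
          (fun x => (app_map φ (R (orbitMap x)) c).symm)
          fun x => (app_map φ (R (fixedMap x.1 x.2)) c).symm)))
    (NatIso.ofComponents
      (fun P => TambaraPair.isoOfBijective (EP.eval P) (EP.regularEquiv P).bijective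
        (EP.pointEquiv P).bijective) fun _ => rfl)

end TambaraFunctor

theorem mainTheorem2 (G : Type) [Group G] [Finite G] (hG : Nat.card G = 2) (χ : G) (hχ : χ ≠ 1) :
    ∃ e : TambaraFunctor.{w} G ≌ TambaraPair.{w} χ,
      e.functor ⋙ TambaraPair.forget χ = TambaraFunctor.pairFunctor G ∧
      ∃ ι : ∀ (P : TambaraPair.{w} χ) (X : FinGSet G), (e.inverse.obj P).obj.obj X ≃ EP P X,
        IsExplicitInverse χ e.inverse ι := by
  have := OrderTwo.of_card hG hχ
  exact ⟨TambaraFunctor.equivalence χ, TambaraFunctor.toPairFunctor_comp_forget χ,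
    fun P X => Equiv.refl (EP P X), EP.isExplicitInverse⟩
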